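/- Let $d\ge 1$, $d-1<s<d$, $\beta>0$, and $g(x)=\|x\|^{-s}$ on $\mathbb R^d$ (Euclidean norm, $g(0)=+\infty$). **Configurations.** Let $\mathcal C$ be the set of subsets $\gamma\subset\mathbb R^d$ with finitely many points in every bounded Borel set, $N_A(\gamma)=|\gamma\cap A|$, $\gamma_A=\gamma\cap A$. For a Borel set $\Lambda$ let $\mathcal F_\Lambda$ be the $\sigma$-algebra generated by the $N_A$ with $A\subset\Lambda$ bounded Borel; $\mathcal C$ carries $\mathcal F=\mathcal F_{\mathbb R^d}$. A function $f:\mathcal C\to\mathbb R$ is local and tame if for some bounded Borel $A$ and some $b\in\mathbb R$ it is $\mathcal F_A$-measurable and $|f|\le b(1+N_A)$. The local topology on measures on $\mathcal C$ is the coarsest one making $\mathbb P\mapsto\int f\,d\mathbb P$ continuous for all local tame $f$. **Gases.** For $n\ge 1$ let $\Lambda_n=[-n^{1/d}/2,n^{1/d}/2]^d$, $$g_n(x)=\sum_{k\in\mathbb Z^d}\Big(g(x+kn^{1/d})-\frac1n\int_{\Lambda_n}g(y+kn^{1/d})\,dy\Big),\qquad H_n(\gamma)=\sum_{\{x,y\}\subset\gamma}g_n(x-y),$$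 and let $\mathcal B_{A,N}$ be the binomial process, i.e. the law of $\{X_1,\dots,X_N\}$ with $X_i$ independent and uniform in $A$ (for $N=0$ the Dirac mass at $\emptyset$). Let $\mathbb P^\beta_n=\frac1{Z^\beta_n}e^{-\beta H_n}\mathcal B_{\Lambda_n,n}$ with $Z_n^\beta=\int e^{-\beta H_n}d\mathcal B_{\Lambda_n,n}$. A $\beta$-circular Riesz gas is a probability measure on $\mathcal C$ that is an accumulation point of $(\mathbb P^\beta_n)_{n\ge1}$ (as $n\to\infty$) for the local topology. **Theorem.** Let $\mathbb P^\beta$ be a $\beta$-circular Riesz gas and $\Delta\subset\mathbb R^d$ a bounded Borel set. For $p\ge1$ and $\eta,\gamma\in\mathcal C$ put $$M^{(p)}_\Delta(\eta,\gamma)=\sum_{x\in\eta_\Delta}\ \sum_{y\in\gamma_{\Lambda_p\setminus\Delta}}\big[g(x-y)-g(y)\big].$$ 1. For $\mathbb P^\beta$-almost every $\gamma$, $0\notin\gamma$ and, for every $\eta\in\mathcal C$, the limit $M_\Delta(\eta,\gamma)=\lim_{p\to\infty}M_\Delta^{(p)}(\eta,\gamma)$ exists and is finite. 2. With $H(\eta)=\sum_{\{x,y\}\subset\eta}g(x-y)$,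 for $\mathbb P^\beta$-almost every $\gamma$, $$Z^\beta_\Delta(\gamma)=\int e^{-\beta(H(\eta)+M_\Delta(\eta,\gamma))}\,\mathcal B_{\Delta,N_\Delta(\gamma)}(d\eta)\in(0,\infty).$$ 3. For every bounded measurable $f:\mathcal C\to\mathbb R$, the function $$f_\Delta(\gamma)=\int\frac1{Z^\beta_\Delta(\gamma)}f(\eta\cup\gamma_{\Delta^c})\,e^{-\beta(H(\eta)+M_\Delta(\eta,\gamma))}\,\mathcal B_{\Delta,N_\Delta(\gamma)}(d\eta)$$ is $\mathbb P^\beta$-integrable and satisfies the canonical DLR equation $$\int f\,d\mathbb P^\beta=\int f_\Delta\,d\mathbb P^\beta .$$ Equivalently, $f_\Delta=E_{\mathbb P^\beta}[f\mid\mathcal E_\Delta]$ $\mathbb P^\beta$-almost surely, where $\mathcal E_\Delta=\sigma(N_\Delta,\mathcal F_{\Delta^c})$. -/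

import Mathlib

open MeasureTheory Filter Topology

noncomputable section

namespace RieszGas

/-- `ℝ^d` with the Euclidean norm. -/
abbrev Space (d : ℕ) : Type := EuclideanSpace ℝ (Fin d)

/-! ### Point configurations -/

/-- Point configurations: subsets of `ℝ^d` with finitely many points in every bounded Borel set. -/
@[ext]
structure Configuration (d : ℕ) where
  carrier : Set (Space d)
  locallyFinite : ∀ A : Set (Space d), MeasurableSet A → Bornology.IsBounded A →
    (carrier ∩ A).Finite

namespace Configuration

/-- The restriction `γ_A = γ ∩ A`. -/
def restrict {d : ℕ} (γ : Configuration d) (A : Set (Space d)) : Configuration d where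
  carrier := γ.carrier ∩ A
  locallyFinite := fun B hB hb =>
    (γ.locallyFinite B hB hb).subset (fun _ hx => ⟨hx.1.1, hx.2⟩)

/-- The union of two configurations. -/
def union {d : ℕ} (η γ : Configuration d) : Configuration d where
  carrier := η.carrier ∪ γ.carrier
  locallyFinite := fun B hB hb => by
    rw [Set.union_inter_distrib_right]
    exact (η.locallyFinite B hB hb).union (γ.locallyFinite B hB hb)

/-- The configuration `{x_1, …, x_N}`. -/
def ofPoints {d N : ℕ} (x : Fin N → Space d) : Configuration d where
  carrier := Set.range x
  locallyFinite := fun _ _ _ => (Set.finite_range x).subset Set.inter_subset_left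

/-- The counting function `N_A(γ) = |γ ∩ A|` (used for bounded Borel sets `A`). -/
def count {d : ℕ} (A : Set (Space d)) (γ : Configuration d) : ℕ := (γ.carrier ∩ A).ncard

end Configuration

/-- The `σ`-algebra `F_Λ` generated by the counting functions `N_A`, for `A ⊆ Λ` bounded Borel. -/
@[reducible]
def sigmaOf (d : ℕ) (Λ : Set (Space d)) : MeasurableSpace (Configuration d) :=
  ⨆ A : {A : Set (Space d) // MeasurableSet A ∧ Bornology.IsBounded A ∧ A ⊆ Λ},
    MeasurableSpace.comap (Configuration.count A.1) ⊤

instance instMeasurableSpaceConfiguration (d : ℕ) : MeasurableSpace (Configuration d) :=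
  sigmaOf d Set.univ

/-- The `σ`-algebra `E_Δ` generated by `N_Δ` and the configuration outside `Δ`. -/
@[reducible]
def exteriorSigma {d : ℕ} (Δ : Set (Space d)) : MeasurableSpace (Configuration d) :=
  MeasurableSpace.comap (Configuration.count Δ) ⊤ ⊔ sigmaOf d Δᶜ

/-! ### Local topology -/

/-- Local tame functions: for some bounded Borel `A` and some `b`, the function is
`F_A`-measurable and bounded by `b (1 + N_A)`. -/
def IsLocalTame {d : ℕ} (f : Configuration d → ℝ) : Prop :=
  ∃ A : Set (Space d), MeasurableSet A ∧ Bornology.IsBounded A ∧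
    Measurable[sigmaOf d A] f ∧
    ∃ b : ℝ, ∀ γ, |f γ| ≤ b * (1 + (Configuration.count A γ : ℝ))

/-- The local topology: the coarsest one for which `P ↦ ∫ f dP` is continuous for every local
tame `f`. -/
@[reducible]
def localTopology (d : ℕ) : TopologicalSpace (Measure (Configuration d)) :=
  ⨅ f : {f : Configuration d → ℝ // IsLocalTame f},
    TopologicalSpace.induced (fun P => ∫ γ, f.1 γ ∂P) inferInstance

/-! ### Riesz interaction and its periodization -/

/-- The Riesz potential `g(x) = ‖x‖^{-s}`, for `x ≠ 0`. (In Lean the value at `0` is `0`. The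
energies below evaluate `g` at differences of distinct points. The remaining occurrences of `g(0)`
lie in null sets, see the comments at `periodicRiesz` and `truncatedMove`.) -/
def riesz {d : ℕ} (s : ℝ) (x : Space d) : ℝ := ‖x‖ ^ (-s)

/-- The side length `n^{1/d}`. -/
def side (d n : ℕ) : ℝ := (n : ℝ) ^ ((1 : ℝ) / (d : ℝ))

/-- The box `Λ_n = [-n^{1/d}/2, n^{1/d}/2]^d` of volume `n`. -/
def box (d n : ℕ) : Set (Space d) := {x | ∀ i, |x i| ≤ side d n / 2}

/-- The vector `n^{1/d} k` for `k ∈ ℤ^d`. -/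
def latticeVec (d n : ℕ) (k : Fin d → ℤ) : Space d :=
  side d n • WithLp.toLp 2 (fun i => (k i : ℝ))

/-- The periodized potential
`g_n(x) = ∑_{k ∈ ℤ^d} (g(x + k n^{1/d}) - (1/n) ∫_{Λ_n} g(y + k n^{1/d}) dy)`;
the series converges absolutely for `d - 1 < s < d`. The value at points `x ∈ n^{1/d} ℤ^d` is
immaterial: it only enters for configurations with two points differing by such a vector, which
form a null set for the binomial process. -/
def periodicRiesz {d : ℕ} (s : ℝ) (n : ℕ) (x : Space d) : ℝ :=
  ∑' k : Fin d → ℤ,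
    (riesz s (x + latticeVec d n k)
      - (1 / (n : ℝ)) * ∫ y in box d n, riesz s (y + latticeVec d n k))

/-- The pair energy `∑_{{x,y} ⊂ γ} φ(x - y)` of a finite configuration for an even potential `φ`,
written as half of the sum over ordered pairs of distinct points. -/
def pairEnergy {d : ℕ} (φ : Space d → ℝ) (γ : Configuration d) : ℝ :=
  (1 / 2) * ∑ᶠ p ∈ γ.carrier.offDiag, φ (p.1 - p.2)

/-- `H(γ) = ∑_{{x,y} ⊂ γ} g(x - y)`. -/
def energy {d : ℕ} (s : ℝ) (γ : Configuration d) : ℝ := pairEnergy (riesz s) γ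

/-- `H_n(γ) = ∑_{{x,y} ⊂ γ} g_n(x - y)`. -/
def periodicEnergy {d : ℕ} (s : ℝ) (n : ℕ) (γ : Configuration d) : ℝ :=
  pairEnergy (periodicRiesz s n) γ

/-! ### Gibbs measures on the torus and their limits -/

/-- The binomial point process: `N` independent uniform points in `A`. For `N = 0` it is the
Dirac mass at the empty configuration, whatever `A` is. -/
def binomialProcess {d : ℕ} (A : Set (Space d)) (N : ℕ) : Measure (Configuration d) :=
  Measure.map Configuration.ofPoints
    (Measure.pi (fun _ : Fin N => ProbabilityTheory.cond (volume : Measure (Space d)) A))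

/-- The canonical partition function `Z_n^β`. -/
def torusPartition (d : ℕ) (s β : ℝ) (n : ℕ) : ℝ :=
  ∫ γ, Real.exp (-β * periodicEnergy s n γ) ∂(binomialProcess (box d n) n)

/-- The canonical Gibbs measure `P_n^β = (1 / Z_n^β) e^{-β H_n} Bin_{Λ_n, n}`. -/
def torusGibbs (d : ℕ) (s β : ℝ) (n : ℕ) : Measure (Configuration d) :=
  (binomialProcess (box d n) n).withDensity
    (fun γ => ENNReal.ofReal
      ((1 / torusPartition d s β n) * Real.exp (-β * periodicEnergy s n γ)))

/-- A `β`-circular Riesz gas: a point process that is an accumulation point, for the local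
topology, of the sequence `(P_n^β)` as `n → ∞`. Limits of subsequences are accumulation points
in this sense. -/
def IsCircularRieszGas {d : ℕ} (s β : ℝ) (P : Measure (Configuration d)) : Prop :=
  IsProbabilityMeasure P ∧
    @MapClusterPt (Measure (Configuration d)) (localTopology d) ℕ P atTop (torusGibbs d s β)

/-! ### Move functions and the canonical DLR kernel -/

/-- `M_Δ^{(p)}(η, γ) = ∑_{x ∈ η_Δ} ∑_{y ∈ γ_{Λ_p ∖ Δ}} (g(x - y) - g(y))`. Here `x ≠ y`, so that
`g` is evaluated at `0` only if `0 ∈ γ`. -/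
def truncatedMove {d : ℕ} (s : ℝ) (Δ : Set (Space d)) (p : ℕ) (η γ : Configuration d) : ℝ :=
  ∑ᶠ x ∈ η.carrier ∩ Δ, ∑ᶠ y ∈ γ.carrier ∩ (box d p \ Δ), (riesz s (x - y) - riesz s y)

/-- `M_Δ(η, γ) = lim_{p → ∞} M_Δ^{(p)}(η, γ)` (wherever the limit exists). -/
def move {d : ℕ} (s : ℝ) (Δ : Set (Space d)) (η γ : Configuration d) : ℝ :=
  limUnder atTop (fun p : ℕ => truncatedMove s Δ p η γ)

/-- The weight `e^{-β (H(η) + M_Δ(η, γ))}`. -/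
def weight {d : ℕ} (s β : ℝ) (Δ : Set (Space d)) (γ η : Configuration d) : ℝ :=
  Real.exp (-β * (energy s η + move s Δ η γ))

/-- `Z_Δ^β(γ) = ∫ e^{-β (H(η) + M_Δ(η, γ))} Bin_{Δ, N_Δ(γ)}(dη)`. -/
def localPartition {d : ℕ} (s β : ℝ) (Δ : Set (Space d)) (γ : Configuration d) : ℝ :=
  ∫ η, weight s β Δ γ η ∂(binomialProcess Δ (γ.count Δ))

/-- `f_Δ(γ) = ∫ (1 / Z_Δ^β(γ)) f(η ∪ γ_{Δᶜ}) e^{-β (H(η) + M_Δ(η, γ))} Bin_{Δ, N_Δ(γ)}(dη)`. -/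
def dlrAverage {d : ℕ} (s β : ℝ) (Δ : Set (Space d)) (f : Configuration d → ℝ)
    (γ : Configuration d) : ℝ :=
  ∫ η, (1 / localPartition s β Δ γ) * f (η.union (γ.restrict Δᶜ)) * weight s β Δ γ η
    ∂(binomialProcess Δ (γ.count Δ))

end RieszGas

end

open MeasureTheory Filter Topology

noncomputable section

namespace RieszGas

open RieszGas.Configuration ProbabilityTheory Bornology

variable {d : ℕ}

/-! ### Measurability on the space of configurations -/

/-! The finite torus measures satisfy the canonical DLR equations exactly; the work is to carry them
to the limit when neither the energy nor the move function is a local observable.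

On the torus, replacing the points in `Δ` by as many fresh independent uniform points of `Δ`
preserves the binomial process (`lintegral_resample`). Hence resampling with density proportional to
`e^{-β H_n}` preserves the Gibbs measure (`torusGibbs_real_eq_integral`). Only normalised averages
appear, so `H_n` matters only up to terms not depending on the resampled points `η`. Modulo such
terms it is `H(η) + M^{(p)}(η, γ)`, by `exists_energy_comparison`. The error is at most `N_Δ(γ)`
times the sum of a tail `∑_{y ∈ γ ∖ Λ_p} (1 + |y|)^{-(s+1)}` and a quantity of order `n ·
n^{-(s+1)/d}`. The exponent `s + 1`, one better than that of `g`, comes from differences: `g(x - y)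
- g(y)` in the move function, and `g_n - g`, which is Lipschitz with constant of order
`n^{-(s+1)/d}` away from the other lattice points (`exists_lipschitz_remainder`). Since `s + 1 > d`,
the weight is integrable on `ℝ^d` and the second error vanishes as `n → ∞`.

The only probabilistic input is the intensity. Translation invariance on the torus makes it Lebesgue
measure on `Λ_n`, and the bound by Lebesgue measure passes to the limit
(`intensityLE_of_isCircularRieszGas`). It controls the means of `N_Δ` and of the tail, but not of
their product. `abs_expAverage_sub_le` therefore bounds the effect of a perturbation of size `N b`
by `θ N + 2b/θ`, in which the two quantities are separated.

Averages with the truncated move function are bounded and local, so they converge along the gases.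
`real_eq_integral_localAverage_of_local` compares them with the torus averages and with the limiting
ones, letting `n`, then `p`, tend to infinity and finally `θ` to zero. This gives the equation for
local events. A π-system argument (`map_glue_compProd_resampleKernel`) turns it into invariance of
`P` under a kernel, hence into the equation for all bounded measurable `f`. The conditional
expectation follows because the average is `E_Δ`-measurable and indicators of `E_Δ`-events pull out
of it. -/

theorem measurable_count_sigmaOf {A Λ : Set (Space d)} (hA : MeasurableSet A) (hb : IsBounded A)
    (h : A ⊆ Λ) : Measurable[sigmaOf d Λ] (count A : Configuration d → ℕ) := by
  have h1 : MeasurableSpace.comap (count A : Configuration d → ℕ) ⊤ ≤ sigmaOf d Λ :=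
    le_iSup (fun A : {A : Set (Space d) // MeasurableSet A ∧ IsBounded A ∧ A ⊆ Λ} =>
      MeasurableSpace.comap (count A.1) ⊤) ⟨A, hA, hb, h⟩
  exact (comap_measurable _).mono h1 le_rfl

theorem measurable_count {A : Set (Space d)} (hA : MeasurableSet A) (hb : IsBounded A) :
    Measurable (count A : Configuration d → ℕ) :=
  measurable_count_sigmaOf hA hb (Set.subset_univ _)

theorem measurable_to_sigmaOf {E : Type*} [MeasurableSpace E] {Λ : Set (Space d)}
    {F : E → Configuration d}
    (h : ∀ A, MeasurableSet A → IsBounded A → A ⊆ Λ → Measurable fun e => count A (F e)) :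
    Measurable[_, sigmaOf d Λ] F := by
  rw [measurable_iff_comap_le, sigmaOf, MeasurableSpace.comap_iSup]
  refine iSup_le fun A => ?_
  rw [MeasurableSpace.comap_comp, ← measurable_iff_comap_le]
  exact h A.1 A.2.1 A.2.2.1 A.2.2.2

theorem measurable_to_configuration {E : Type*} [MeasurableSpace E] {F : E → Configuration d}
    (h : ∀ A, MeasurableSet A → IsBounded A → Measurable fun e => count A (F e)) :
    Measurable F :=
  measurable_to_sigmaOf fun A hA hb _ => h A hA hb

theorem sigmaOf_mono {A B : Set (Space d)} (h : A ⊆ B) : sigmaOf d A ≤ sigmaOf d B :=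
  iSup_le fun C => (measurable_iff_comap_le).1
    (measurable_count_sigmaOf C.2.1 C.2.2.1 (C.2.2.2.trans h))

theorem sigmaOf_le (A : Set (Space d)) : sigmaOf d A ≤ instMeasurableSpaceConfiguration d :=
  sigmaOf_mono (Set.subset_univ A)

@[simp] theorem count_restrict (γ : Configuration d) (A B : Set (Space d)) :
    count B (γ.restrict A) = count (A ∩ B) γ := by
  simp [count, restrict, Set.inter_assoc]

theorem measurable_restrict_sigmaOf {A : Set (Space d)} (hA : MeasurableSet A) :
    Measurable[sigmaOf d A] fun γ : Configuration d => γ.restrict A := by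
  refine @measurable_to_sigmaOf d _ (sigmaOf d A) _ _ fun B hB hb _ => ?_
  simp only [count_restrict]
  exact measurable_count_sigmaOf (hA.inter hB) (hb.subset Set.inter_subset_right)
    Set.inter_subset_left

/-- Events of `F_A` depend only on the restriction to `A`. -/
theorem mem_iff_restrict_mem {A : Set (Space d)} {E : Set (Configuration d)}
    (hE : MeasurableSet[sigmaOf d A] E) (γ : Configuration d) : γ ∈ E ↔ γ.restrict A ∈ E := by
  -- Each generator `N_C` with `C ⊆ A` factors through the restriction to `A`, so every event of
  -- `F_A` is a preimage under it; restriction is idempotent.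
  have h : sigmaOf d A ≤
      MeasurableSpace.comap (fun γ : Configuration d => γ.restrict A) (sigmaOf d A) := by
    refine iSup_le fun C => ?_
    have h1 : (count C.1 : Configuration d → ℕ) = count C.1 ∘ fun γ => γ.restrict A := by
      funext γ
      simp [Set.inter_eq_right.2 C.2.2.2]
    rw [h1, ← MeasurableSpace.comap_comp]
    exact MeasurableSpace.comap_mono
      ((measurable_iff_comap_le).1 (measurable_count_sigmaOf C.2.1 C.2.2.1 C.2.2.2))
  obtain ⟨F, -, rfl⟩ := h _ hE
  simp [restrict, Set.inter_assoc]

/-- `η_Δ ∪ γ_{Δᶜ}`. -/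
def glue (Δ : Set (Space d)) (η γ : Configuration d) : Configuration d :=
  (η.restrict Δ).union (γ.restrict Δᶜ)

theorem count_glue {Δ A : Set (Space d)} (hA : MeasurableSet A) (hb : IsBounded A)
    (η γ : Configuration d) :
    count A (glue Δ η γ) = count (Δ ∩ A) η + count (Δᶜ ∩ A) γ := by
  have h : (glue Δ η γ).carrier ∩ A = (η.carrier ∩ (Δ ∩ A)) ∪ (γ.carrier ∩ (Δᶜ ∩ A)) := by
    ext x; simp only [glue, Configuration.union, restrict, Set.mem_inter_iff, Set.mem_union]; tauto
  rw [count, h, Set.ncard_union_eq ?_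
    ((η.locallyFinite A hA hb).subset fun x hx => ⟨hx.1, hx.2.2⟩)
    ((γ.locallyFinite A hA hb).subset fun x hx => ⟨hx.1, hx.2.2⟩)]
  · rfl
  · rw [Set.disjoint_left]
    rintro x ⟨-, h1, -⟩ ⟨-, h2, -⟩
    exact h2 h1

theorem measurable_glue {Δ : Set (Space d)} (hΔ : MeasurableSet Δ) :
    Measurable fun p : Configuration d × Configuration d => glue Δ p.1 p.2 := by
  refine measurable_to_configuration fun A hA hb => ?_
  simp only [count_glue hA hb]
  exact ((measurable_count (hΔ.inter hA) (hb.subset Set.inter_subset_right)).comp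
    measurable_fst).add
    ((measurable_count (hΔ.compl.inter hA) (hb.subset Set.inter_subset_right)).comp measurable_snd)

@[simp] theorem glue_restrict_compl (Δ : Set (Space d)) (η γ : Configuration d) :
    (glue Δ η γ).restrict Δᶜ = γ.restrict Δᶜ := by
  ext x; simp only [glue, Configuration.union, restrict, Set.mem_inter_iff, Set.mem_union,
    Set.mem_compl_iff]; tauto

theorem restrict_of_subset {A : Set (Space d)} {γ : Configuration d} (h : γ.carrier ⊆ A) :
    γ.restrict A = γ :=
  Configuration.ext (Set.inter_eq_left.2 h)

theorem glue_of_subset {Δ : Set (Space d)} {η : Configuration d} (h : η.carrier ⊆ Δ)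
    (γ : Configuration d) : glue Δ η γ = η.union (γ.restrict Δᶜ) := by
  rw [glue, restrict_of_subset h]

/-- Local finiteness is assumed for Borel sets only; the closure of a bounded set is bounded and
Borel. -/
theorem carrier_inter_finite (γ : Configuration d) {A : Set (Space d)} (hb : IsBounded A) :
    (γ.carrier ∩ A).Finite := by
  refine (γ.locallyFinite (closure A) isClosed_closure.measurableSet hb.closure).subset ?_
  exact Set.inter_subset_inter_right _ subset_closure

/-! ### The counting measure of a configuration -/

/-- The measure `∑_{y ∈ γ} δ_y`. -/
def pointMeasure (γ : Configuration d) : Measure (Space d) := Measure.count.restrict γ.carrier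

theorem pointMeasure_apply (γ : Configuration d) {A : Set (Space d)} (hA : MeasurableSet A)
    (hb : IsBounded A) : pointMeasure γ A = count A γ := by
  have hf := carrier_inter_finite γ hb
  rw [pointMeasure, Measure.restrict_apply hA, Set.inter_comm, count,
    Measure.count_apply_finite _ hf, Set.ncard_eq_toFinset_card _ hf]

theorem iUnion_closedBall_disjointed :
    ⋃ m, disjointed (fun m : ℕ => Metric.closedBall (0 : Space d) m) m = Set.univ := by
  rw [iUnion_disjointed, Metric.iUnion_closedBall_nat]

theorem measurableSet_shell (m : ℕ) :
    MeasurableSet (disjointed (fun m : ℕ => Metric.closedBall (0 : Space d) m) m) :=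
  MeasurableSet.disjointed (fun _ => Metric.isClosed_closedBall.measurableSet) m

theorem isBounded_shell (m : ℕ) :
    IsBounded (disjointed (fun m : ℕ => Metric.closedBall (0 : Space d) m) m) :=
  Metric.isBounded_closedBall.subset (disjointed_subset _ m)

/-- The `σ`-algebra is generated by counts in bounded sets. A general Borel set is cut into its
intersections with disjoint bounded shells, and the counts are summed. -/
theorem measurable_pointMeasure : Measurable (pointMeasure : Configuration d → _) := by
  refine Measure.measurable_of_measurable_coe _ fun A hA => ?_
  have h (γ : Configuration d) : pointMeasure γ A
      = ∑' m, pointMeasure γ (A ∩ disjointed (fun m : ℕ => Metric.closedBall (0 : Space d) m) m) := by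
    rw [← measure_iUnion, ← Set.inter_iUnion, iUnion_closedBall_disjointed, Set.inter_univ]
    · exact fun i j hij => ((disjoint_disjointed _) hij).mono Set.inter_subset_right
        Set.inter_subset_right
    · exact fun m => hA.inter (measurableSet_shell m)
  simp only [h]
  refine Measurable.tsum fun m => ?_
  have hb := (isBounded_shell (d := d) m).subset (Set.inter_subset_right (s := A))
  simp only [pointMeasure_apply _ (hA.inter (measurableSet_shell m)) hb]
  exact measurable_from_top.comp (measurable_count (hA.inter (measurableSet_shell m)) hb)

/-- The kernel `γ ↦ ∑_{y ∈ γ} δ_y`. -/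
def pointKernel : Kernel (Configuration d) (Space d) := ⟨pointMeasure, measurable_pointMeasure⟩

@[simp] theorem pointKernel_apply (γ : Configuration d) : pointKernel γ = pointMeasure γ := rfl

-- The number of points has no uniform bound, so the kernel is split over pairs (shell, number of
-- points in it): each piece has bounded mass and there are countably many. S-finiteness gives joint
-- measurability of integrals against the kernel.
open Classical in
instance : IsSFiniteKernel (pointKernel (d := d)) := by
  let S (m : ℕ) : Set (Space d) := disjointed (fun m : ℕ => Metric.closedBall (0 : Space d) m) m
  have hS (m : ℕ) : MeasurableSet (S m) := measurableSet_shell m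
  have hSb (m : ℕ) : IsBounded (S m) := isBounded_shell m
  have hm (q : ℕ × ℕ) : MeasurableSet {γ : Configuration d | count (S q.1) γ = q.2} :=
    measurable_count (hS _) (hSb _) (measurableSet_singleton _)
  let κ (q : ℕ × ℕ) : Kernel (Configuration d) (Space d) :=
    Kernel.piecewise (hm q) (pointKernel.restrict (hS q.1)) 0
  have hκ (q : ℕ × ℕ) : IsFiniteKernel (κ q) := by
    refine ⟨⟨q.2, by simp, fun γ => ?_⟩⟩
    simp only [κ, Kernel.piecewise_apply']
    split_ifs with h
    · rw [Kernel.restrict_apply' _ _ _ MeasurableSet.univ, Set.univ_inter, pointKernel_apply,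
        pointMeasure_apply _ (hS _) (hSb _)]
      simp only [Set.mem_ofPred_eq] at h
      rw [h]
    · simp
  have : pointKernel = Kernel.sum κ := by
    ext γ A hA
    rw [Kernel.sum_apply' _ _ hA, ENNReal.tsum_prod (f := fun m N => κ (m, N) γ A)]
    have h1 (m : ℕ) : ∑' N, (κ (m, N)) γ A = pointMeasure γ (A ∩ S m) := by
      rw [tsum_eq_single (count (S m) γ)]
      · simp [κ, Kernel.piecewise_apply', Kernel.restrict_apply' _ _ _ hA]
      · intro N hN
        simp [κ, Kernel.piecewise_apply', Ne.symm hN]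
    simp only [h1]
    rw [← measure_iUnion, ← Set.inter_iUnion, iUnion_closedBall_disjointed, Set.inter_univ]
    · rfl
    · exact fun i j hij => ((disjoint_disjointed _) hij).mono Set.inter_subset_right
        Set.inter_subset_right
    · exact fun m => hA.inter (hS m)
  rw [this]
  infer_instance

/-! ### Measurability of sums over the points of a configuration. -/

theorem finsum_mem_eq_integral (γ : Configuration d) {A : Set (Space d)} (hA : MeasurableSet A)
    (hb : IsBounded A) (φ : Space d → ℝ) :
    ∑ᶠ y ∈ γ.carrier ∩ A, φ y = ∫ y in A, φ y ∂(pointMeasure γ) := by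
  have hf := carrier_inter_finite γ hb
  rw [pointMeasure, Measure.restrict_restrict hA, Set.inter_comm A,
    ← hf.coe_toFinset, finsum_mem_coe_finset, setIntegral_finset]
  · simp [Measure.real]
  · have h := integrableOn_finset_iUnion (f := φ) (μ := (Measure.count : Measure (Space d)))
      (s := hf.toFinset) (t := fun x => {x})
    have h2 : ⋃ x ∈ hf.toFinset, ({x} : Set (Space d)) = hf.toFinset := by ext; simp
    rw [← h2, h]
    simp

/-- Written as an integral against `pointKernel`, the sum is jointly measurable in the parameter and
the configuration. Double sums follow by applying this twice. -/
theorem measurable_finsum_mem {E : Type*} [MeasurableSpace E] {φ : E → Space d → ℝ}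
    (hφ : Measurable (Function.uncurry φ)) {A : Set (Space d)} (hA : MeasurableSet A)
    (hb : IsBounded A) :
    Measurable fun p : E × Configuration d => ∑ᶠ y ∈ p.2.carrier ∩ A, φ p.1 y := by
  simp only [finsum_mem_eq_integral _ hA hb]
  let κ : Kernel (E × Configuration d) (Space d) := Kernel.prodMkLeft E (pointKernel.restrict hA)
  have h : StronglyMeasurable fun p : E × Configuration d => ∫ y, φ p.1 y ∂(κ p) := by
    refine StronglyMeasurable.integral_kernel_prod_right' (κ := κ)
      (f := fun q : (E × Configuration d) × Space d => φ q.1.1 q.2) ?_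
    exact (hφ.comp ((measurable_fst.comp measurable_fst).prodMk
      measurable_snd)).stronglyMeasurable
  simpa [κ, Kernel.restrict_apply] using h.measurable

theorem truncatedMove_measurable (s : ℝ) {Δ : Set (Space d)} (hΔ : MeasurableSet Δ)
    (hb : IsBounded Δ) (p : ℕ) (hp : MeasurableSet (box d p)) (hpb : IsBounded (box d p)) :
    Measurable fun q : Configuration d × Configuration d => truncatedMove s Δ p q.1 q.2 := by
  have hr : Measurable (riesz s : Space d → ℝ) := by unfold riesz; fun_prop
  have h1 : Measurable fun q : Space d × Configuration d =>
      ∑ᶠ y ∈ q.2.carrier ∩ (box d p \ Δ), (riesz s (q.1 - y) - riesz s y) := by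
    refine measurable_finsum_mem (φ := fun x y => riesz s (x - y) - riesz s y) ?_ (hp.diff hΔ)
      (hpb.subset Set.sdiff_subset)
    exact (hr.comp (measurable_fst.sub measurable_snd)).sub (hr.comp measurable_snd)
  have h2 := measurable_finsum_mem (E := Configuration d)
    (φ := fun γ x => ∑ᶠ y ∈ γ.carrier ∩ (box d p \ Δ), (riesz s (x - y) - riesz s y))
    (h1.comp measurable_swap) hΔ hb
  exact h2.comp measurable_swap

theorem pairEnergy_eq {φ : Space d → ℝ} (γ : Configuration d) {A : Set (Space d)}
    (hb : IsBounded A) :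
    pairEnergy φ (γ.restrict A) = (1 / 2) * ∑ᶠ x ∈ γ.carrier ∩ A, ∑ᶠ y ∈ γ.carrier ∩ A,
      ({x}ᶜ : Set (Space d)).indicator (fun y => φ (x - y)) y := by
  classical
  obtain ⟨S, hS⟩ := (carrier_inter_finite γ hb).exists_finset_coe
  rw [pairEnergy, show (γ.restrict A).carrier = γ.carrier ∩ A from rfl, ← hS]
  congr 1
  simp only [finsum_mem_coe_finset]
  have h : S.offDiag = (S ×ˢ S).filter fun p => p.1 ≠ p.2 := by
    ext p; simp [Finset.mem_offDiag, and_assoc]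
  rw [← Finset.coe_offDiag, finsum_mem_coe_finset, h, Finset.sum_filter, Finset.sum_product]
  refine Finset.sum_congr rfl fun x _ => Finset.sum_congr rfl fun y _ => ?_
  by_cases h : x = y
  · simp [h]
  · simp [h, Ne.symm h]

/-- Restricting to a bounded set makes the sum genuinely finite. The potentials used later contain
such restrictions for this reason; they change nothing almost surely under the binomial laws. -/
theorem measurable_pairEnergy_restrict {φ : Space d → ℝ} (hφ : Measurable φ) {A : Set (Space d)}
    (hA : MeasurableSet A) (hb : IsBounded A) :
    Measurable fun γ : Configuration d => pairEnergy φ (γ.restrict A) := by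
  simp only [pairEnergy_eq _ hb]
  refine Measurable.const_mul ?_ _
  have h1 : Measurable fun q : Space d × Configuration d => ∑ᶠ y ∈ q.2.carrier ∩ A,
      ({q.1}ᶜ : Set (Space d)).indicator (fun y => φ (q.1 - y)) y := by
    refine measurable_finsum_mem
      (φ := fun x y => ({x}ᶜ : Set (Space d)).indicator (fun y => φ (x - y)) y) ?_ hA hb
    have h : Function.uncurry (fun x y : Space d =>
        ({x}ᶜ : Set (Space d)).indicator (fun y => φ (x - y)) y)
        = Set.indicator {q : Space d × Space d | q.1 = q.2}ᶜ (fun q => φ (q.1 - q.2)) := by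
      funext q
      by_cases hq : q.1 = q.2
      · simp [Function.uncurry, hq]
      · simp [Function.uncurry, hq, Ne.symm hq]
    rw [h]
    exact (hφ.comp (measurable_fst.sub measurable_snd)).indicator
      (measurableSet_eq_fun measurable_fst measurable_snd).compl
  have h2 := measurable_finsum_mem (E := Configuration d)
    (φ := fun γ x => ∑ᶠ y ∈ γ.carrier ∩ A,
      ({x}ᶜ : Set (Space d)).indicator (fun y => φ (x - y)) y)
    (h1.comp measurable_swap) hA hb
  exact h2.comp (measurable_id.prodMk measurable_id)

/-! ### The binomial process -/

/-- Coincident points are counted once, through their first index. The identity holds for every `x`,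
so measurability of `ofPoints` needs no exceptional set. -/
theorem count_ofPoints {N : ℕ} (x : Fin N → Space d) (A : Set (Space d)) [DecidablePred (· ∈ A)] :
    count A (ofPoints x)
      = ∑ i, if x i ∈ A ∧ ∀ j, j < i → x j ≠ x i then 1 else 0 := by
  classical
  rw [Finset.sum_boole, Nat.cast_id, count]
  have h : (ofPoints x).carrier ∩ A
      = x '' (Finset.univ.filter fun i => x i ∈ A ∧ ∀ j, j < i → x j ≠ x i : Finset (Fin N)) := by
    ext y
    simp only [ofPoints, Set.mem_inter_iff, Set.mem_range, Finset.coe_filter, Finset.mem_univ,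
      true_and, Set.mem_image, Set.mem_ofPred_eq]
    constructor
    · rintro ⟨⟨i, rfl⟩, hA⟩
      have hne : (Finset.univ.filter fun j => x j = x i).Nonempty := ⟨i, by simp⟩
      have hmem := Finset.min'_mem _ hne
      simp only [Finset.mem_filter, Finset.mem_univ, true_and] at hmem
      refine ⟨Finset.min' _ hne, ⟨by rwa [hmem], fun j hj hx => ?_⟩, hmem⟩
      exact absurd (Finset.min'_le _ j (by simp [hx, hmem])) (not_le.2 hj)
    · rintro ⟨i, ⟨hA, -⟩, rfl⟩
      exact ⟨⟨i, rfl⟩, hA⟩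
  rw [h, Set.InjOn.ncard_image, Set.ncard_coe_finset]
  intro i hi j hj hij
  simp only [Finset.coe_filter, Finset.mem_univ, true_and, Set.mem_ofPred_eq] at hi hj
  rcases lt_trichotomy i j with h | h | h
  · exact absurd hij (hj.2 i h)
  · exact h
  · exact absurd hij.symm (hi.2 j h)

theorem measurable_ofPoints {N : ℕ} : Measurable (ofPoints : (Fin N → Space d) → _) := by
  classical
  refine measurable_to_configuration fun A hA _ => ?_
  simp only [count_ofPoints]
  refine Finset.measurable_sum _ fun i _ => Measurable.ite ?_ measurable_const measurable_const
  have h : {x : Fin N → Space d | x i ∈ A ∧ ∀ j, j < i → x j ≠ x i}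
      = (fun x => x i) ⁻¹' A ∩ ⋂ j, ⋂ (_ : j < i), {x | x j = x i}ᶜ := by
    ext x; simp
  rw [h]
  exact (measurable_pi_apply i hA).inter (MeasurableSet.iInter fun j => MeasurableSet.iInter
    fun _ => (measurableSet_eq_fun (measurable_pi_apply j) (measurable_pi_apply i)).compl)

theorem count_ofPoints_of_injective {N : ℕ} {x : Fin N → Space d} (hx : Function.Injective x)
    (A : Set (Space d)) [DecidablePred (· ∈ A)] :
    count A (ofPoints x) = (Finset.univ.filter fun i => x i ∈ A).card := by
  rw [count_ofPoints, Finset.sum_boole, Nat.cast_id]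
  congr 1
  ext i
  simp only [Finset.mem_filter, Finset.mem_univ, true_and, and_iff_left_iff_imp]
  exact fun _ j hj h => hj.ne (hx h)

/-- A box condition on the coordinates `σ k` is a box condition on all coordinates, trivial off the
range of `σ`. This later identifies a random-size selection of independent points with a sample of
that size. -/
theorem map_comp_pi {ι κ X : Type*} [Fintype ι] [Fintype κ] [MeasurableSpace X] (μ : Measure X)
    [IsProbabilityMeasure μ] {σ : κ → ι} (hσ : Function.Injective σ) :
    MeasurePreserving (fun y : ι → X => y ∘ σ) (Measure.pi fun _ => μ) (Measure.pi fun _ => μ) := by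
  have hm : Measurable (fun y : ι → X => y ∘ σ) :=
    measurable_pi_lambda _ fun k => measurable_pi_apply (σ k)
  refine ⟨hm, (Measure.pi_eq fun s hs => ?_).symm⟩
  rw [Measure.map_apply hm (MeasurableSet.univ_pi hs)]
  have h : (fun y : ι → X => y ∘ σ) ⁻¹' Set.univ.pi s
      = Set.univ.pi (Function.extend σ s fun _ => Set.univ) := by
    ext y
    simp only [Set.mem_preimage, Set.mem_univ_pi, Function.comp_apply]
    constructor
    · intro h i
      by_cases hi : ∃ k, σ k = i
      · obtain ⟨k, rfl⟩ := hi
        rw [hσ.extend_apply]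
        exact h k
      · rw [Function.extend_apply' _ _ _ hi]
        trivial
    · intro h k
      have := h (σ k)
      rwa [hσ.extend_apply] at this
  rw [h, Measure.pi_pi]
  refine (Fintype.prod_of_injective σ hσ _ _ (fun i hi => ?_) fun k => ?_).symm
  · rw [Function.extend_apply' _ _ _ (by simpa using hi), measure_univ]
  · rw [hσ.extend_apply]

/-- Two distinct coordinates have joint law `μ × μ`, which does not charge the diagonal when `μ` has
no atoms. -/
theorem ae_injective_pi {X : Type*} [MeasurableSpace X] [MeasurableSingletonClass X]
    [MeasurableEq X] (μ : Measure X) [IsProbabilityMeasure μ] [NullSingletonClass μ]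
    (N : ℕ) :
    ∀ᵐ x ∂(Measure.pi fun _ : Fin N => μ), Function.Injective x := by
  have h (i j : Fin N) (hij : i ≠ j) : ∀ᵐ x ∂(Measure.pi fun _ : Fin N => μ), x i ≠ x j := by
    have hσ : Function.Injective ![i, j] := by
      intro a b hab
      fin_cases a <;> fin_cases b <;> simp_all
    have h1 := (measurePreserving_finTwoArrow μ).comp (map_comp_pi μ hσ)
    have hD : MeasurableSet {p : X × X | p.1 = p.2} :=
      measurableSet_eq_fun measurable_fst measurable_snd
    have h2 : (μ.prod μ) {p : X × X | p.1 = p.2} = 0 := by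
      rw [Measure.measure_prod_null hD]
      refine Eventually.of_forall fun a => ?_
      have : Prod.mk a ⁻¹' {p : X × X | p.1 = p.2} = {a} := by ext; simp [eq_comm]
      simp [this]
    have h3 := h1.measure_preimage hD.nullMeasurableSet
    rw [h2] at h3
    rw [ae_iff]
    convert h3 using 2
    ext x
    simp
  have h' : ∀ᵐ x ∂(Measure.pi fun _ : Fin N => μ), ∀ i j, i ≠ j → x i ≠ x j := by
    rw [ae_all_iff]; intro i
    rw [ae_all_iff]; intro j
    by_cases hij : i = j
    · exact Eventually.of_forall fun x h => absurd hij h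
    · filter_upwards [h i j hij] with x hx _ using hx
  filter_upwards [h'] with x hx i j hij
  by_contra hne
  exact hx i j hne hij

theorem isProbabilityMeasure_binomialProcess {A : Set (Space d)} (hA : volume A ≠ 0)
    (hb : IsBounded A) (N : ℕ) : IsProbabilityMeasure (binomialProcess A N) := by
  have := cond_isProbabilityMeasure_of_finite hA hb.measure_lt_top.ne
  exact Measure.isProbabilityMeasure_map measurable_ofPoints.aemeasurable

theorem binomialProcess_zero (A : Set (Space d)) :
    binomialProcess A 0 = Measure.dirac (ofPoints (Fin.elim0 : Fin 0 → Space d)) := by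
  rw [binomialProcess, Measure.pi_of_empty _ Fin.elim0, Measure.map_dirac' measurable_ofPoints]

theorem ofPoints_elim0_carrier : (ofPoints (Fin.elim0 : Fin 0 → Space d)).carrier = ∅ := by
  simp [ofPoints]

/-- The bound survives when the conditioning degenerates to the zero measure, so `binomialKernel` is
a finite kernel even for null `Δ`. -/
theorem binomialProcess_univ_le (A : Set (Space d)) (N : ℕ) :
    binomialProcess A N Set.univ ≤ 1 := by
  rw [binomialProcess, Measure.map_apply measurable_ofPoints MeasurableSet.univ, Set.preimage_univ,
    Measure.pi_univ]
  exact Finset.prod_le_one' fun _ _ => prob_le_one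

instance (A : Set (Space d)) (N : ℕ) : IsFiniteMeasure (binomialProcess A N) :=
  ⟨(binomialProcess_univ_le A N).trans_lt ENNReal.one_lt_top⟩

theorem measurableSet_count_eq {A : Set (Space d)} (hA : MeasurableSet A) (hb : IsBounded A)
    (N : ℕ) : MeasurableSet {γ : Configuration d | count A γ = N} :=
  measurable_count hA hb (measurableSet_singleton N)

/-- The kernel `γ ↦ Bin_{Δ, N_Δ(γ)}`. -/
def binomialKernel {Δ : Set (Space d)} (hΔ : MeasurableSet Δ) (hb : IsBounded Δ) :
    Kernel (Configuration d) (Configuration d) :=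
  ⟨fun γ => binomialProcess Δ (count Δ γ), (measurable_from_top (f := binomialProcess Δ)).comp
    (measurable_count hΔ hb)⟩

instance {Δ : Set (Space d)} (hΔ : MeasurableSet Δ) (hb : IsBounded Δ) :
    IsFiniteKernel (binomialKernel hΔ hb) :=
  ⟨⟨1, ENNReal.one_lt_top, fun _ => binomialProcess_univ_le _ _⟩⟩

theorem measurable_lintegral_binomialProcess {Δ : Set (Space d)} (hΔ : MeasurableSet Δ)
    (hb : IsBounded Δ) {F : Configuration d × Configuration d → ENNReal} (hF : Measurable F) :
    Measurable fun γ => ∫⁻ η, F (γ, η) ∂(binomialProcess Δ (count Δ γ)) :=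
  hF.lintegral_kernel_prod_right' (κ := binomialKernel hΔ hb)

theorem measurableSet_carrier_subset {A : Set (Space d)} (hA : MeasurableSet A) :
    MeasurableSet {γ : Configuration d | γ.carrier ⊆ A} := by
  have h : {γ : Configuration d | γ.carrier ⊆ A} = {γ | pointKernel γ Aᶜ = 0} := by
    ext γ
    simp only [Set.mem_ofPred_eq, pointKernel_apply, pointMeasure,
      Measure.restrict_apply hA.compl, Measure.count_eq_zero_iff]
    rw [Set.inter_comm, ← Set.disjoint_iff_inter_eq_empty, Set.disjoint_compl_right_iff_subset]
  rw [h]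
  exact measurableSet_eq_fun (Kernel.measurable_coe _ hA.compl) measurable_const

theorem ae_binomialProcess_subset {A : Set (Space d)} (hA : MeasurableSet A) (N : ℕ) :
    ∀ᵐ γ ∂(binomialProcess A N), γ.carrier ⊆ A := by
  rw [binomialProcess, ae_map_iff measurable_ofPoints.aemeasurable
    (measurableSet_carrier_subset hA)]
  have h : ∀ᵐ x ∂(Measure.pi fun _ : Fin N => cond (volume : Measure (Space d)) A),
      ∀ i, x i ∈ A := by
    rw [ae_all_iff]
    exact fun i => Measure.tendsto_eval_ae_ae.eventually (ae_cond_mem hA)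
  filter_upwards [h] with x hx
  rintro _ ⟨i, rfl⟩
  exact hx i

section Atomless

variable [NeZero d]

instance : Nontrivial (Space d) := by
  have : Nonempty (Fin d) := ⟨0⟩
  infer_instance

instance (A : Set (Space d)) : NullSingletonClass (cond (volume : Measure (Space d)) A) :=
  ⟨fun x => by simp [ProbabilityTheory.cond]⟩

theorem ae_injective_cond {A : Set (Space d)} (hA : volume A ≠ 0) (hb : IsBounded A) (N : ℕ) :
    ∀ᵐ x ∂(Measure.pi fun _ : Fin N => cond (volume : Measure (Space d)) A),
      Function.Injective x := by
  have := cond_isProbabilityMeasure_of_finite hA hb.measure_lt_top.ne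
  exact ae_injective_pi _ N

/-- Sampled points are almost surely distinct, so none is lost in passing to sets. The hypothesis on
null `A`, which recurs below, excludes the degenerate zero measure; for `N = N_Δ(γ)` it holds almost
surely under any process with intensity at most Lebesgue (`IntensityLE.ae_count_eq_zero`). -/
theorem ae_binomialProcess_count {A B : Set (Space d)} (hA : MeasurableSet A) (hb : IsBounded A)
    (hB : MeasurableSet B) (hBb : IsBounded B) (hAB : A ⊆ B) {N : ℕ} (h0 : volume A = 0 → N = 0) :
    ∀ᵐ γ ∂(binomialProcess A N), count B γ = N := by
  classical
  by_cases hv : volume A = 0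
  · obtain rfl := h0 hv
    rw [binomialProcess_zero, ae_dirac_iff
      (measurableSet_count_eq hB hBb 0)]
    simp [count, ofPoints_elim0_carrier]
  rw [binomialProcess, ae_map_iff measurable_ofPoints.aemeasurable
    (measurableSet_count_eq hB hBb N)]
  have h : ∀ᵐ x ∂(Measure.pi fun _ : Fin N => cond (volume : Measure (Space d)) A),
      ∀ i, x i ∈ A := by
    rw [ae_all_iff]
    exact fun i => Measure.tendsto_eval_ae_ae.eventually (ae_cond_mem hA)
  filter_upwards [h, ae_injective_cond hv hb N] with x hx hi
  rw [count_ofPoints_of_injective hi, Finset.filter_true_of_mem fun i _ => hAB (hx i)]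
  simp

end Atomless

/-! ### Resampling of the points in `Δ` -/

-- A uniform point of `Λ` conditioned to lie in `Δ` is uniform in `Δ`, so redrawing it there does
-- not change its law.
open Classical in
theorem measurePreserving_ite_cond {Λ Δ : Set (Space d)} (hΔ : MeasurableSet Δ)
    (hsub : Δ ⊆ Λ) (hΛ : MeasurableSet Λ) (hΛb : IsBounded Λ) (h0 : volume Δ ≠ 0) :
    MeasurePreserving (fun p : Space d × Space d => if p.1 ∈ Δ then p.2 else p.1)
      ((cond volume Λ).prod (cond volume Δ)) (cond volume Λ) := by
  have hfin : volume Δ ≠ ⊤ := (hΛb.subset hsub).measure_lt_top.ne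
  have := cond_isProbabilityMeasure_of_finite h0 hfin
  have hm : Measurable (fun p : Space d × Space d => if p.1 ∈ Δ then p.2 else p.1) :=
    Measurable.ite (measurable_fst hΔ) measurable_snd measurable_fst
  refine ⟨hm, ?_⟩
  ext B hB
  rw [Measure.map_apply hm hB]
  have h1 : (fun p : Space d × Space d => if p.1 ∈ Δ then p.2 else p.1) ⁻¹' B
      = (Δ ×ˢ B) ∪ ((B \ Δ) ×ˢ Set.univ) := by
    ext p
    by_cases hp : p.1 ∈ Δ <;> simp [hp]
  rw [h1, measure_union _ ((hB.diff hΔ).prod MeasurableSet.univ), Measure.prod_prod,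
    Measure.prod_prod, measure_univ, mul_one]
  · have h2 : cond (volume : Measure (Space d)) Λ Δ * cond (volume : Measure (Space d)) Δ B
        = cond (volume : Measure (Space d)) Λ (B ∩ Δ) := by
      rw [cond_apply hΛ, cond_apply hΔ, cond_apply hΛ, Set.inter_eq_right.2 hsub,
        Set.inter_eq_right.2 (Set.inter_subset_right.trans hsub), Set.inter_comm B, mul_assoc,
        ← mul_assoc (volume Δ), ENNReal.mul_inv_cancel h0 hfin, one_mul]
    rw [h2, measure_inter_add_sdiff _ hΔ]
  · rw [Set.disjoint_left]
    rintro p ⟨h1, -⟩ ⟨h2, -⟩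
    exact h2.2 h1

open Classical in
theorem measurePreserving_ite_pi {Λ Δ : Set (Space d)} (hΔ : MeasurableSet Δ)
    (hsub : Δ ⊆ Λ) (hΛ : MeasurableSet Λ) (hΛb : IsBounded Λ) (h0 : volume Δ ≠ 0) (n : ℕ) :
    MeasurePreserving
      (fun (p : (Fin n → Space d) × (Fin n → Space d)) i => if p.1 i ∈ Δ then p.2 i else p.1 i)
      ((Measure.pi fun _ => cond volume Λ).prod (Measure.pi fun _ => cond volume Δ))
      (Measure.pi fun _ => cond volume Λ) := by
  have h1 := measurePreserving_arrowProdEquivProdArrow (Space d) (Space d) (Fin n)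
    (fun _ => cond volume Λ) (fun _ => cond volume Δ)
  have h2 := measurePreserving_pi (ι := Fin n) (fun _ => (cond volume Λ).prod (cond volume Δ))
    (fun _ => cond volume Λ) (fun _ => measurePreserving_ite_cond hΔ hsub hΛ hΛb h0)
  exact h2.comp h1.symm

open Classical in
theorem ae_binomialProcess_count_eq_zero {Λ Δ : Set (Space d)} (hΔ : MeasurableSet Δ)
    (hΔb : IsBounded Δ) (h0 : volume Δ = 0) (n : ℕ) :
    ∀ᵐ γ ∂(binomialProcess Λ n), count Δ γ = 0 := by
  rw [binomialProcess, ae_map_iff measurable_ofPoints.aemeasurable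
    (measurableSet_count_eq hΔ hΔb 0)]
  have h : ∀ᵐ x ∂(Measure.pi fun _ : Fin n => cond (volume : Measure (Space d)) Λ),
      ∀ i, x i ∉ Δ := by
    rw [ae_all_iff]
    have h1 : ∀ᵐ y ∂(cond (volume : Measure (Space d)) Λ), y ∉ Δ := by
      rw [ae_iff]
      simp only [not_not]
      exact cond_absolutelyContinuous h0
    exact fun i => (Measure.tendsto_eval_ae_ae
      (μ := fun _ : Fin n => cond (volume : Measure (Space d)) Λ) (i := i)).eventually h1
  filter_upwards [h] with x hx
  rw [count_ofPoints]
  simp [hx]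

-- Coordinatewise, one redraws exactly the `x i` lying in `Δ`, which preserves the product law by
-- `measurePreserving_ite_pi`. That construction carries `n` spare points while the binomial kernel
-- draws only `N_Δ(γ)`; the proof consists in discarding the spare ones.
open Classical in
theorem lintegral_resample [NeZero d] {Λ Δ : Set (Space d)} (hΔ : MeasurableSet Δ)
    (hsub : Δ ⊆ Λ) (hΛ : MeasurableSet Λ) (hΛb : IsBounded Λ) (hΛ0 : volume Λ ≠ 0) (n : ℕ)
    {G : Configuration d → ENNReal} (hG : Measurable G) :
    ∫⁻ γ, ∫⁻ η, G (glue Δ η γ) ∂(binomialProcess Δ (count Δ γ)) ∂(binomialProcess Λ n)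
      = ∫⁻ γ, G γ ∂(binomialProcess Λ n) := by
  have hΔb := hΛb.subset hsub
  have hG' : Measurable fun x : Fin n → Space d => G (ofPoints x) := hG.comp measurable_ofPoints
  have hin : Measurable fun γ : Configuration d =>
      ∫⁻ η, G (glue Δ η γ) ∂(binomialProcess Δ (count Δ γ)) :=
    measurable_lintegral_binomialProcess hΔ hΔb
      ((hG.comp (measurable_glue hΔ)).comp measurable_swap)
  by_cases h0 : volume Δ = 0
  -- When `Δ` is null there is almost surely nothing to redraw: the inner law is the Dirac mass at
  -- the empty configuration, and glueing returns `γ`.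
  · have hae := ae_binomialProcess_count_eq_zero hΔ hΔb h0 (Λ := Λ) n
    refine lintegral_congr_ae ?_
    filter_upwards [hae] with γ hγ
    have hGm : Measurable fun η => G (glue Δ η γ) :=
      hG.comp ((measurable_glue hΔ).comp (measurable_id.prodMk measurable_const))
    rw [hγ, binomialProcess_zero, lintegral_dirac' _ hGm]
    congr 1
    have h2 : γ.carrier ∩ Δ = ∅ :=
      (Set.ncard_eq_zero (carrier_inter_finite γ hΔb)).1 hγ
    ext x
    have := Set.eq_empty_iff_forall_notMem.1 h2 x
    simp only [glue, Configuration.union, restrict, ofPoints_elim0_carrier, Set.empty_inter,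
      Set.empty_union, Set.mem_inter_iff, Set.mem_compl_iff] at this ⊢
    tauto
  have := cond_isProbabilityMeasure_of_finite h0 hΔb.measure_lt_top.ne
  have := cond_isProbabilityMeasure_of_finite hΛ0 hΛb.measure_lt_top.ne
  conv_rhs => rw [binomialProcess, lintegral_map hG measurable_ofPoints,
    ← (measurePreserving_ite_pi hΔ hsub hΛ hΛb h0 n).lintegral_comp hG']
  have hG'' : Measurable fun a : (Fin n → Space d) × (Fin n → Space d) =>
      G (ofPoints fun i => if a.1 i ∈ Δ then a.2 i else a.1 i) :=
    hG'.comp (measurePreserving_ite_pi hΔ hsub hΛ hΛb h0 n).measurable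
  rw [lintegral_prod _ hG''.aemeasurable]
  conv_lhs => rw [binomialProcess, lintegral_map hin measurable_ofPoints]
  refine lintegral_congr_ae ?_
  filter_upwards [ae_injective_cond hΛ0 hΛb n] with x hx
  have hcard := count_ofPoints_of_injective hx Δ
  set I : Finset (Fin n) := Finset.univ.filter fun i => x i ∈ Δ with hI
  rw [hcard]
  -- Enumerating the indices of the points in `Δ` selects `N_Δ` of the `n` spare points; by
  -- `map_comp_pi` they are again independent and uniform.
  let σ : Fin I.card → Fin n := I.orderEmbOfFin rfl
  have hσ : Function.Injective σ := (I.orderEmbOfFin rfl).injective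
  have hr : Set.range σ = I := Finset.range_orderEmbOfFin I rfl
  have hGm : Measurable fun η => G (glue Δ η (ofPoints x)) :=
    hG.comp ((measurable_glue hΔ).comp (measurable_id.prodMk measurable_const))
  rw [binomialProcess, lintegral_map hGm measurable_ofPoints,
    ← (map_comp_pi (cond (volume : Measure (Space d)) Δ) hσ).lintegral_comp
      (show Measurable fun y => G (glue Δ (ofPoints y) (ofPoints x)) from
        hGm.comp measurable_ofPoints)]
  have h : ∀ᵐ y ∂(Measure.pi fun _ : Fin n => cond (volume : Measure (Space d)) Δ),
      ∀ i, y i ∈ Δ := by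
    rw [ae_all_iff]
    exact fun i => Measure.tendsto_eval_ae_ae.eventually (ae_cond_mem hΔ)
  refine lintegral_congr_ae ?_
  filter_upwards [h] with y hy
  congr 1
  ext z
  have hrange (i : Fin n) : x i ∈ Δ ↔ ∃ k, σ k = i := by
    have : i ∈ Set.range σ ↔ i ∈ (I : Set (Fin n)) := by rw [hr]
    simpa [hI] using this.symm
  simp only [glue, Configuration.union, restrict, ofPoints, Set.mem_union, Set.mem_inter_iff,
    Set.mem_range, Set.mem_compl_iff, Function.comp_apply]
  constructor
  · rintro (⟨⟨k, rfl⟩, -⟩ | ⟨⟨i, rfl⟩, hi⟩)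
    · exact ⟨σ k, by rw [if_pos ((hrange _).2 ⟨k, rfl⟩)]⟩
    · exact ⟨i, by rw [if_neg hi]⟩
  · rintro ⟨i, hi⟩
    by_cases hxi : x i ∈ Δ
    · rw [if_pos hxi] at hi
      obtain ⟨k, rfl⟩ := (hrange i).1 hxi
      exact Or.inl ⟨⟨k, hi⟩, hi ▸ hy _⟩
    · rw [if_neg hxi] at hi
      exact Or.inr ⟨⟨i, hi⟩, hi ▸ hxi⟩

/-! ### Boxes -/

theorem side_nonneg (d n : ℕ) : 0 ≤ side d n := Real.rpow_nonneg (Nat.cast_nonneg n) _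

theorem side_pos (d : ℕ) {n : ℕ} (hn : 1 ≤ n) : 0 < side d n :=
  Real.rpow_pos_of_pos (by exact_mod_cast hn) _

theorem side_mono (d : ℕ) {m n : ℕ} (h : m ≤ n) : side d m ≤ side d n :=
  Real.rpow_le_rpow (Nat.cast_nonneg m) (by exact_mod_cast h) (by positivity)

theorem side_pow (d n : ℕ) [NeZero d] : side d n ^ d = n := by
  rw [side, ← Real.rpow_natCast, ← Real.rpow_mul (Nat.cast_nonneg n), one_div,
    inv_mul_cancel₀ (by exact_mod_cast NeZero.ne d), Real.rpow_one]

theorem tendsto_side (d : ℕ) [NeZero d] : Tendsto (side d) atTop atTop := by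
  have hd : 0 < (1 : ℝ) / d := by have := NeZero.pos d; positivity
  exact (tendsto_rpow_atTop hd).comp tendsto_natCast_atTop_atTop

theorem abs_apply_le_norm (x : Space d) (i : Fin d) : |x i| ≤ ‖x‖ := by
  simpa using PiLp.norm_apply_le x i

theorem exists_norm_le_apply [NeZero d] (x : Space d) : ∃ i, ‖x‖ ≤ Real.sqrt d * |x i| := by
  obtain ⟨i, -, hi⟩ := Finset.exists_max_image Finset.univ (fun i => |x i|) ⟨0, Finset.mem_univ _⟩
  refine ⟨i, ?_⟩
  rw [EuclideanSpace.norm_eq, ← Real.sqrt_sq (abs_nonneg (x i)), ← Real.sqrt_mul (by positivity)]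
  refine Real.sqrt_le_sqrt ?_
  calc ∑ j, ‖x j‖ ^ 2 ≤ ∑ _j : Fin d, |x i| ^ 2 :=
        Finset.sum_le_sum fun j hj => by
          rw [Real.norm_eq_abs]; exact pow_le_pow_left₀ (abs_nonneg _) (hi j hj) 2
    _ = d * |x i| ^ 2 := by simp

theorem box_mono {m n : ℕ} (h : m ≤ n) : box d m ⊆ box d n := fun _ hx i =>
  (hx i).trans (by have := side_mono d h; linarith)

theorem measurableSet_box (d n : ℕ) : MeasurableSet (box d n) := by
  have : box d n = ⋂ i, {x : Space d | |x i| ≤ side d n / 2} := by ext; simp [box]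
  rw [this]
  exact MeasurableSet.iInter fun i => measurableSet_le (by fun_prop) measurable_const

theorem norm_le_of_mem_box [NeZero d] {n : ℕ} {x : Space d} (hx : x ∈ box d n) :
    ‖x‖ ≤ Real.sqrt d * side d n := by
  obtain ⟨i, hi⟩ := exists_norm_le_apply x
  refine hi.trans (mul_le_mul_of_nonneg_left ?_ (Real.sqrt_nonneg _))
  have := hx i
  have := side_nonneg d n
  linarith

theorem isBounded_box (d n : ℕ) [NeZero d] : IsBounded (box d n) :=
  (Metric.isBounded_closedBall (x := (0 : Space d)) (r := Real.sqrt d * side d n)).subset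
    fun x hx => by simpa using norm_le_of_mem_box hx

theorem half_side_le_norm {n : ℕ} {x : Space d} (hx : x ∉ box d n) : side d n / 2 ≤ ‖x‖ := by
  simp only [box, Set.mem_ofPred_eq, not_forall, not_le] at hx
  obtain ⟨i, hi⟩ := hx
  exact hi.le.trans (abs_apply_le_norm x i)

theorem closedBall_subset_box {n : ℕ} {r : ℝ} (h : r ≤ side d n / 2) :
    Metric.closedBall (0 : Space d) r ⊆ box d n := fun x hx i =>
  (abs_apply_le_norm x i).trans ((by simpa using hx : ‖x‖ ≤ r).trans h)

theorem box_eq_preimage (d n : ℕ) : box d n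
    = WithLp.ofLp ⁻¹' (Set.univ.pi fun _ : Fin d => Set.Icc (-(side d n / 2)) (side d n / 2)) := by
  ext x; simp only [box, abs_le, Set.mem_ofPred_eq, Set.mem_preimage, Set.mem_univ_pi, Set.mem_Icc]

theorem volume_box (d n : ℕ) [NeZero d] : volume (box d n) = n := by
  rw [box_eq_preimage, (PiLp.volume_preserving_ofLp (Fin d)).measure_preimage
    (MeasurableSet.univ_pi fun _ => measurableSet_Icc).nullMeasurableSet, volume_pi_pi]
  simp only [Real.volume_Icc, sub_neg_eq_add, add_halves, Finset.prod_const, Finset.card_univ,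
    Fintype.card_fin]
  rw [← ENNReal.ofReal_pow (side_nonneg d n), side_pow, ENNReal.ofReal_natCast]

/-! ### The Riesz potential and its periodization -/

theorem abs_rpow_sub_rpow_le {s m a b : ℝ} (hs : 0 < s) (hm : 0 < m) (ha : m ≤ a) (hb : m ≤ b) :
    |a ^ (-s) - b ^ (-s)| ≤ s * m ^ (-(s + 1)) * |a - b| := by
  have h := Convex.norm_image_sub_le_of_norm_hasDerivWithin_le (f := fun t : ℝ => t ^ (-s))
    (f' := fun t => -s * t ^ (-s - 1)) (s := Set.Ici m) (C := s * m ^ (-(s + 1)))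
    (x := b) (y := a) (fun t ht => ?_) (fun t ht => ?_) (convex_Ici m) hb ha
  · simpa using h
  · exact (Real.hasDerivAt_rpow_const (Or.inl (hm.trans_le ht).ne')).hasDerivWithinAt
  · have ht0 : 0 < t := hm.trans_le ht
    rw [norm_mul, norm_neg, Real.norm_of_nonneg hs.le,
      Real.norm_of_nonneg (Real.rpow_nonneg ht0.le _), show -s - 1 = -(s + 1) by ring]
    exact mul_le_mul_of_nonneg_left
      (Real.rpow_le_rpow_of_nonpos hm ht (by linarith)) hs.le

theorem abs_riesz_sub_le {s m : ℝ} (hs : 0 < s) (hm : 0 < m) {x y : Space d} (hx : m ≤ ‖x‖)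
    (hy : m ≤ ‖y‖) : |riesz s x - riesz s y| ≤ s * m ^ (-(s + 1)) * ‖x - y‖ :=
  (abs_rpow_sub_rpow_le hs hm hx hy).trans
    (mul_le_mul_of_nonneg_left (abs_norm_sub_norm_le x y) (by positivity))

theorem riesz_nonneg (s : ℝ) (x : Space d) : 0 ≤ riesz s x := Real.rpow_nonneg (norm_nonneg x) _

@[simp] theorem riesz_neg (s : ℝ) (x : Space d) : riesz s (-x) = riesz s x := by simp [riesz]

theorem measurable_riesz (s : ℝ) : Measurable (riesz s : Space d → ℝ) := by
  unfold riesz; fun_prop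

/-! ### Convergence, lower bound and periodicity of the lattice sum. -/

/-- The vector `k ∈ ℤ^d` in `ℝ^d`. -/
def intVec (k : Fin d → ℤ) : Space d := WithLp.toLp 2 fun i => (k i : ℝ)

theorem latticeVec_eq (n : ℕ) (k : Fin d → ℤ) : latticeVec d n k = side d n • intVec k := rfl

theorem norm_latticeVec (n : ℕ) (k : Fin d → ℤ) :
    ‖latticeVec d n k‖ = side d n * ‖intVec k‖ := by
  rw [latticeVec_eq, norm_smul, Real.norm_of_nonneg (side_nonneg d n)]

theorem latticeVec_add (n : ℕ) (k l : Fin d → ℤ) :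
    latticeVec d n (k + l) = latticeVec d n k + latticeVec d n l := by
  ext i; simp [latticeVec]; ring

theorem latticeVec_neg (n : ℕ) (k : Fin d → ℤ) :
    latticeVec d n (-k) = -latticeVec d n k := by
  ext i; simp [latticeVec]

@[simp] theorem latticeVec_zero (n : ℕ) : latticeVec d n 0 = 0 := by
  ext i; simp [latticeVec]

theorem summable_norm_intVec_rpow {r : ℝ} (hr : (d : ℝ) < r) :
    Summable fun k : Fin d → ℤ => ‖intVec k‖ ^ (-r) := by
  let b := (EuclideanSpace.basisFun (Fin d) ℝ).toBasis
  let L : Submodule ℤ (Space d) := Submodule.span ℤ (Set.range b)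
  let e : (Fin d → ℤ) ≃ L := (b.restrictScalars ℤ).equivFun.symm.toEquiv
  have hrank : Module.finrank ℤ L = d := by
    rw [Module.finrank_eq_card_basis (b.restrictScalars ℤ), Fintype.card_fin]
  have h := ZLattice.summable_norm_rpow L (-r) (by rw [hrank]; linarith)
  refine (e.summable_iff.2 h).congr fun k => ?_
  have : ((e k : L) : Space d) = intVec k := by
    simp only [e, LinearEquiv.coe_toEquiv, Module.Basis.equivFun_symm_apply, Submodule.coe_sum,
      Submodule.coe_smul, Module.Basis.restrictScalars_apply]
    ext i
    simp [b, intVec, EuclideanSpace.basisFun_apply, Pi.single_apply]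
  simp [← this]

theorem finite_norm_intVec_le (R : ℝ) : {k : Fin d → ℤ | ‖intVec k‖ ≤ R}.Finite := by
  refine (Set.Finite.pi' (t := fun _ : Fin d => Set.Icc (-⌈R⌉) ⌈R⌉)
    fun _ => Set.finite_Icc _ _).subset fun k hk i => ?_
  have h := (abs_apply_le_norm (intVec k) i).trans (hk : ‖intVec k‖ ≤ R)
  have h2 : |((k i : ℤ) : ℝ)| ≤ (⌈R⌉ : ℤ) := le_trans (by simpa [intVec] using h) (Int.le_ceil R)
  rw [Set.mem_Icc, ← abs_le]
  exact_mod_cast h2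

/-- The average of the `k`-th translate of the Riesz potential. -/
def rieszAverage (d : ℕ) (s : ℝ) (n : ℕ) (k : Fin d → ℤ) : ℝ :=
  (1 / (n : ℝ)) * ∫ y in box d n, riesz s (y + latticeVec d n k)

theorem periodicRiesz_eq (s : ℝ) (n : ℕ) (x : Space d) : periodicRiesz s n x
    = ∑' k, (riesz s (x + latticeVec d n k) - rieszAverage d s n k) := rfl

theorem rieszAverage_neg (s : ℝ) (n : ℕ) (k : Fin d → ℤ) :
    rieszAverage d s n (-k) = rieszAverage d s n k := by
  unfold rieszAverage
  congr 1
  have h := (Measure.measurePreserving_neg (volume : Measure (Space d))).setIntegral_preimage_emb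
    (MeasurableEquiv.neg (Space d)).measurableEmbedding
    (fun y => riesz s (y + latticeVec d n k)) (box d n)
  rw [← h]
  have hb : Neg.neg ⁻¹' box d n = box d n := by ext; simp [box]
  rw [hb]
  refine integral_congr_ae (Eventually.of_forall fun y => ?_)
  simp only
  rw [latticeVec_neg, ← riesz_neg]
  congr 1
  abel

/-- Subtracting the mean over the cell gains one power of decay: `g(z + Lk)` is compared with `g(y +
Lk)` for every `y` in the box by the mean value inequality. The finite set `F` contains the `k` for
which a singularity may be near. -/
theorem exists_abs_riesz_sub_average_le [NeZero d] {s : ℝ} (hs : 0 < s) {n : ℕ} (hn : 1 ≤ n)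
    (ρ : ℝ) : ∃ F : Finset (Fin d → ℤ), ∃ C : ℝ, ∀ z : Space d, ‖z‖ ≤ ρ → ∀ k, k ∉ F →
      |riesz s (z + latticeVec d n k) - rieszAverage d s n k| ≤ C * ‖intVec k‖ ^ (-(s + 1)) := by
  have hL := side_pos d hn
  set L := side d n
  set R : ℝ := max ρ (Real.sqrt d * L) + 1 with hR
  have hR0 : 0 < R := by
    have : 0 ≤ Real.sqrt d * L := by positivity
    have := le_max_right ρ (Real.sqrt d * L)
    linarith
  -- `R` dominates `z` and every point of the box. Outside `F` one has `L‖k‖ > 2R`, which leaves all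
  -- translated points at distance at least `L‖k‖/2` from the origin.
  refine ⟨(finite_norm_intVec_le (2 * R / L)).toFinset, s * (L / 2) ^ (-(s + 1)) * (2 * R),
    fun z hz k hk => ?_⟩
  simp only [Set.Finite.mem_toFinset, Set.mem_ofPred_eq, not_le] at hk
  have hk0 : 0 < ‖intVec k‖ := lt_trans (by positivity) hk
  have hk1 : 2 * R ≤ L * ‖intVec k‖ := by
    rw [div_lt_iff₀ hL] at hk; linarith
  have hlow (y : Space d) (hy : ‖y‖ ≤ R) : L / 2 * ‖intVec k‖ ≤ ‖y + latticeVec d n k‖ := by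
    have h1 : ‖latticeVec d n k‖ - ‖y‖ ≤ ‖y + latticeVec d n k‖ := by
      have := norm_sub_norm_le (latticeVec d n k) (-y)
      rw [norm_neg, sub_neg_eq_add, add_comm (latticeVec d n k)] at this
      exact this
    rw [norm_latticeVec] at h1
    linarith
  have hzR : ‖z‖ ≤ R := hz.trans (by rw [hR]; linarith [le_max_left ρ (Real.sqrt d * L)])
  have hbR (y : Space d) (hy : y ∈ box d n) : ‖y‖ ≤ R :=
    (norm_le_of_mem_box hy).trans (by rw [hR]; linarith [le_max_right ρ (Real.sqrt d * L)])
  have hmpos : 0 < L / 2 * ‖intVec k‖ := by positivity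
  have hdiff (y : Space d) (hy : y ∈ box d n) :
      ‖riesz s (z + latticeVec d n k) - riesz s (y + latticeVec d n k)‖
        ≤ s * (L / 2) ^ (-(s + 1)) * (2 * R) * ‖intVec k‖ ^ (-(s + 1)) := by
    refine (abs_riesz_sub_le hs hmpos (hlow z hzR) (hlow y (hbR y hy))).trans ?_
    rw [Real.mul_rpow (by positivity) (norm_nonneg _), add_sub_add_right_eq_sub]
    have : ‖z - y‖ ≤ 2 * R := (norm_sub_le z y).trans (by linarith [hbR y hy])
    calc s * ((L / 2) ^ (-(s + 1)) * ‖intVec k‖ ^ (-(s + 1))) * ‖z - y‖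
        ≤ s * ((L / 2) ^ (-(s + 1)) * ‖intVec k‖ ^ (-(s + 1))) * (2 * R) :=
          mul_le_mul_of_nonneg_left this (by positivity)
      _ = _ := by ring
  set C := s * (L / 2) ^ (-(s + 1)) * (2 * R) * ‖intVec k‖ ^ (-(s + 1))
  have hvol : volume.real (box d n) = n := by simp [Measure.real, volume_box]
  have hvt : volume (box d n) < ⊤ := by simp [volume_box]
  have hm : Measurable fun y : Space d => riesz s (y + latticeVec d n k) :=
    (measurable_riesz s).comp (measurable_add_const _)
  have hInt : IntegrableOn (fun y => riesz s (y + latticeVec d n k)) (box d n) := by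
    refine Measure.integrableOn_of_bounded (M := |riesz s (z + latticeVec d n k)| + C) hvt.ne
      hm.aestronglyMeasurable ?_
    filter_upwards [ae_restrict_mem (measurableSet_box d n)] with y hy
    have h1 := hdiff y hy
    rw [Real.norm_eq_abs] at h1 ⊢
    have := abs_sub_abs_le_abs_sub (riesz s (y + latticeVec d n k)) (riesz s (z + latticeVec d n k))
    rw [abs_sub_comm] at this
    linarith
  have hn0 : (n : ℝ) ≠ 0 := by positivity
  have hconst : riesz s (z + latticeVec d n k)
      = (1 / (n : ℝ)) * ∫ _ in box d n, riesz s (z + latticeVec d n k) := by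
    rw [setIntegral_const, hvol, smul_eq_mul]
    field_simp
  have hci : Integrable (fun _ : Space d => riesz s (z + latticeVec d n k))
      (volume.restrict (box d n)) := integrableOn_const hvt.ne
  rw [rieszAverage, hconst, ← mul_sub, ← integral_sub hci hInt, abs_mul]
  have := norm_setIntegral_le_of_norm_le_const hvt hdiff
  rw [hvol, Real.norm_eq_abs] at this
  rw [abs_of_pos (by positivity : 0 < 1 / (n : ℝ))]
  calc _ ≤ 1 / (n : ℝ) * (C * n) := mul_le_mul_of_nonneg_left this (by positivity)
    _ = C := by field_simp

theorem summable_periodicRiesz [NeZero d] {s : ℝ} (hs : 0 < s) (hsd : (d : ℝ) < s + 1) {n : ℕ}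
    (hn : 1 ≤ n) (x : Space d) :
    Summable fun k => riesz s (x + latticeVec d n k) - rieszAverage d s n k := by
  obtain ⟨F, C, h⟩ := exists_abs_riesz_sub_average_le (d := d) hs hn ‖x‖
  refine Summable.of_norm_bounded_eventually
    ((summable_norm_intVec_rpow hsd).mul_left C) ?_
  filter_upwards [F.finite_toSet.compl_mem_cofinite] with k hk
  exact h x le_rfl k (by simpa using hk)

/-- Only a lower bound is possible near the lattice, and it is enough to bound the Boltzmann weight.
The finitely many singular terms are bounded below through `g ≥ 0`. -/
theorem exists_le_periodicRiesz [NeZero d] {s : ℝ} (hs : 0 < s) (hsd : (d : ℝ) < s + 1) {n : ℕ}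
    (hn : 1 ≤ n) (ρ : ℝ) : ∃ K : ℝ, ∀ z : Space d, ‖z‖ ≤ ρ → K ≤ periodicRiesz s n z := by
  classical
  obtain ⟨F, C, h⟩ := exists_abs_riesz_sub_average_le (d := d) hs hn ρ
  let b : (Fin d → ℤ) → ℝ := fun k =>
    if k ∈ F then -rieszAverage d s n k else -(C * ‖intVec k‖ ^ (-(s + 1)))
  have hb : Summable b := by
    refine Summable.of_norm_bounded_eventually
      (g := fun k => |C| * ‖intVec k‖ ^ (-(s + 1)))
      ((summable_norm_intVec_rpow hsd).mul_left |C|) ?_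
    filter_upwards [F.finite_toSet.compl_mem_cofinite] with k hk
    have : k ∉ F := by simpa using hk
    simp only [b, if_neg this, norm_neg, norm_mul, Real.norm_eq_abs]
    rw [abs_of_nonneg (by positivity : 0 ≤ ‖intVec k‖ ^ (-(s + 1)))]
  refine ⟨∑' k, b k, fun z hz => ?_⟩
  rw [periodicRiesz_eq]
  refine hb.tsum_le_tsum (fun k => ?_) (summable_periodicRiesz hs hsd hn z)
  by_cases hk : k ∈ F
  · simp only [b, if_pos hk]
    linarith [riesz_nonneg s (z + latticeVec d n k)]
  · simp only [b, if_neg hk]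
    exact (abs_le.1 (h z hz k hk)).1

theorem measurable_periodicRiesz (s : ℝ) (n : ℕ) :
    Measurable (periodicRiesz s n : Space d → ℝ) :=
  Measurable.tsum fun _ => ((measurable_riesz s).comp (measurable_add_const _)).sub measurable_const

theorem periodicRiesz_neg (s : ℝ) (n : ℕ) (x : Space d) :
    periodicRiesz s n (-x) = periodicRiesz s n x := by
  rw [periodicRiesz_eq, periodicRiesz_eq, ← (Equiv.neg (Fin d → ℤ)).tsum_eq]
  refine tsum_congr fun k => ?_
  rw [Equiv.neg_apply, rieszAverage_neg, latticeVec_neg, ← neg_add, riesz_neg]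

theorem summable_comp_add_right {G : Type*} [AddGroup G] {u : G → ℝ} (hu : Summable u) (e : G) :
    Summable fun k => u (k + e) :=
  (Equiv.addRight e).summable_iff.2 hu

theorem tsum_comp_add_right {G : Type*} [AddGroup G] (u : G → ℝ) (e : G) :
    ∑' k, u (k + e) = ∑' k, u k :=
  (Equiv.addRight e).tsum_eq u

/-- Reindexing also shifts the subtracted means, so periodicity is not immediate. It does show that
the increment of `g_n` under a lattice shift is independent of `x`; at the point `-Le/2` this
increment vanishes because `g_n` is even. -/
theorem periodicRiesz_add_latticeVec [NeZero d] {s : ℝ} (hs : 0 < s) (hsd : (d : ℝ) < s + 1)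
    {n : ℕ} (hn : 1 ≤ n) (e : Fin d → ℤ) (x : Space d) :
    periodicRiesz s n (x + latticeVec d n e) = periodicRiesz s n x := by
  have key (x : Space d) : periodicRiesz s n (x + latticeVec d n e) - periodicRiesz s n x
      = ∑' k, (rieszAverage d s n (k + e) - rieszAverage d s n k) := by
    have h2 : Summable fun k => riesz s (x + latticeVec d n (k + e)) - rieszAverage d s n (k + e) :=
      summable_comp_add_right (summable_periodicRiesz hs hsd hn x) e
    have h3 : periodicRiesz s n x
        = ∑' k, (riesz s (x + latticeVec d n (k + e)) - rieszAverage d s n (k + e)) :=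
      (tsum_comp_add_right (fun k => riesz s (x + latticeVec d n k) - rieszAverage d s n k) e).symm
    rw [h3, periodicRiesz_eq,
      ← (summable_periodicRiesz hs hsd hn (x + latticeVec d n e)).tsum_sub h2]
    refine tsum_congr fun k => ?_
    rw [latticeVec_add, add_assoc x, add_comm (latticeVec d n e)]
    ring
  have h0 := key (-((1 / 2 : ℝ) • latticeVec d n e))
  have h1 : -((1 / 2 : ℝ) • latticeVec d n e) + latticeVec d n e
      = (1 / 2 : ℝ) • latticeVec d n e := by
    ext i; simp; ring
  rw [h1, periodicRiesz_neg, sub_self] at h0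
  have := key x
  rw [← h0] at this
  linarith

/-- Away from the other lattice points, `g_n - g` is Lipschitz with a small constant. -/
theorem exists_lipschitz_remainder [NeZero d] {s : ℝ} (hs : 0 < s) (hsd : (d : ℝ) < s + 1) :
    ∃ K : ℝ, 0 ≤ K ∧ ∀ n : ℕ, 1 ≤ n → ∀ z w : Space d, (∀ i, |z i| ≤ 3 / 4 * side d n) →
      (∀ i, |w i| ≤ 3 / 4 * side d n) →
      |(periodicRiesz s n z - riesz s z) - (periodicRiesz s n w - riesz s w)|
        ≤ K * side d n ^ (-(s + 1)) * ‖z - w‖ := by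
  -- Choosing a coordinate with `‖k‖ ≤ √d |k i|`, the restriction to `3L/4` leaves `L|k i| - 3L/4 ≥
  -- L|k i|/4 ≥ c L ‖k‖` when `k ≠ 0`. The value `3/4` accommodates `x - y` with `|x| ≤ L/4` and `y
  -- ∈ Λ_n`.
  set c : ℝ := 1 / (4 * Real.sqrt d) with hc
  have hd : 0 < Real.sqrt d := Real.sqrt_pos.2 (by exact_mod_cast NeZero.pos d)
  have hc0 : 0 < c := by positivity
  refine ⟨s * c ^ (-(s + 1)) * ∑' k : Fin d → ℤ, ‖intVec k‖ ^ (-(s + 1)),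
    mul_nonneg (by positivity) (tsum_nonneg fun k => by positivity), fun n hn z w hz hw => ?_⟩
  have hL := side_pos d hn
  set L := side d n
  have hlow (y : Space d) (hy : ∀ i, |y i| ≤ 3 / 4 * L) (k : Fin d → ℤ) (hk : k ≠ 0) :
      c * L * ‖intVec k‖ ≤ ‖y + latticeVec d n k‖ := by
    obtain ⟨i, hi⟩ := exists_norm_le_apply (intVec k)
    have hki : k i ≠ 0 := by
      intro h0
      have : intVec k i = 0 := by simp [intVec, h0]
      rw [this, abs_zero, mul_zero] at hi
      have h3 : intVec k = 0 := norm_le_zero_iff.1 hi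
      refine hk (funext fun j => ?_)
      have := congrArg (fun v : Space d => v j) h3
      simpa [intVec] using this
    have h1 : (1 : ℝ) ≤ |(k i : ℝ)| := by exact_mod_cast Int.one_le_abs hki
    have h2 : (y + latticeVec d n k) i = y i + L * k i := by simp [latticeVec, L]
    have h3 : L * |(k i : ℝ)| - 3 / 4 * L ≤ ‖y + latticeVec d n k‖ := by
      refine le_trans ?_ (abs_apply_le_norm _ i)
      rw [h2]
      have := abs_sub_abs_le_abs_sub (L * (k i : ℝ)) (-(y i))
      rw [abs_neg, sub_neg_eq_add, abs_mul, abs_of_pos hL, add_comm (L * (k i : ℝ))] at this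
      linarith [hy i]
    have h4 : ‖intVec k‖ ≤ Real.sqrt d * |(k i : ℝ)| := by simpa [intVec] using hi
    calc c * L * ‖intVec k‖ ≤ c * L * (Real.sqrt d * |(k i : ℝ)|) :=
          mul_le_mul_of_nonneg_left h4 (by positivity)
      _ = L * |(k i : ℝ)| / 4 := by rw [hc]; field_simp
      _ ≤ _ := by nlinarith
  have hsz := summable_periodicRiesz hs hsd hn z
  have hsw := summable_periodicRiesz hs hsd hn w
  let D : (Fin d → ℤ) → ℝ := fun k =>
    riesz s (z + latticeVec d n k) - riesz s (w + latticeVec d n k)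
  have hD : Summable D := (hsz.sub hsw).congr fun k => by simp only [D]; ring
  have hsum : periodicRiesz s n z - periodicRiesz s n w = ∑' k, D k := by
    rw [periodicRiesz_eq, periodicRiesz_eq, ← hsz.tsum_sub hsw]
    exact tsum_congr fun k => by simp only [D]; ring
  have h0 : D 0 = riesz s z - riesz s w := by simp [D]
  -- Removing `g` deletes exactly the term `k = 0`, whatever value `g` is given at the origin; hence
  -- `z = 0` and `w = 0` are admissible.
  have h1 : (periodicRiesz s n z - riesz s z) - (periodicRiesz s n w - riesz s w)
      = ∑' k, if k = 0 then 0 else D k := by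
    have := hD.tsum_eq_add_tsum_ite 0
    rw [← hsum, h0] at this
    linarith
  rw [h1]
  have hb : Summable fun k : Fin d → ℤ =>
      s * c ^ (-(s + 1)) * L ^ (-(s + 1)) * ‖z - w‖ * ‖intVec k‖ ^ (-(s + 1)) :=
    (summable_norm_intVec_rpow hsd).mul_left _
  have h2 := tsum_of_norm_bounded (f := fun k => if k = 0 then 0 else D k) hb.hasSum fun k => by
    by_cases hk : k = 0
    · simp only [hk, if_true, norm_zero]
      positivity
    · simp only [if_neg hk]
      have hkp : 0 < ‖intVec k‖ := by
        rw [norm_pos_iff]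
        intro h3
        refine hk (funext fun j => ?_)
        have := congrArg (fun v : Space d => v j) h3
        simpa [intVec] using this
      refine (abs_riesz_sub_le hs (by positivity) (hlow z hz k hk) (hlow w hw k hk)).trans ?_
      rw [Real.mul_rpow (by positivity) (norm_nonneg _), Real.mul_rpow hc0.le hL.le,
        add_sub_add_right_eq_sub]
      exact le_of_eq (by ring)
  rw [tsum_mul_left] at h2
  refine h2.trans (le_of_eq ?_)
  ring

/-! ### Translations on the torus -/

/-- The representative in `[-L/2, L/2)` of `t - L/2` modulo `L`. -/
def wrap (L t : ℝ) : ℝ := L * Int.fract (t / L) - L / 2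

theorem measurable_wrap (L : ℝ) : Measurable (wrap L) := by
  unfold wrap
  exact ((measurable_fract.comp (measurable_id.div_const L)).const_mul L).sub_const _

theorem wrap_eq {L : ℝ} (hL : 0 < L) (t : ℝ) : wrap L t = t - L / 2 - L * ⌊t / L⌋ := by
  rw [wrap, ← Int.self_sub_floor]
  field_simp
  ring

theorem wrap_add_zsmul {L : ℝ} (hL : 0 < L) (t : ℝ) (k : ℤ) : wrap L (t + k * L) = wrap L t := by
  rw [wrap, wrap, add_div, mul_div_assoc, div_self hL.ne', mul_one, Int.fract_add_intCast]

/-- The preimage is `L`-periodic, so its measure may be computed on any interval of length `L`. On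
the one starting at `-v` the map is a plain translation. -/
theorem measurePreserving_wrap {L : ℝ} (hL : 0 < L) (v : ℝ) :
    MeasurePreserving (fun t => wrap L (t + v)) (volume.restrict (Set.Icc (-(L / 2)) (L / 2)))
      (volume.restrict (Set.Icc (-(L / 2)) (L / 2))) := by
  have hm : Measurable fun t => wrap L (t + v) := (measurable_wrap L).comp (measurable_add_const v)
  refine ⟨hm, ?_⟩
  ext B hB
  rw [Measure.map_apply hm hB, Measure.restrict_apply (hm hB), Measure.restrict_apply hB]
  set A := (fun t => wrap L (t + v)) ⁻¹' B with hA
  have h1 : volume (A ∩ Set.Icc (-(L / 2)) (L / 2))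
      = volume (A ∩ Set.Ioc (-(L / 2)) (-(L / 2) + L)) := by
    have : -(L / 2) + L = L / 2 := by ring
    rw [this]
    exact measure_congr ((ae_eq_refl A).inter Ioc_ae_eq_Icc.symm)
  have h2 : volume (A ∩ Set.Ioc (-(L / 2)) (-(L / 2) + L))
      = volume (A ∩ Set.Ioc (-v) (-v + L)) := by
    refine (isAddFundamentalDomain_Ioc hL _).measure_set_eq (isAddFundamentalDomain_Ioc hL _)
      (hm hB) fun g => ?_
    obtain ⟨_, k, rfl⟩ := g
    ext t
    have h : k • L + t + v = t + v + k * L := by rw [zsmul_eq_mul]; ring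
    simp only [Set.mem_preimage, AddSubgroup.vadd_def, vadd_eq_add]
    rw [h, wrap_add_zsmul hL]
  have h3 : volume (A ∩ Set.Ioc (-v) (-v + L)) = volume (A ∩ Set.Ico (-v) (-v + L)) :=
    measure_congr ((ae_eq_refl A).inter Ico_ae_eq_Ioc.symm)
  have h4 : A ∩ Set.Ico (-v) (-v + L)
      = (fun t => t + (v - L / 2)) ⁻¹' (B ∩ Set.Ico (-(L / 2)) (L / 2)) := by
    ext t
    simp only [hA, Set.mem_inter_iff, Set.mem_preimage, Set.mem_Ico]
    have hiff : (-v ≤ t ∧ t < -v + L) ↔ (-(L / 2) ≤ t + (v - L / 2) ∧ t + (v - L / 2) < L / 2) := by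
      constructor <;> rintro ⟨h, h'⟩ <;> constructor <;> linarith
    rw [← hiff]
    refine and_congr_left fun h => ?_
    have hfl : ⌊(t + v) / L⌋ = 0 := by
      rw [Int.floor_eq_zero_iff, Set.mem_Ico, le_div_iff₀ hL, div_lt_iff₀ hL]
      constructor <;> linarith [h.1, h.2]
    rw [wrap_eq hL, hfl]
    have : t + v - L / 2 - L * ((0 : ℤ) : ℝ) = t + (v - L / 2) := by push_cast; ring
    rw [this]
  rw [h1, h2, h3, h4, measure_preimage_add_right]
  exact measure_congr ((ae_eq_refl B).inter Ico_ae_eq_Icc)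

/-- Translation by `v` on the torus of side `n^{1/d}`. -/
def torusShift (d n : ℕ) (v x : Space d) : Space d :=
  WithLp.toLp 2 fun i => wrap (side d n) (x i + v i)

/-- The symmetry lets an average over all translations of a fixed point be read as a uniform average
over the box. -/
theorem torusShift_comm (n : ℕ) (v x : Space d) : torusShift d n v x = torusShift d n x v := by
  simp [torusShift, add_comm]

theorem measurable_torusShift (n : ℕ) :
    Measurable fun p : Space d × Space d => torusShift d n p.1 p.2 := by
  refine (MeasurableEquiv.toLp 2 (Fin d → ℝ)).measurable.comp (measurable_pi_lambda _ fun i => ?_)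
  exact (measurable_wrap _).comp (by fun_prop)

theorem measurePreserving_torusShift_restrict {n : ℕ} (hn : 1 ≤ n) (v : Space d) :
    MeasurePreserving (torusShift d n v) (volume.restrict (box d n))
      (volume.restrict (box d n)) := by
  have hL := side_pos d hn
  set I : Set ℝ := Set.Icc (-(side d n / 2)) (side d n / 2)
  have hI : MeasurableSet (Set.univ.pi fun _ : Fin d => I) :=
    MeasurableSet.univ_pi fun _ => measurableSet_Icc
  have h1 : MeasurePreserving (WithLp.ofLp : Space d → Fin d → ℝ) (volume.restrict (box d n))
      (Measure.pi fun _ => volume.restrict I) := by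
    have := (PiLp.volume_preserving_ofLp (Fin d)).restrict_preimage hI
    rw [← box_eq_preimage, volume_pi, Measure.restrict_pi_pi] at this
    exact this
  have h2 := measurePreserving_pi (ι := Fin d) (fun _ => volume.restrict I)
    (fun _ => volume.restrict I) (f := fun i t => wrap (side d n) (t + v i))
    (fun i => measurePreserving_wrap hL (v i))
  have h3 : MeasurePreserving (WithLp.toLp 2 : (Fin d → ℝ) → Space d)
      (Measure.pi fun _ => volume.restrict I) (volume.restrict (box d n)) := by
    have := (PiLp.volume_preserving_toLp (Fin d)).restrict_preimage (measurableSet_box d n)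
    have hpre : (WithLp.toLp 2 : (Fin d → ℝ) → Space d) ⁻¹' box d n
        = Set.univ.pi fun _ : Fin d => I := by
      rw [box_eq_preimage]; rfl
    rw [hpre, volume_pi, Measure.restrict_pi_pi] at this
    exact this
  exact h3.comp (h2.comp h1)

theorem measurePreserving_torusShift {n : ℕ} (hn : 1 ≤ n) (v : Space d) :
    MeasurePreserving (torusShift d n v) (cond volume (box d n)) (cond volume (box d n)) :=
  (measurePreserving_torusShift_restrict hn v).smul_measure _

theorem torusShift_sub {n : ℕ} (hn : 1 ≤ n) (v x y : Space d) :
    ∃ k, torusShift d n v x - torusShift d n v y = x - y + latticeVec d n k := by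
  refine ⟨fun i => ⌊(y i + v i) / side d n⌋ - ⌊(x i + v i) / side d n⌋, ?_⟩
  ext i
  simp only [torusShift, latticeVec, PiLp.sub_apply, PiLp.add_apply, PiLp.smul_apply, smul_eq_mul,
    wrap_eq (side_pos d hn)]
  push_cast
  ring

/-! ### The Gibbs measure on the torus -/

theorem pairEnergy_ofPoints {N : ℕ} {x : Fin N → Space d} (hx : Function.Injective x)
    (φ : Space d → ℝ) :
    pairEnergy φ (ofPoints x) = (1 / 2) * ∑ i, ∑ j, if i = j then 0 else φ (x i - x j) := by
  classical
  have h1 : (ofPoints x).restrict Set.univ = ofPoints x := restrict_of_subset (Set.subset_univ _)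
  have hoff : (ofPoints x).carrier.offDiag
      = ((Finset.univ.image x).offDiag : Finset (Space d × Space d)) := by
    ext p; simp [ofPoints]
  have h : (Finset.univ.image x).offDiag
      = ((Finset.univ.image x) ×ˢ (Finset.univ.image x)).filter fun p => p.1 ≠ p.2 := by
    ext p; simp [Finset.mem_offDiag, and_assoc]
  rw [pairEnergy, hoff, finsum_mem_coe_finset, h, Finset.sum_filter, Finset.sum_product,
    Finset.sum_image hx.injOn]
  congr 1
  refine Finset.sum_congr rfl fun i _ => ?_
  rw [Finset.sum_image hx.injOn]
  refine Finset.sum_congr rfl fun j _ => ?_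
  by_cases hij : i = j
  · simp [hij]
  · simp [hij, hx.eq_iff]

/-- The Boltzmann weight in coordinates. -/
def coordWeight (s β : ℝ) (n : ℕ) (x : Fin n → Space d) : ℝ :=
  Real.exp (-β * ((1 / 2) * ∑ i, ∑ j, if i = j then 0 else periodicRiesz s n (x i - x j)))

theorem coordWeight_pos (s β : ℝ) (n : ℕ) (x : Fin n → Space d) : 0 < coordWeight s β n x :=
  Real.exp_pos _

theorem measurable_coordWeight (s β : ℝ) (n : ℕ) :
    Measurable (coordWeight s β n : (Fin n → Space d) → ℝ) := by
  refine Real.measurable_exp.comp (Measurable.const_mul (Measurable.const_mul ?_ _) _)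
  refine Finset.measurable_sum _ fun i _ => Finset.measurable_sum _ fun j _ => ?_
  by_cases h : i = j
  · simp [h]
  · simp only [if_neg h]
    exact (measurable_periodicRiesz s n).comp
      ((measurable_pi_apply i).sub (measurable_pi_apply j))

theorem coordWeight_torusShift [NeZero d] {s : ℝ} (hs : 0 < s) (hsd : (d : ℝ) < s + 1) (β : ℝ)
    {n : ℕ} (hn : 1 ≤ n) (v : Space d) (x : Fin n → Space d) :
    coordWeight s β n (fun i => torusShift d n v (x i)) = coordWeight s β n x := by
  have h (i j : Fin n) : periodicRiesz s n (torusShift d n v (x i) - torusShift d n v (x j))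
      = periodicRiesz s n (x i - x j) := by
    obtain ⟨k, hk⟩ := torusShift_sub hn v (x i) (x j)
    rw [hk, periodicRiesz_add_latticeVec hs hsd hn]
  simp only [coordWeight, h]

theorem exists_coordWeight_le [NeZero d] {s : ℝ} (hs : 0 < s) (hsd : (d : ℝ) < s + 1) {β : ℝ}
    (hβ : 0 < β) {n : ℕ} (hn : 1 ≤ n) : ∃ C, ∀ x : Fin n → Space d, (∀ i, x i ∈ box d n) →
      coordWeight s β n x ≤ C := by
  obtain ⟨K, hK⟩ := exists_le_periodicRiesz (d := d) hs hsd hn (2 * (Real.sqrt d * side d n))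
  refine ⟨Real.exp (-β * ((1 / 2) * ∑ i : Fin n, ∑ j : Fin n, if i = j then 0 else K)),
    fun x hx => Real.exp_le_exp.2 ?_⟩
  refine mul_le_mul_of_nonpos_left (mul_le_mul_of_nonneg_left ?_ (by norm_num)) (by linarith)
  refine Finset.sum_le_sum fun i _ => Finset.sum_le_sum fun j _ => ?_
  split_ifs
  · rfl
  · refine hK _ ((norm_sub_le _ _).trans ?_)
    linarith [norm_le_of_mem_box (hx i), norm_le_of_mem_box (hx j)]

section Torus

variable {s β : ℝ} {n : ℕ}

/-- The law of `n` independent uniform points in `Λ_n`. -/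
abbrev uniformPoints (d n : ℕ) : Measure (Fin n → Space d) :=
  Measure.pi fun _ => cond (volume : Measure (Space d)) (box d n)

theorem volume_box_ne_zero [NeZero d] (hn : 1 ≤ n) : volume (box d n) ≠ 0 := by
  rw [volume_box]
  exact_mod_cast (by omega : n ≠ 0)

theorem isProbabilityMeasure_cond_box [NeZero d] (hn : 1 ≤ n) :
    IsProbabilityMeasure (cond (volume : Measure (Space d)) (box d n)) :=
  cond_isProbabilityMeasure_of_finite (volume_box_ne_zero hn) (isBounded_box d n).measure_lt_top.ne

theorem ae_uniformPoints_mem : ∀ᵐ x ∂(uniformPoints d n), ∀ i, x i ∈ box d n := by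
  rw [ae_all_iff]
  exact fun i => Measure.tendsto_eval_ae_ae.eventually (ae_cond_mem (measurableSet_box d n))

/-- The weight `e^{-β H_n(γ_{Λ_n})}`. -/
def gibbsWeight (s β : ℝ) (n : ℕ) (γ : Configuration d) : ℝ :=
  Real.exp (-β * periodicEnergy s n (γ.restrict (box d n)))

theorem gibbsWeight_pos (s β : ℝ) (n : ℕ) (γ : Configuration d) : 0 < gibbsWeight s β n γ :=
  Real.exp_pos _

theorem measurable_gibbsWeight [NeZero d] (s β : ℝ) (n : ℕ) :
    Measurable (gibbsWeight s β n : Configuration d → ℝ) :=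
  Real.measurable_exp.comp ((measurable_pairEnergy_restrict (measurable_periodicRiesz s n)
    (measurableSet_box d n) (isBounded_box d n)).const_mul _)

theorem ae_exp_energy_eq_gibbsWeight (s β : ℝ) :
    (fun γ => Real.exp (-β * periodicEnergy s n γ))
      =ᵐ[binomialProcess (box d n) n] gibbsWeight s β n := by
  filter_upwards [ae_binomialProcess_subset (measurableSet_box d n) n] with γ hγ
  rw [gibbsWeight, restrict_of_subset hγ]

theorem ae_gibbsWeight_ofPoints [NeZero d] (hn : 1 ≤ n) (s β : ℝ) :
    ∀ᵐ x ∂(uniformPoints d n), gibbsWeight s β n (ofPoints x) = coordWeight s β n x := by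
  filter_upwards [ae_injective_cond (volume_box_ne_zero hn) (isBounded_box d n) n,
    ae_uniformPoints_mem] with x hx hm
  have h : (ofPoints x).carrier ⊆ box d n := by rintro _ ⟨i, rfl⟩; exact hm i
  rw [gibbsWeight, restrict_of_subset h, periodicEnergy, pairEnergy_ofPoints hx, coordWeight]

theorem integrable_gibbsWeight [NeZero d] (hs : 0 < s) (hsd : (d : ℝ) < s + 1) (hβ : 0 < β)
    (hn : 1 ≤ n) : Integrable (gibbsWeight s β n) (binomialProcess (box d n) n) := by
  have := isProbabilityMeasure_cond_box (d := d) hn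
  obtain ⟨C, hC⟩ := exists_coordWeight_le (d := d) hs hsd hβ hn
  rw [binomialProcess, integrable_map_measure (measurable_gibbsWeight s β n).aestronglyMeasurable
    measurable_ofPoints.aemeasurable]
  refine Integrable.of_bound
    ((measurable_gibbsWeight s β n).comp measurable_ofPoints).aestronglyMeasurable C ?_
  filter_upwards [ae_gibbsWeight_ofPoints hn s β, ae_uniformPoints_mem] with x hx hm
  rw [Function.comp_apply, hx, Real.norm_of_nonneg (coordWeight_pos s β n x).le]
  exact hC x hm

theorem torusPartition_eq :
    torusPartition d s β n = ∫ γ, gibbsWeight s β n γ ∂(binomialProcess (box d n) n) :=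
  integral_congr_ae (ae_exp_energy_eq_gibbsWeight s β)

theorem torusPartition_pos [NeZero d] (hs : 0 < s) (hsd : (d : ℝ) < s + 1) (hβ : 0 < β)
    (hn : 1 ≤ n) : 0 < torusPartition d s β n := by
  have := isProbabilityMeasure_binomialProcess (volume_box_ne_zero (d := d) hn)
    (isBounded_box d n) n
  rw [torusPartition_eq]
  refine (integral_pos_iff_support_of_nonneg (fun γ => (gibbsWeight_pos s β n γ).le)
    (integrable_gibbsWeight hs hsd hβ hn)).2 ?_
  have : Function.support (gibbsWeight s β n : Configuration d → ℝ) = Set.univ := by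
    ext γ; simp [(gibbsWeight_pos s β n γ).ne']
  rw [this, measure_univ]
  exact one_pos

/-- The density is replaced by a version that is measurable on the whole configuration space and
agrees with it almost everywhere for the binomial process. -/
theorem torusGibbs_eq [NeZero d] : torusGibbs d s β n = (binomialProcess (box d n) n).withDensity
    fun γ => ENNReal.ofReal ((1 / torusPartition d s β n) * gibbsWeight s β n γ) := by
  refine withDensity_congr_ae ?_
  filter_upwards [ae_exp_energy_eq_gibbsWeight s β] with γ hγ
  rw [hγ]

theorem lintegral_torusGibbs [NeZero d] {G : Configuration d → ENNReal} (hG : Measurable G) :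
    ∫⁻ γ, G γ ∂(torusGibbs d s β n)
      = ∫⁻ γ, ENNReal.ofReal ((1 / torusPartition d s β n) * gibbsWeight s β n γ) * G γ
          ∂(binomialProcess (box d n) n) := by
  rw [torusGibbs_eq, lintegral_withDensity_eq_lintegral_mul _
    ((measurable_gibbsWeight s β n).const_mul _).ennreal_ofReal hG]
  rfl

theorem isProbabilityMeasure_torusGibbs [NeZero d] (hs : 0 < s) (hsd : (d : ℝ) < s + 1) (hβ : 0 < β)
    (hn : 1 ≤ n) : IsProbabilityMeasure (torusGibbs d s β n) := by
  have hZ := torusPartition_pos (d := d) hs hsd hβ hn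
  refine ⟨?_⟩
  rw [← lintegral_one, lintegral_torusGibbs measurable_const]
  simp only [mul_one]
  rw [← ofReal_integral_eq_lintegral_ofReal ((integrable_gibbsWeight hs hsd hβ hn).const_mul _)
    (Eventually.of_forall fun γ => mul_nonneg (by positivity) (Real.exp_pos _).le),
    integral_const_mul, ← torusPartition_eq, one_div, inv_mul_cancel₀ hZ.ne', ENNReal.ofReal_one]

theorem torusGibbs_absolutelyContinuous :
    torusGibbs d s β n ≪ binomialProcess (box d n) n :=
  withDensity_absolutelyContinuous _ _

/-! ### Translation invariance and the intensity of the Gibbs measure. -/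

theorem lintegral_pointMeasure_ofPoints {N : ℕ} {x : Fin N → Space d}
    (hx : Function.Injective x) (φ : Space d → ENNReal) :
    ∫⁻ y, φ y ∂(pointMeasure (ofPoints x)) = ∑ i, φ (x i) := by
  classical
  have h : (ofPoints x).carrier = (Finset.univ.image x : Finset (Space d)) := by
    simp [ofPoints]
  rw [pointMeasure, h, lintegral_finset, Finset.sum_image hx.injOn]
  simp

/-- The integral is unchanged when all points are translated by `v`. Averaging over uniform `v` and
exchanging the integrals makes the `i`-th point uniform and independent of the weight. -/
theorem lintegral_coordWeight_mul [NeZero d] (hs : 0 < s) (hsd : (d : ℝ) < s + 1) (hn : 1 ≤ n)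
    (i : Fin n) {φ : Space d → ENNReal} (hφ : Measurable φ) :
    ∫⁻ x, ENNReal.ofReal (coordWeight s β n x) * φ (x i) ∂(uniformPoints d n)
      = (∫⁻ x, ENNReal.ofReal (coordWeight s β n x) ∂(uniformPoints d n))
        * ∫⁻ y, φ y ∂(cond (volume : Measure (Space d)) (box d n)) := by
  have := isProbabilityMeasure_cond_box (d := d) hn
  set μ := cond (volume : Measure (Space d)) (box d n)
  have hW : Measurable fun x : Fin n → Space d => ENNReal.ofReal (coordWeight s β n x) :=
    (measurable_coordWeight s β n).ennreal_ofReal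
  have hm : Measurable fun x : Fin n → Space d => ENNReal.ofReal (coordWeight s β n x) * φ (x i) :=
    hW.mul (hφ.comp (measurable_pi_apply i))
  have h1 (v : Space d) :
      ∫⁻ x, ENNReal.ofReal (coordWeight s β n x) * φ (x i) ∂(uniformPoints d n)
        = ∫⁻ x, ENNReal.ofReal (coordWeight s β n x) * φ (torusShift d n v (x i))
          ∂(uniformPoints d n) := by
    have hp := measurePreserving_pi (ι := Fin n) (fun _ => μ) (fun _ => μ)
      (f := fun _ => torusShift d n v) (fun _ => measurePreserving_torusShift hn v)
    rw [← hp.lintegral_comp hm]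
    simp only [coordWeight_torusShift hs hsd β hn v]
    rfl
  have h2 (x : Fin n → Space d) : ∫⁻ v, φ (torusShift d n v (x i)) ∂μ = ∫⁻ y, φ y ∂μ := by
    simp only [torusShift_comm n _ (x i)]
    exact (measurePreserving_torusShift hn (x i)).lintegral_comp hφ
  have hmv (x : Fin n → Space d) : Measurable fun v => φ (torusShift d n v (x i)) :=
    hφ.comp ((measurable_torusShift n).comp (measurable_id.prodMk measurable_const))
  have hj : Measurable (Function.uncurry fun (v : Space d) (x : Fin n → Space d) =>
      ENNReal.ofReal (coordWeight s β n x) * φ (torusShift d n v (x i))) :=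
    (hW.comp measurable_snd).mul (hφ.comp ((measurable_torusShift n).comp
      (measurable_fst.prodMk ((measurable_pi_apply i).comp measurable_snd))))
  calc ∫⁻ x, ENNReal.ofReal (coordWeight s β n x) * φ (x i) ∂(uniformPoints d n)
      = ∫⁻ _v, (∫⁻ x, ENNReal.ofReal (coordWeight s β n x) * φ (x i) ∂(uniformPoints d n)) ∂μ := by
        simp
    _ = ∫⁻ v, ∫⁻ x, ENNReal.ofReal (coordWeight s β n x) * φ (torusShift d n v (x i))
          ∂(uniformPoints d n) ∂μ := lintegral_congr fun v => h1 v
    _ = ∫⁻ x, ∫⁻ v, ENNReal.ofReal (coordWeight s β n x) * φ (torusShift d n v (x i)) ∂μ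
          ∂(uniformPoints d n) := lintegral_lintegral_swap hj.aemeasurable
    _ = ∫⁻ x, ENNReal.ofReal (coordWeight s β n x) * ∫⁻ y, φ y ∂μ ∂(uniformPoints d n) := by
        refine lintegral_congr fun x => ?_
        rw [lintegral_const_mul _ (hmv x), h2]
    _ = _ := lintegral_mul_const _ hW

/-- The Gibbs measure on the torus has intensity one in `Λ_n`. -/
theorem lintegral_pointMeasure_torusGibbs [NeZero d] (hs : 0 < s) (hsd : (d : ℝ) < s + 1) (hβ : 0 < β)
    (hn : 1 ≤ n) {φ : Space d → ENNReal} (hφ : Measurable φ) :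
    ∫⁻ γ, ∫⁻ y, φ y ∂(pointMeasure γ) ∂(torusGibbs d s β n) = ∫⁻ y in box d n, φ y := by
  have hprob := isProbabilityMeasure_torusGibbs (d := d) hs hsd hβ hn
  have hin : Measurable fun γ : Configuration d => ∫⁻ y, φ y ∂(pointMeasure γ) :=
    hφ.lintegral_kernel (κ := pointKernel)
  have hZ := torusPartition_pos (d := d) hs hsd hβ hn
  set Z := torusPartition d s β n
  have hc : Measurable fun x : Fin n → Space d => ENNReal.ofReal (coordWeight s β n x) :=
    (measurable_coordWeight s β n).ennreal_ofReal
  have key {G : Configuration d → ENNReal} (hG : Measurable G) :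
      ∫⁻ γ, G γ ∂(torusGibbs d s β n) = ENNReal.ofReal (1 / Z) *
        ∫⁻ x, ENNReal.ofReal (coordWeight s β n x) * G (ofPoints x) ∂(uniformPoints d n) := by
    have hm1 : Measurable fun γ : Configuration d =>
        ENNReal.ofReal (1 / Z * gibbsWeight s β n γ) * G γ :=
      ((measurable_gibbsWeight s β n).const_mul _).ennreal_ofReal.mul hG
    have hm2 : Measurable fun x : Fin n → Space d =>
        ENNReal.ofReal (coordWeight s β n x) * G (ofPoints x) :=
      hc.mul (hG.comp measurable_ofPoints)
    rw [lintegral_torusGibbs hG, binomialProcess, lintegral_map hm1 measurable_ofPoints,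
      ← lintegral_const_mul _ hm2]
    refine lintegral_congr_ae ?_
    filter_upwards [ae_gibbsWeight_ofPoints hn s β] with x hx
    rw [hx, ENNReal.ofReal_mul (by positivity), mul_assoc]
  have h1 : ENNReal.ofReal (1 / Z) *
      ∫⁻ x, ENNReal.ofReal (coordWeight s β n x) ∂(uniformPoints d n) = 1 := by
    have := key (G := fun _ => 1) measurable_const
    simpa using this.symm
  have h2 : ∫⁻ x, ENNReal.ofReal (coordWeight s β n x) *
      ∫⁻ y, φ y ∂(pointMeasure (ofPoints x)) ∂(uniformPoints d n)
      = ∑ i, ∫⁻ x, ENNReal.ofReal (coordWeight s β n x) * φ (x i) ∂(uniformPoints d n) := by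
    have hm (i : Fin n) : Measurable fun x : Fin n → Space d =>
        ENNReal.ofReal (coordWeight s β n x) * φ (x i) :=
      hc.mul (hφ.comp (measurable_pi_apply i))
    rw [← lintegral_finsetSum _ fun i _ => hm i]
    refine lintegral_congr_ae ?_
    filter_upwards [ae_injective_cond (volume_box_ne_zero hn) (isBounded_box d n) n] with x hx
    rw [lintegral_pointMeasure_ofPoints hx, Finset.mul_sum]
  rw [key hin, h2]
  simp only [lintegral_coordWeight_mul hs hsd hn _ hφ]
  -- Each of the `n` points contributes a uniform law of density `1/n`.
  rw [Finset.sum_const, Finset.card_univ, Fintype.card_fin, nsmul_eq_mul, mul_left_comm,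
    ← mul_assoc (ENNReal.ofReal (1 / Z)), h1, one_mul, ProbabilityTheory.cond,
    lintegral_smul_measure, volume_box, smul_eq_mul, ← mul_assoc,
    ENNReal.mul_inv_cancel (by exact_mod_cast (by omega : n ≠ 0)) (by simp), one_mul]

end Torus

/-! ### Finite sums over configurations -/

theorem abs_finsum_mem_sub_le {α : Type*} {S : Set α} (hS : S.Finite) {f g : α → ℝ} {c : ℝ}
    (h : ∀ x ∈ S, |f x - g x| ≤ c) :
    |∑ᶠ x ∈ S, f x - ∑ᶠ x ∈ S, g x| ≤ S.ncard * c := by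
  obtain ⟨S, rfl⟩ := hS.exists_finset_coe
  rw [finsum_mem_coe_finset, finsum_mem_coe_finset, ← Finset.sum_sub_distrib,
    Set.ncard_coe_finset, ← nsmul_eq_mul]
  exact (Finset.abs_sum_le_sum_abs _ _).trans
    (Finset.sum_le_card_nsmul _ _ _ fun x hx => h x (by simpa using hx))

theorem abs_finsum_mem_sub_le_of_subset {α : Type*} {S T : Set α} (hT : T.Finite) (hST : S ⊆ T)
    {f h : α → ℝ} (hf : ∀ x ∈ T \ S, |f x| ≤ h x) :
    |∑ᶠ x ∈ T, f x - ∑ᶠ x ∈ S, f x| ≤ ∑ᶠ x ∈ T \ S, h x := by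
  rw [← finsum_mem_add_sdiff hST hT, add_sub_cancel_left]
  obtain ⟨R, hR⟩ := (hT.subset (Set.sdiff_subset (t := S))).exists_finset_coe
  rw [← hR] at hf ⊢
  rw [finsum_mem_coe_finset, finsum_mem_coe_finset]
  exact (Finset.abs_sum_le_sum_abs _ _).trans
    (Finset.sum_le_sum fun x hx => hf x (by simpa using hx))

/-! ### Tails of configurations -/

/-- The weight `(1 + |y|)^{-(s+1)}`, which is integrable on `ℝ^d`. -/
def tailWeight (s : ℝ) (y : Space d) : ℝ := (1 + ‖y‖) ^ (-(s + 1))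

theorem tailWeight_nonneg (s : ℝ) (y : Space d) : 0 ≤ tailWeight s y :=
  Real.rpow_nonneg (by positivity) _

theorem measurable_tailWeight (s : ℝ) : Measurable (tailWeight s : Space d → ℝ) := by
  unfold tailWeight; fun_prop

/-- The tail `∑_{y ∈ γ ∖ Λ_p} (1 + |y|)^{-(s+1)}`. -/
def tail (s : ℝ) (p : ℕ) (γ : Configuration d) : ENNReal :=
  ∫⁻ y in (box d p)ᶜ, ENNReal.ofReal (tailWeight s y) ∂(pointMeasure γ)

/-- The mean tail `∫_{ℝ^d ∖ Λ_p} (1 + |y|)^{-(s+1)} dy`. -/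
def meanTail (d : ℕ) (s : ℝ) (p : ℕ) : ENNReal :=
  ∫⁻ y in (box d p)ᶜ, ENNReal.ofReal (tailWeight s (y : Space d))

theorem tail_eq (s : ℝ) (p : ℕ) (γ : Configuration d) : tail s p γ
    = ∫⁻ y, (box d p)ᶜ.indicator (fun y => ENNReal.ofReal (tailWeight s y)) y
        ∂(pointMeasure γ) := by
  rw [tail, lintegral_indicator (measurableSet_box d p).compl]

theorem measurable_tailWeight_indicator (s : ℝ) (p : ℕ) :
    Measurable ((box d p)ᶜ.indicator (fun y => ENNReal.ofReal (tailWeight s y))) :=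
  (measurable_tailWeight s).ennreal_ofReal.indicator (measurableSet_box d p).compl

theorem measurable_tail (s : ℝ) (p : ℕ) : Measurable (tail s p : Configuration d → ENNReal) := by
  simp only [funext fun γ => tail_eq (d := d) s p γ]
  exact (measurable_tailWeight_indicator s p).lintegral_kernel (κ := pointKernel)

theorem iInter_box_compl [NeZero d] : ⋂ p, (box d p)ᶜ = ∅ := by
  refine Set.eq_empty_of_forall_notMem fun x hx => ?_
  obtain ⟨p, hp⟩ := ((tendsto_side d).eventually_ge_atTop (2 * ‖x‖)).exists
  exact Set.mem_iInter.1 hx p (closedBall_subset_box (r := ‖x‖) (by linarith) (by simp))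

/-- Continuity from above for the measure of density `f`: the complements of the boxes decrease to
the empty set, and one finite value suffices. -/
theorem tendsto_setLIntegral_box_compl [NeZero d] {μ : Measure (Space d)} {f : Space d → ENNReal}
    {q : ℕ} (hf : ∫⁻ y in (box d q)ᶜ, f y ∂μ ≠ ⊤) :
    Tendsto (fun p => ∫⁻ y in (box d p)ᶜ, f y ∂μ) atTop (𝓝 0) := by
  have h := tendsto_measure_iInter_atTop (μ := μ.withDensity f) (s := fun p => (box d p)ᶜ)
    (fun p => (measurableSet_box d p).compl.nullMeasurableSet)
    (fun p q hpq => Set.compl_subset_compl.2 (box_mono hpq))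
    ⟨q, by rwa [withDensity_apply _ (measurableSet_box d q).compl]⟩
  rw [iInter_box_compl, measure_empty] at h
  refine h.congr fun p => ?_
  rw [Function.comp_apply, withDensity_apply _ (measurableSet_box d p).compl]

theorem meanTail_ne_top {s : ℝ} (hsd : (d : ℝ) < s + 1) (p : ℕ) : meanTail d s p ≠ ⊤ := by
  have h : Integrable (tailWeight s : Space d → ℝ) :=
    integrable_one_add_norm (by simpa using hsd)
  have h2 : ∫⁻ y, ENNReal.ofReal (tailWeight s (y : Space d)) ≠ ⊤ := by
    rw [← ofReal_integral_eq_lintegral_ofReal h (Eventually.of_forall (tailWeight_nonneg s))]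
    exact ENNReal.ofReal_ne_top
  exact ne_top_of_le_ne_top h2 (setLIntegral_le_lintegral _ _)

theorem tendsto_meanTail [NeZero d] {s : ℝ} (hsd : (d : ℝ) < s + 1) :
    Tendsto (meanTail d s) atTop (𝓝 0) :=
  tendsto_setLIntegral_box_compl (q := 0) (meanTail_ne_top hsd 0)

theorem tendsto_tail [NeZero d] {s : ℝ} {q : ℕ} {γ : Configuration d} (h : tail s q γ ≠ ⊤) :
    Tendsto (fun p => tail s p γ) atTop (𝓝 0) :=
  tendsto_setLIntegral_box_compl (q := q) h

theorem finsum_tailWeight_le {s : ℝ} {p : ℕ} {γ : Configuration d} (h : tail s p γ ≠ ⊤)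
    {A : Set (Space d)} (hA : MeasurableSet A) (hb : IsBounded A) (hAp : A ⊆ (box d p)ᶜ) :
    ∑ᶠ y ∈ γ.carrier ∩ A, tailWeight s y ≤ (tail s p γ).toReal := by
  rw [finsum_mem_eq_integral _ hA hb, integral_eq_lintegral_of_nonneg_ae
    (Eventually.of_forall (tailWeight_nonneg s)) (measurable_tailWeight s).aestronglyMeasurable]
  exact ENNReal.toReal_mono h (lintegral_mono_set hAp)

/-! ### Convergence of the move function -/

/-- The constant in the bound `|g(x - y) - g(y)| ≤ C (1 + |y|)^{-(s+1)}`. -/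
def moveConst (s D : ℝ) : ℝ := s * (1 / 4) ^ (-(s + 1)) * D

theorem moveConst_nonneg {s D : ℝ} (hs : 0 < s) (hD : 0 ≤ D) : 0 ≤ moveConst s D := by
  unfold moveConst; positivity

theorem abs_riesz_sub_riesz_le_tailWeight {s D : ℝ} (hs : 0 < s) {x y : Space d}
    (hx : ‖x‖ ≤ D) (hy : 2 * D + 1 ≤ ‖y‖) :
    |riesz s (x - y) - riesz s y| ≤ moveConst s D * tailWeight s y := by
  have hD : 0 ≤ D := (norm_nonneg x).trans hx
  have h1 : ‖y‖ - ‖x‖ ≤ ‖x - y‖ := by rw [norm_sub_rev]; exact norm_sub_norm_le y x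
  have hm : 0 < 1 / 4 * (1 + ‖y‖) := by positivity
  -- The comparison points are `x - y` and `-y`, which differ by `x`. The hypothesis on `‖y‖` keeps
  -- both at norm at least `(1 + ‖y‖)/4`.
  have h := abs_riesz_sub_le hs hm (x := x - y) (y := -y) (by linarith) (by rw [norm_neg]; linarith)
  rw [riesz_neg, sub_neg_eq_add, sub_add_cancel] at h
  refine h.trans ?_
  rw [Real.mul_rpow (by norm_num) (by positivity), moveConst, tailWeight]
  calc s * ((1 / 4) ^ (-(s + 1)) * (1 + ‖y‖) ^ (-(s + 1))) * ‖x‖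
      ≤ s * ((1 / 4) ^ (-(s + 1)) * (1 + ‖y‖) ^ (-(s + 1))) * D :=
        mul_le_mul_of_nonneg_left hx (by positivity)
    _ = _ := by ring

theorem abs_truncatedMove_sub_le [NeZero d] {s D : ℝ} (hs : 0 < s) {Δ : Set (Space d)}
    (hD0 : 0 ≤ D) (hD : Δ ⊆ Metric.closedBall 0 D) {p q : ℕ} (hp : 2 * D + 1 ≤ side d p / 2)
    (hpq : p ≤ q) {γ : Configuration d} (hT : tail s p γ ≠ ⊤) (η : Configuration d) :
    |truncatedMove s Δ q η γ - truncatedMove s Δ p η γ|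
      ≤ count Δ η * (moveConst s D * (tail s p γ).toReal) := by
  have hΔb : IsBounded Δ := Metric.isBounded_closedBall.subset hD
  have hΔp : Δ ⊆ box d p := hD.trans (closedBall_subset_box (by linarith))
  refine abs_finsum_mem_sub_le (carrier_inter_finite η hΔb) fun x hx => ?_
  have hxD : ‖x‖ ≤ D := by simpa using hD hx.2
  have hfin := carrier_inter_finite γ ((isBounded_box d q).subset (Set.sdiff_subset (t := Δ)))
  -- Since `Δ ⊆ Λ_p`, the additional points all lie outside `Λ_p`, where the decay estimate applies.
  have hdiff : (γ.carrier ∩ (box d q \ Δ)) \ (γ.carrier ∩ (box d p \ Δ))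
      = γ.carrier ∩ (box d q \ box d p) := by
    ext y
    have := @hΔp y
    simp only [Set.mem_sdiff, Set.mem_inter_iff]
    tauto
  have hsub : γ.carrier ∩ (box d p \ Δ) ⊆ γ.carrier ∩ (box d q \ Δ) :=
    Set.inter_subset_inter_right _ (Set.sdiff_subset_sdiff_left (box_mono hpq))
  have h := abs_finsum_mem_sub_le_of_subset hfin hsub
    (f := fun y => riesz s (x - y) - riesz s y) (h := fun y => moveConst s D * tailWeight s y)
    (fun y hy => ?_)
  · refine h.trans ?_
    rw [hdiff, ← mul_finsum_mem]
    exact mul_le_mul_of_nonneg_left (finsum_tailWeight_le hT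
      ((measurableSet_box d q).diff (measurableSet_box d p))
      ((isBounded_box d q).subset Set.sdiff_subset) fun y hy => hy.2) (moveConst_nonneg hs hD0)
  · rw [hdiff] at hy
    exact abs_riesz_sub_riesz_le_tailWeight hs hxD (hp.trans (half_side_le_norm hy.2.2))

/-- The truncations form a Cauchy sequence, controlled by the tail of `γ`, so `limUnder` is a true
limit. The condition involves `γ` alone, hence one exceptional set serves all `η`. -/
theorem tendsto_truncatedMove [NeZero d] {s D : ℝ} (hs : 0 < s) {Δ : Set (Space d)}
    (hD0 : 0 ≤ D) (hD : Δ ⊆ Metric.closedBall 0 D) {q : ℕ} {γ : Configuration d}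
    (hT : tail s q γ ≠ ⊤) (η : Configuration d) :
    Tendsto (fun p => truncatedMove s Δ p η γ) atTop (𝓝 (move s Δ η γ)) := by
  have hside := (tendsto_side d).eventually_ge_atTop (2 * (2 * D + 1))
  have ht := tendsto_tail hT
  have hfin : ∀ᶠ p in atTop, tail s p γ < ⊤ := ht.eventually_lt_const (by simp)
  refine CauchySeq.tendsto_limUnder (Metric.cauchySeq_iff'.2 fun ε hε => ?_)
  have hlim : Tendsto (fun p => count Δ η * (moveConst s D * (tail s p γ).toReal)) atTop (𝓝 0) := by
    have h1 := (ENNReal.tendsto_toReal ENNReal.zero_ne_top).comp ht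
    simpa using (h1.const_mul (moveConst s D)).const_mul (count Δ η : ℝ)
  obtain ⟨p, hp1, hp2, hp3⟩ := (hside.and (hfin.and (hlim.eventually_lt_const hε))).exists
  refine ⟨p, fun r hr => ?_⟩
  rw [Real.dist_eq]
  exact (abs_truncatedMove_sub_le hs hD0 hD (by linarith) hr hp2.ne η).trans_lt hp3

theorem abs_move_sub_le [NeZero d] {s D : ℝ} (hs : 0 < s) {Δ : Set (Space d)}
    (hD0 : 0 ≤ D) (hD : Δ ⊆ Metric.closedBall 0 D) {p : ℕ} (hp : 2 * D + 1 ≤ side d p / 2)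
    {γ : Configuration d} (hT : tail s p γ ≠ ⊤) (η : Configuration d) :
    |move s Δ η γ - truncatedMove s Δ p η γ|
      ≤ count Δ η * (moveConst s D * (tail s p γ).toReal) := by
  refine le_of_tendsto ((tendsto_truncatedMove hs hD0 hD hT η).sub_const _).abs ?_
  filter_upwards [eventually_ge_atTop p] with q hq
  exact abs_truncatedMove_sub_le hs hD0 hD hp hq hT η

/-- Dropping `g(x - y) ≥ 0` leaves a bound depending on `η` only through its number of points in
`Δ`. With `H ≥ 0` it bounds the Boltzmann factor from above. -/
theorem le_truncatedMove [NeZero d] (s : ℝ) {Δ : Set (Space d)} (hb : IsBounded Δ) (p : ℕ)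
    (η γ : Configuration d) :
    -(count Δ η * ∑ᶠ y ∈ γ.carrier ∩ (box d p \ Δ), riesz s y) ≤ truncatedMove s Δ p η γ := by
  obtain ⟨X, hX⟩ := (carrier_inter_finite η hb).exists_finset_coe
  obtain ⟨Y, hY⟩ := (carrier_inter_finite γ
    ((isBounded_box d p).subset (Set.sdiff_subset (t := Δ)))).exists_finset_coe
  rw [truncatedMove, count, ← hX, ← hY, Set.ncard_coe_finset]
  simp only [finsum_mem_coe_finset]
  rw [← nsmul_eq_mul, ← Finset.sum_const, ← Finset.sum_neg_distrib]
  refine Finset.sum_le_sum fun x _ => ?_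
  rw [← Finset.sum_neg_distrib]
  refine Finset.sum_le_sum fun y _ => ?_
  linarith [riesz_nonneg s (x - y)]

/-! ### Comparison of the energies -/

theorem pairEnergy_coe {φ : Space d → ℝ} (Z : Finset (Space d)) {γ : Configuration d}
    (h : γ.carrier = Z) :
    pairEnergy φ γ
      = (1 / 2) * ∑ x ∈ Z, ∑ y ∈ Z, ({x}ᶜ : Set (Space d)).indicator (fun y => φ (x - y)) y := by
  have hb : IsBounded (Z : Set (Space d)) := Z.finite_toSet.isBounded
  have h1 := pairEnergy_eq (φ := φ) γ hb
  rw [restrict_of_subset h.le, h, Set.inter_self] at h1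
  simpa only [finsum_mem_coe_finset] using h1

theorem pairEnergy_union {φ : Space d → ℝ} (hφ : ∀ x, φ (-x) = φ x) [DecidableEq (Space d)]
    {X Y : Finset (Space d)} (hXY : Disjoint X Y) {γ η ξ : Configuration d}
    (hγ : γ.carrier = (X ∪ Y : Finset (Space d))) (hη : η.carrier = X) (hξ : ξ.carrier = Y) :
    pairEnergy φ γ = pairEnergy φ η + pairEnergy φ ξ + ∑ x ∈ X, ∑ y ∈ Y, φ (x - y) := by
  rw [pairEnergy_coe _ hγ, pairEnergy_coe _ hη, pairEnergy_coe _ hξ, Finset.sum_union hXY]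
  simp only [Finset.sum_union hXY, Finset.sum_add_distrib]
  have hne {x y : Space d} (hx : x ∈ X) (hy : y ∈ Y) : x ≠ y := fun h =>
    Finset.disjoint_left.1 hXY hx (h ▸ hy)
  have h1 : ∑ x ∈ X, ∑ y ∈ Y, ({x}ᶜ : Set (Space d)).indicator (fun y => φ (x - y)) y
      = ∑ x ∈ X, ∑ y ∈ Y, φ (x - y) :=
    Finset.sum_congr rfl fun x hx => Finset.sum_congr rfl fun y hy => by
      simp [(hne hx hy).symm]
  have h2 : ∑ y ∈ Y, ∑ x ∈ X, ({y}ᶜ : Set (Space d)).indicator (fun x => φ (y - x)) x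
      = ∑ x ∈ X, ∑ y ∈ Y, φ (x - y) := by
    rw [Finset.sum_comm]
    refine Finset.sum_congr rfl fun x hx => Finset.sum_congr rfl fun y hy => ?_
    rw [Set.indicator_of_mem (by simpa using hne hx hy), ← hφ, neg_sub]
  rw [h1, h2]
  ring

/-- After removal of `g`, the remainder `g_n - g` is nearly constant at the scale of `Δ`. Inside `Δ`
it is replaced by its value at `0`; between `Δ` and an outside point `y`, by its value at `y`. The
replaced terms depend on `η` only through its fixed number of points, and enter `c` together with
the energy of the outside points. -/
theorem exists_energy_comparison [NeZero d] {s D : ℝ} (hs : 0 < s) (hsd : (d : ℝ) < s + 1)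
    {Δ : Set (Space d)} (hD0 : 0 ≤ D) (hD : Δ ⊆ Metric.closedBall 0 D) :
    ∃ K : ℝ, 0 ≤ K ∧ ∀ n p : ℕ, 1 ≤ n → p ≤ n → 2 * D + 1 ≤ side d p / 2 →
      ∀ γ : Configuration d, γ.carrier ⊆ box d n → count (box d n) γ = n → tail s p γ ≠ ⊤ →
      ∃ c : ℝ, ∀ η : Configuration d, η.carrier ⊆ Δ → count Δ η = count Δ γ →
        |periodicEnergy s n (glue Δ η γ) - (energy s η + truncatedMove s Δ p η γ) - c|
          ≤ count Δ γ * (moveConst s D * (tail s p γ).toReal + K * (n * side d n ^ (-(s + 1)))) := by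
  classical
  obtain ⟨K, hK0, hK⟩ := exists_lipschitz_remainder (d := d) hs hsd
  -- The inner pairs (displacement up to `2D`, factor `1/2`) and the mixed pairs (displacement up to
  -- `D`) each contribute `D * K`.
  refine ⟨2 * D * K, by positivity, fun n p hn hpn hp γ hγ hγn hT => ?_⟩
  have hΔb : IsBounded Δ := Metric.isBounded_closedBall.subset hD
  have hpL := side_mono d hpn
  have hL := side_pos d hn
  set L := side d n
  obtain ⟨Y, hY⟩ := (carrier_inter_finite γ
    ((isBounded_box d n).subset (Set.sdiff_subset (t := Δ)))).exists_finset_coe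
  have hξ : (γ.restrict Δᶜ).carrier = Y := by
    rw [hY]
    ext y
    have := @hγ y
    simp only [restrict, Set.mem_inter_iff, Set.mem_compl_iff, Set.mem_sdiff]
    tauto
  have hYn : (Y.card : ℝ) ≤ n := by
    rw [← hγn, count, ← Set.ncard_coe_finset, hY]
    exact_mod_cast Set.ncard_le_ncard (Set.inter_subset_inter_right _ Set.sdiff_subset)
      (carrier_inter_finite γ (isBounded_box d n))
  -- This trades the quadratic count `N²` of inner pairs for `N n`, so that the error stays linear
  -- in `N`.
  have hNn : (count Δ γ : ℝ) ≤ n := by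
    have hΔn : Δ ⊆ box d n := hD.trans (closedBall_subset_box (by linarith))
    rw [← hγn]
    exact_mod_cast Set.ncard_le_ncard (Set.inter_subset_inter_right _ hΔn)
      (carrier_inter_finite γ (isBounded_box d n))
  set N : ℝ := (count Δ γ : ℝ) with hN
  have hN0 : 0 ≤ N := Nat.cast_nonneg _
  set r0 := periodicRiesz s n (0 : Space d) - riesz s (0 : Space d)
  refine ⟨pairEnergy (periodicRiesz s n) (γ.restrict Δᶜ) + 1 / 2 * (N * (N - 1) * r0)
    + N * ∑ y ∈ Y, periodicRiesz s n y, fun η hη hηN => ?_⟩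
  obtain ⟨X, hX⟩ := (carrier_inter_finite η hΔb).exists_finset_coe
  have hηX : η.carrier = X := by rw [hX, Set.inter_eq_left.2 hη]
  have hXN : (X.card : ℝ) = N := by
    rw [hN, ← hηN, count, ← hX, Set.ncard_coe_finset]
  have hXD (x : Space d) (hx : x ∈ X) : ‖x‖ ≤ D := by
    have : x ∈ η.carrier ∩ Δ := hX ▸ hx
    simpa using hD this.2
  have hYb (y : Space d) (hy : y ∈ Y) : y ∈ box d n := by
    have : y ∈ γ.carrier ∩ (box d n \ Δ) := hY ▸ hy
    exact this.2.1
  have hdisj : Disjoint X Y := by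
    rw [Finset.disjoint_left]
    intro x hx hy
    have h1 : x ∈ η.carrier ∩ Δ := hX ▸ hx
    have h2 : x ∈ γ.carrier ∩ (box d n \ Δ) := hY ▸ hy
    exact h2.2.2 h1.2
  have hglue : (glue Δ η γ).carrier = (X ∪ Y : Finset (Space d)) := by
    rw [glue_of_subset hη, Finset.coe_union, ← hξ, ← hηX]; rfl
  have hmove : truncatedMove s Δ n η γ = ∑ x ∈ X, ∑ y ∈ Y, (riesz s (x - y) - riesz s y) := by
    rw [truncatedMove, ← hX, ← hY]
    simp only [finsum_mem_coe_finset]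
  have hMM := abs_truncatedMove_sub_le hs hD0 hD hp hpn hT η
  rw [hηN, ← hN] at hMM
  rw [periodicEnergy, pairEnergy_union (periodicRiesz_neg s n) hdisj hglue hηX hξ, energy]
  set R := L ^ (-(s + 1))
  have hR0 : 0 ≤ R := by positivity
  -- the interaction inside `Δ`
  have hin : |pairEnergy (periodicRiesz s n) η - pairEnergy (riesz s) η
      - 1 / 2 * (N * (N - 1) * r0)| ≤ N * (D * K * (n * R)) := by
    have hoff : ∑ x ∈ X, ∑ y ∈ X, ({x}ᶜ : Set (Space d)).indicator (fun _ => r0) y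
        = N * (N - 1) * r0 := by
      have h1 (x : Space d) (hx : x ∈ X) :
          ∑ y ∈ X, ({x}ᶜ : Set (Space d)).indicator (fun _ => r0) y = (N - 1) * r0 := by
        have h2 : ∑ y ∈ X, ({x}ᶜ : Set (Space d)).indicator (fun _ => r0) y
            = ∑ y ∈ X, (r0 - if y = x then r0 else 0) := by
          refine Finset.sum_congr rfl fun y _ => ?_
          by_cases h : y = x <;> simp [h]
        rw [h2, Finset.sum_sub_distrib, Finset.sum_const, Finset.sum_ite_eq' X x, if_pos hx,
          nsmul_eq_mul, hXN]
        ring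
      rw [Finset.sum_congr rfl h1, Finset.sum_const, nsmul_eq_mul, hXN]
      ring
    rw [pairEnergy_coe _ hηX, pairEnergy_coe _ hηX, ← mul_sub, ← hoff, ← mul_sub,
      ← Finset.sum_sub_distrib, ← Finset.sum_sub_distrib, abs_mul]
    have h3 : |∑ x ∈ X, (∑ y ∈ X, ({x}ᶜ : Set (Space d)).indicator
          (fun y => periodicRiesz s n (x - y)) y
        - ∑ y ∈ X, ({x}ᶜ : Set (Space d)).indicator (fun y => riesz s (x - y)) y
        - ∑ y ∈ X, ({x}ᶜ : Set (Space d)).indicator (fun _ => r0) y)|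
        ≤ X.card • (X.card • (K * R * (2 * D))) := by
      refine (Finset.abs_sum_le_sum_abs _ _).trans (Finset.sum_le_card_nsmul _ _ _ fun x hx => ?_)
      rw [← Finset.sum_sub_distrib, ← Finset.sum_sub_distrib]
      refine (Finset.abs_sum_le_sum_abs _ _).trans (Finset.sum_le_card_nsmul _ _ _ fun y hy => ?_)
      by_cases h : y = x
      · simp only [h, Set.mem_compl_iff, Set.mem_singleton_iff, not_true_eq_false,
          not_false_eq_true, Set.indicator_of_notMem, sub_zero, abs_zero]
        positivity
      · have hmem : y ∈ ({x}ᶜ : Set (Space d)) := by simpa using h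
        simp only [Set.indicator_of_mem hmem]
        have hxy : ‖x - y‖ ≤ 2 * D := (norm_sub_le x y).trans (by linarith [hXD x hx, hXD y hy])
        refine (hK n hn (x - y) 0 (fun i => ?_) (fun i => ?_)).trans ?_
        · exact (abs_apply_le_norm _ i).trans (by linarith)
        · simp only [PiLp.zero_apply, abs_zero]; positivity
        · rw [sub_zero]
          exact mul_le_mul_of_nonneg_left hxy (by positivity)
    rw [nsmul_eq_mul, nsmul_eq_mul, hXN] at h3
    rw [abs_of_pos (by norm_num : (0 : ℝ) < 1 / 2)]
    have h4 : N * (N * (K * R * (2 * D))) ≤ N * (n * (K * R * (2 * D))) :=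
      mul_le_mul_of_nonneg_left (mul_le_mul_of_nonneg_right hNn (by positivity)) hN0
    calc _ ≤ 1 / 2 * (N * (n * (K * R * (2 * D)))) :=
          mul_le_mul_of_nonneg_left (h3.trans h4) (by norm_num)
      _ = _ := by ring
  -- the interaction between `Δ` and its complement
  have hout : |∑ x ∈ X, ∑ y ∈ Y, periodicRiesz s n (x - y) - truncatedMove s Δ n η γ
      - N * ∑ y ∈ Y, periodicRiesz s n y| ≤ N * (D * K * (n * R)) := by
    rw [hmove, ← hXN, ← nsmul_eq_mul, ← Finset.sum_const, ← Finset.sum_sub_distrib,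
      ← Finset.sum_sub_distrib]
    have h3 : |∑ x ∈ X, (∑ y ∈ Y, periodicRiesz s n (x - y)
        - ∑ y ∈ Y, (riesz s (x - y) - riesz s y) - ∑ y ∈ Y, periodicRiesz s n y)|
        ≤ X.card • (Y.card • (K * R * D)) := by
      refine (Finset.abs_sum_le_sum_abs _ _).trans (Finset.sum_le_card_nsmul _ _ _ fun x hx => ?_)
      rw [← Finset.sum_sub_distrib, ← Finset.sum_sub_distrib]
      refine (Finset.abs_sum_le_sum_abs _ _).trans (Finset.sum_le_card_nsmul _ _ _ fun y hy => ?_)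
      have hyb := hYb y hy
      have h5 := hK n hn (x - y) (-y) (fun i => ?_) (fun i => ?_)
      · rw [periodicRiesz_neg, riesz_neg, sub_neg_eq_add, sub_add_cancel] at h5
        -- The move term turns the expression into an increment of `g_n - g` between `x - y` and
        -- `-y`, by evenness.
        rw [show periodicRiesz s n (x - y) - (riesz s (x - y) - riesz s y) - periodicRiesz s n y
          = periodicRiesz s n (x - y) - riesz s (x - y) - (periodicRiesz s n y - riesz s y) by ring]
        exact h5.trans (mul_le_mul_of_nonneg_left (hXD x hx) (by positivity))
      · have h6 := (abs_apply_le_norm x i).trans (hXD x hx)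
        have h7 : |y i| ≤ L / 2 := hyb i
        rw [PiLp.sub_apply]
        exact (abs_sub _ _).trans (by linarith)
      · have h7 : |y i| ≤ L / 2 := hyb i
        rw [PiLp.neg_apply, abs_neg]
        linarith
    refine h3.trans ?_
    rw [nsmul_eq_mul, nsmul_eq_mul, hXN]
    calc N * (Y.card * (K * R * D)) ≤ N * (n * (K * R * D)) :=
          mul_le_mul_of_nonneg_left (mul_le_mul_of_nonneg_right hYn (by positivity)) hN0
      _ = _ := by ring
  set e1 := pairEnergy (periodicRiesz s n) η
  set e2 := pairEnergy (riesz s) η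
  set e3 := pairEnergy (periodicRiesz s n) (γ.restrict Δᶜ)
  set e4 := ∑ x ∈ X, ∑ y ∈ Y, periodicRiesz s n (x - y)
  set e5 := truncatedMove s Δ n η γ
  set e6 := truncatedMove s Δ p η γ
  -- The last difference changes the truncation from `Λ_n` to `Λ_p` and is paid for by the tail.
  rw [show e1 + e3 + e4 - (e2 + e6) - (e3 + 1 / 2 * (N * (N - 1) * r0)
      + N * ∑ y ∈ Y, periodicRiesz s n y)
    = (e1 - e2 - 1 / 2 * (N * (N - 1) * r0)) + (e4 - e5 - N * ∑ y ∈ Y, periodicRiesz s n y)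
      + (e5 - e6) by ring]
  refine (abs_add_three _ _ _).trans ?_
  calc _ ≤ N * (D * K * (n * R)) + N * (D * K * (n * R))
        + N * (moveConst s D * (tail s p γ).toReal) := by gcongr
    _ = _ := by ring

/-! ### Ratios of exponential integrals -/

/-- In effect `min 1 (e^z - 1) ≤ 2√z`: for `z ≤ 1` one has `e^z - 1 ≤ 2z`, and for `z > 1` the bound
exceeds `1`. -/
theorem min_le_of_sq_le {z t : ℝ} (hz : 0 ≤ z) (ht : 0 ≤ t) (h : 4 * z ≤ t ^ 2) {a : ℝ}
    (h1 : a ≤ 1) (h2 : a ≤ Real.exp z - 1) : a ≤ t := by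
  rcases le_or_gt z 1 with hz1 | hz1
  · have h3 : Real.exp z - 1 - z ≤ z ^ 2 :=
      (le_abs_self _).trans (Real.abs_exp_sub_one_sub_id_le (by rwa [abs_of_nonneg hz]))
    have h4 : 2 * z ≤ t := by
      refine abs_le_of_sq_le_sq' ?_ ht |>.2
      nlinarith
    nlinarith
  · have : 1 ≤ t := by
      by_contra hlt
      nlinarith
    linarith

/-- The average of `f` with respect to the probability measure proportional to `e^V ν`. -/
def expAverage {Ω : Type*} [MeasurableSpace Ω] (ν : Measure Ω) (V f : Ω → ℝ) : ℝ :=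
  (∫ ω, f ω * Real.exp (V ω) ∂ν) / ∫ ω, Real.exp (V ω) ∂ν

section ExpAverage

variable {Ω : Type*} [MeasurableSpace Ω] {ν : Measure Ω} {V V₁ V₂ f : Ω → ℝ}

theorem integrable_mul_exp (hf : Measurable f) (hf0 : ∀ ω, 0 ≤ f ω) (hf1 : ∀ ω, f ω ≤ 1)
    (hV : Integrable (fun ω => Real.exp (V ω)) ν) :
    Integrable (fun ω => f ω * Real.exp (V ω)) ν :=
  hV.bdd_mul (c := 1) hf.aestronglyMeasurable
    (Eventually.of_forall fun ω => by rw [Real.norm_of_nonneg (hf0 ω)]; exact hf1 ω)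

theorem expAverage_mem_Icc (hf : Measurable f) (hf0 : ∀ ω, 0 ≤ f ω) (hf1 : ∀ ω, f ω ≤ 1) :
    expAverage ν V f ∈ Set.Icc (0 : ℝ) 1 := by
  have h0 : 0 ≤ ∫ ω, Real.exp (V ω) ∂ν := integral_nonneg fun ω => (Real.exp_pos _).le
  refine ⟨div_nonneg (integral_nonneg fun ω => mul_nonneg (hf0 ω) (Real.exp_pos _).le) h0, ?_⟩
  by_cases hV : Integrable (fun ω => Real.exp (V ω)) ν
  · refine div_le_one_of_le₀ ?_ h0
    refine integral_mono (integrable_mul_exp hf hf0 hf1 hV) hV fun ω => ?_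
    exact mul_le_of_le_one_left (Real.exp_pos _).le (hf1 ω)
  -- Without integrability the denominator is `0` by convention and so is the quotient; the bounds
  -- thus hold for every potential.
  · simp [expAverage, integral_undef hV]

/-- The constant `c` cancels between numerator and denominator, and the two errors multiply to
`e^{2δ}`. The average being at most `1` turns the ratio estimate into a difference estimate. -/
theorem expAverage_sub_le [NeZero ν] (hf : Measurable f) (hf0 : ∀ ω, 0 ≤ f ω)
    (hf1 : ∀ ω, f ω ≤ 1) (hV₁ : Integrable (fun ω => Real.exp (V₁ ω)) ν)
    (hV₂ : Integrable (fun ω => Real.exp (V₂ ω)) ν) {c δ : ℝ}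
    (h : ∀ᵐ ω ∂ν, |V₁ ω - V₂ ω - c| ≤ δ) :
    expAverage ν V₁ f - expAverage ν V₂ f ≤ Real.exp (2 * δ) - 1 := by
  have hZ₁ := integral_exp_pos hV₁
  have hZ₂ := integral_exp_pos hV₂
  have hup : ∫ ω, f ω * Real.exp (V₁ ω) ∂ν
      ≤ Real.exp (c + δ) * ∫ ω, f ω * Real.exp (V₂ ω) ∂ν := by
    rw [← integral_const_mul]
    refine integral_mono_ae (integrable_mul_exp hf hf0 hf1 hV₁)
      ((integrable_mul_exp hf hf0 hf1 hV₂).const_mul _) ?_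
    filter_upwards [h] with ω hω
    have : Real.exp (V₁ ω) ≤ Real.exp (c + δ) * Real.exp (V₂ ω) := by
      rw [← Real.exp_add]
      exact Real.exp_le_exp.2 (by linarith [(abs_le.1 hω).2])
    calc f ω * Real.exp (V₁ ω) ≤ f ω * (Real.exp (c + δ) * Real.exp (V₂ ω)) :=
          mul_le_mul_of_nonneg_left this (hf0 ω)
      _ = _ := by ring
  have hlow : Real.exp (c - δ) * ∫ ω, Real.exp (V₂ ω) ∂ν ≤ ∫ ω, Real.exp (V₁ ω) ∂ν := by
    rw [← integral_const_mul]
    refine integral_mono_ae (hV₂.const_mul _) hV₁ ?_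
    filter_upwards [h] with ω hω
    rw [← Real.exp_add]
    exact Real.exp_le_exp.2 (by linarith [(abs_le.1 hω).1])
  have hδ : 0 ≤ δ := by
    obtain ⟨ω, hω⟩ := h.exists
    exact (abs_nonneg _).trans hω
  set A₂ := ∫ ω, f ω * Real.exp (V₂ ω) ∂ν
  set Z₂ := ∫ ω, Real.exp (V₂ ω) ∂ν
  have hA₂ : 0 ≤ A₂ := integral_nonneg fun ω => mul_nonneg (hf0 ω) (Real.exp_pos _).le
  have h1 : expAverage ν V₁ f ≤ Real.exp (2 * δ) * expAverage ν V₂ f := by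
    unfold expAverage
    calc _ ≤ (Real.exp (c + δ) * A₂) / (Real.exp (c - δ) * Z₂) :=
          div_le_div₀ (by positivity) hup (by positivity) hlow
      _ = Real.exp (2 * δ) * (A₂ / Z₂) := by
          have : Real.exp (c + δ) = Real.exp (2 * δ) * Real.exp (c - δ) := by
            rw [← Real.exp_add]; congr 1; ring
          rw [this]
          have := (Real.exp_pos (c - δ)).ne'
          field_simp
  have h2 := (expAverage_mem_Icc (ν := ν) (V := V₂) hf hf0 hf1).2
  have h3 : 1 ≤ Real.exp (2 * δ) := Real.one_le_exp (by linarith)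
  nlinarith

/-- The difference is at most `1` and at most `e^{2Nb} - 1`, hence at most of order `√(N b)`, which
the arithmetic-geometric inequality splits. The result can be integrated knowing only the first
moments of `N` and `b`. -/
theorem abs_expAverage_sub_le [NeZero ν] (hf : Measurable f) (hf0 : ∀ ω, 0 ≤ f ω)
    (hf1 : ∀ ω, f ω ≤ 1) (hV₁ : Integrable (fun ω => Real.exp (V₁ ω)) ν)
    (hV₂ : Integrable (fun ω => Real.exp (V₂ ω)) ν) {c N b θ : ℝ} (hN : 0 ≤ N) (hb : 0 ≤ b)
    (hθ : 0 < θ) (h : ∀ᵐ ω ∂ν, |V₁ ω - V₂ ω - c| ≤ N * b) :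
    |expAverage ν V₁ f - expAverage ν V₂ f| ≤ θ * N + 2 * b / θ := by
  have h' : ∀ᵐ ω ∂ν, |V₂ ω - V₁ ω - (-c)| ≤ N * b := by
    filter_upwards [h] with ω hω
    rw [show V₂ ω - V₁ ω - (-c) = -(V₁ ω - V₂ ω - c) by ring, abs_neg]
    exact hω
  have hsq : 4 * (2 * (N * b)) ≤ (θ * N + 2 * b / θ) ^ 2 := by
    have : (θ * N + 2 * b / θ) ^ 2 = (θ * N - 2 * b / θ) ^ 2 + 4 * (2 * (N * b)) := by
      field_simp; ring
    rw [this]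
    nlinarith [sq_nonneg (θ * N - 2 * b / θ)]
  have hm₁ := expAverage_mem_Icc (ν := ν) (V := V₁) hf hf0 hf1
  have hm₂ := expAverage_mem_Icc (ν := ν) (V := V₂) hf hf0 hf1
  refine min_le_of_sq_le (z := 2 * (N * b)) (by positivity) (by positivity) hsq ?_ ?_
  · rw [abs_le]; constructor <;> linarith [hm₁.1, hm₁.2, hm₂.1, hm₂.2]
  · rw [abs_le]
    constructor
    · linarith [expAverage_sub_le hf hf0 hf1 hV₂ hV₁ h']
    · exact expAverage_sub_le hf hf0 hf1 hV₁ hV₂ h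

end ExpAverage

/-! ### Point processes with intensity at most one -/

/-- The intensity measure of the point process `Q` is at most the Lebesgue measure. -/
def IntensityLE (Q : Measure (Configuration d)) : Prop :=
  ∀ φ : Space d → ENNReal, Measurable φ →
    ∫⁻ γ, ∫⁻ y, φ y ∂(pointMeasure γ) ∂Q ≤ ∫⁻ y, φ y

namespace IntensityLE

variable {Q : Measure (Configuration d)}

theorem lintegral_pointMeasure_le (hQ : IntensityLE Q) {A : Set (Space d)} (hA : MeasurableSet A) :
    ∫⁻ γ, pointMeasure γ A ∂Q ≤ volume A := by
  have h := hQ (A.indicator 1) (measurable_one.indicator hA)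
  simpa only [lintegral_indicator_one hA] using h

theorem lintegral_count_le (hQ : IntensityLE Q) {A : Set (Space d)} (hA : MeasurableSet A)
    (hb : IsBounded A) : ∫⁻ γ, (count A γ : ENNReal) ∂Q ≤ volume A := by
  simpa only [pointMeasure_apply _ hA hb] using hQ.lintegral_pointMeasure_le hA

theorem ae_pointMeasure_eq_zero (hQ : IntensityLE Q) {A : Set (Space d)} (hA : MeasurableSet A)
    (h0 : volume A = 0) : ∀ᵐ γ ∂Q, pointMeasure γ A = 0 := by
  have h := hQ.lintegral_pointMeasure_le hA
  have hm : Measurable fun γ : Configuration d => pointMeasure γ A :=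
    Kernel.measurable_coe pointKernel hA
  rw [h0, nonpos_iff_eq_zero, lintegral_eq_zero_iff hm] at h
  exact h

theorem ae_count_eq_zero (hQ : IntensityLE Q) {A : Set (Space d)} (hA : MeasurableSet A)
    (hb : IsBounded A) : ∀ᵐ γ ∂Q, volume A = 0 → count A γ = 0 := by
  by_cases h0 : volume A = 0
  · filter_upwards [hQ.ae_pointMeasure_eq_zero hA h0] with γ hγ _
    rw [pointMeasure_apply _ hA hb] at hγ
    exact_mod_cast hγ
  · exact Eventually.of_forall fun _ h => absurd h h0

theorem ae_zero_notMem [NeZero d] (hQ : IntensityLE Q) :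
    ∀ᵐ γ ∂Q, (0 : Space d) ∉ γ.carrier := by
  filter_upwards [hQ.ae_pointMeasure_eq_zero (measurableSet_singleton (0 : Space d)) (by simp)]
    with γ hγ h0
  rw [pointMeasure, Measure.restrict_apply (measurableSet_singleton _),
    Set.inter_eq_left.2 (Set.singleton_subset_iff.2 h0)] at hγ
  simp at hγ

theorem lintegral_tail_le (hQ : IntensityLE Q) (s : ℝ) (p : ℕ) :
    ∫⁻ γ, tail s p γ ∂Q ≤ meanTail d s p := by
  simp only [tail_eq]
  refine (hQ _ (measurable_tailWeight_indicator s p)).trans (le_of_eq ?_)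
  rw [meanTail, lintegral_indicator (measurableSet_box d p).compl]

theorem ae_tail_ne_top (hQ : IntensityLE Q) {s : ℝ} (hsd : (d : ℝ) < s + 1) (p : ℕ) :
    ∀ᵐ γ ∂Q, tail s p γ ≠ ⊤ := by
  have h := ae_lt_top (measurable_tail s p)
    (ne_top_of_le_ne_top (meanTail_ne_top hsd p) (hQ.lintegral_tail_le s p))
  filter_upwards [h] with γ hγ using hγ.ne

theorem integrable_tail (hQ : IntensityLE Q) {s : ℝ} (hsd : (d : ℝ) < s + 1) (p : ℕ) :
    Integrable (fun γ => (tail s p γ).toReal) Q :=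
  integrable_toReal_of_lintegral_ne_top (measurable_tail s p).aemeasurable
    (ne_top_of_le_ne_top (meanTail_ne_top hsd p) (hQ.lintegral_tail_le s p))

theorem integral_tail_le (hQ : IntensityLE Q) {s : ℝ} (hsd : (d : ℝ) < s + 1) (p : ℕ) :
    ∫ γ, (tail s p γ).toReal ∂Q ≤ (meanTail d s p).toReal := by
  rw [integral_toReal (measurable_tail s p).aemeasurable
    (by filter_upwards [hQ.ae_tail_ne_top hsd p] with γ hγ using hγ.lt_top)]
  exact ENNReal.toReal_mono (meanTail_ne_top hsd p) (hQ.lintegral_tail_le s p)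

theorem measurable_count_ennreal {A : Set (Space d)} (hA : MeasurableSet A) (hb : IsBounded A) :
    Measurable fun γ : Configuration d => (count A γ : ENNReal) :=
  (measurable_from_top (f := fun n : ℕ => (n : ENNReal))).comp (measurable_count hA hb)

theorem integrable_count (hQ : IntensityLE Q) {A : Set (Space d)} (hA : MeasurableSet A)
    (hb : IsBounded A) : Integrable (fun γ => (count A γ : ℝ)) Q := by
  have h := integrable_toReal_of_lintegral_ne_top (measurable_count_ennreal hA hb).aemeasurable
    (ne_top_of_le_ne_top hb.measure_lt_top.ne (hQ.lintegral_count_le hA hb))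
  simpa using h

theorem integral_count_le (hQ : IntensityLE Q) {A : Set (Space d)} (hA : MeasurableSet A)
    (hb : IsBounded A) : ∫ γ, (count A γ : ℝ) ∂Q ≤ volume.real A := by
  have h := integral_toReal (μ := Q) (measurable_count_ennreal hA hb).aemeasurable
    (Eventually.of_forall fun γ => by simp)
  simp only [ENNReal.toReal_natCast] at h
  rw [h]
  exact ENNReal.toReal_mono hb.measure_lt_top.ne (hQ.lintegral_count_le hA hb)

end IntensityLE

theorem intensityLE_torusGibbs [NeZero d] {s β : ℝ} (hs : 0 < s) (hsd : (d : ℝ) < s + 1)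
    (hβ : 0 < β) {n : ℕ} (hn : 1 ≤ n) : IntensityLE (torusGibbs d s β n) := fun φ hφ => by
  rw [lintegral_pointMeasure_torusGibbs hs hsd hβ hn hφ]
  exact setLIntegral_le_lintegral _ _

/-- The left side integrates `φ` against the intensity measure `Q.bind pointMeasure`. A bound on
bounded sets extends to all Borel sets by summing over shells. -/
theorem intensityLE_of_count {Q : Measure (Configuration d)}
    (h : ∀ A : Set (Space d), MeasurableSet A → IsBounded A →
      ∫⁻ γ, (count A γ : ENNReal) ∂Q ≤ volume A) : IntensityLE Q := by
  intro φ hφ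
  have hκ : Measurable (pointMeasure : Configuration d → Measure (Space d)) :=
    measurable_pointMeasure
  rw [← Measure.lintegral_bind hκ.aemeasurable hφ.aemeasurable]
  refine lintegral_mono' (Measure.le_iff.2 fun A hA => ?_) le_rfl
  have hd : ∀ μ : Measure (Space d), μ A
      = ∑' m, μ (A ∩ disjointed (fun m : ℕ => Metric.closedBall (0 : Space d) m) m) := by
    intro μ
    rw [← measure_iUnion, ← Set.inter_iUnion, iUnion_closedBall_disjointed, Set.inter_univ]
    · exact fun i j hij => ((disjoint_disjointed _) hij).mono Set.inter_subset_right
        Set.inter_subset_right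
    · exact fun m => hA.inter (measurableSet_shell m)
  rw [hd, hd volume]
  refine ENNReal.tsum_le_tsum fun m => ?_
  have hb := (isBounded_shell (d := d) m).subset (Set.inter_subset_right (s := A))
  have hm := hA.inter (measurableSet_shell m)
  rw [Measure.bind_apply hm hκ.aemeasurable]
  simp only [pointMeasure_apply _ hm hb]
  exact h _ hm hb

/-! ### Convergence along an ultrafilter -/

/-- An accumulation point is a limit along some ultrafilter finer than `atTop`; no subsequence need
be extracted in the local topology. -/
theorem exists_ultrafilter_tendsto {s β : ℝ} {P : Measure (Configuration d)}
    (hP : IsCircularRieszGas s β P) : ∃ U : Ultrafilter ℕ, (U : Filter ℕ) ≤ atTop ∧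
      ∀ f : Configuration d → ℝ, IsLocalTame f →
        Tendsto (fun n => ∫ γ, f γ ∂(torusGibbs d s β n)) U (𝓝 (∫ γ, f γ ∂P)) := by
  let _ := localTopology d
  obtain ⟨U, hU, h⟩ := mapClusterPt_iff_ultrafilter.1 hP.2
  refine ⟨U, hU, fun f hf => ?_⟩
  rw [localTopology, nhds_iInf, tendsto_iInf] at h
  have h1 := h ⟨f, hf⟩
  rw [nhds_induced, tendsto_comap_iff] at h1
  exact h1

theorem isLocalTame_of_bounded {A : Set (Space d)} (hA : MeasurableSet A) (hb : IsBounded A)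
    {f : Configuration d → ℝ} (hf : Measurable[sigmaOf d A] f) {b : ℝ} (hfb : ∀ γ, |f γ| ≤ b) :
    IsLocalTame f := by
  refine ⟨A, hA, hb, hf, b, fun γ => (hfb γ).trans ?_⟩
  have h0 : 0 ≤ b := (abs_nonneg _).trans (hfb γ)
  nlinarith [(Nat.cast_nonneg (count A γ) : (0 : ℝ) ≤ _)]

theorem intensityLE_of_isCircularRieszGas [NeZero d] {s β : ℝ} (hs : 0 < s)
    (hsd : (d : ℝ) < s + 1) (hβ : 0 < β) {P : Measure (Configuration d)}
    (hP : IsCircularRieszGas s β P) : IntensityLE P := by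
  have := hP.1
  obtain ⟨U, hU, hlim⟩ := exists_ultrafilter_tendsto hP
  refine intensityLE_of_count fun A hA hb => ?_
  -- The count is capped so that its Bochner integral under `P` is meaningful before integrability
  -- is known; monotone convergence removes the cap.
  have hmin (M : ℕ) : ∫ γ, ((min (count A γ) M : ℕ) : ℝ) ∂P ≤ volume.real A := by
    have hmeas : Measurable[sigmaOf d A] fun γ : Configuration d => ((min (count A γ) M : ℕ) : ℝ) :=
      (measurable_from_top (f := fun k : ℕ => ((min k M : ℕ) : ℝ))).comp
        (measurable_count_sigmaOf hA hb le_rfl)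
    have ht := hlim _ (isLocalTame_of_bounded hA hb hmeas (b := M) fun γ => by
      rw [abs_of_nonneg (Nat.cast_nonneg _)]
      exact_mod_cast min_le_right _ _)
    refine le_of_tendsto ht ?_
    filter_upwards [hU (eventually_ge_atTop 1)] with n hn
    have hI := intensityLE_torusGibbs (d := d) hs hsd hβ hn
    refine le_trans ?_ (hI.integral_count_le hA hb)
    refine integral_mono_of_nonneg (Eventually.of_forall fun γ => Nat.cast_nonneg _)
      (hI.integrable_count hA hb) (Eventually.of_forall fun γ => ?_)
    exact Nat.cast_le.2 (min_le_left _ _)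
  have hmin' (M : ℕ) : ∫⁻ γ, ((min (count A γ) M : ℕ) : ENNReal) ∂P ≤ volume A := by
    have hm : Measurable fun γ : Configuration d => ((min (count A γ) M : ℕ) : ENNReal) :=
      (measurable_from_top (f := fun k : ℕ => ((min k M : ℕ) : ENNReal))).comp
        (measurable_count hA hb)
    have hfin : ∫⁻ γ, ((min (count A γ) M : ℕ) : ENNReal) ∂P ≠ ⊤ := by
      refine ne_top_of_le_ne_top (b := ∫⁻ _γ : Configuration d, (M : ENNReal) ∂P) (by simp) ?_
      exact lintegral_mono fun γ => Nat.cast_le.2 (min_le_right _ _)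
    have h := integral_toReal (μ := P) hm.aemeasurable (Eventually.of_forall fun γ => by simp)
    simp only [ENNReal.toReal_natCast] at h
    rw [← ENNReal.toReal_le_toReal hfin hb.measure_lt_top.ne, ← h]
    exact hmin M
  have hsup (γ : Configuration d) : (count A γ : ENNReal)
      = ⨆ M : ℕ, ((min (count A γ) M : ℕ) : ENNReal) := by
    refine le_antisymm (le_iSup_of_le (count A γ) (by simp)) (iSup_le fun M => ?_)
    exact_mod_cast min_le_left _ _
  simp only [hsup]
  rw [lintegral_iSup]
  · exact iSup_le hmin'
  · exact fun M => (measurable_from_top (f := fun k : ℕ => ((min k M : ℕ) : ENNReal))).comp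
        (measurable_count hA hb)
  · intro M M' hM γ
    exact Nat.cast_le.2 (min_le_min_left _ hM)

/-! ### Local averages -/

/-- The average of the indicator of `E` after resampling the points in `Δ` with the density
proportional to `e^V`. -/
def localAverage (Δ : Set (Space d)) (V : Configuration d → Configuration d → ℝ)
    (E : Set (Configuration d)) (γ : Configuration d) : ℝ :=
  expAverage (binomialProcess Δ (count Δ γ)) (V γ) fun η => E.indicator 1 (glue Δ η γ)

theorem isProbabilityMeasure_binomialProcess_of {Δ : Set (Space d)} (hb : IsBounded Δ) {N : ℕ}
    (h0 : volume Δ = 0 → N = 0) : IsProbabilityMeasure (binomialProcess Δ N) := by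
  by_cases hv : volume Δ = 0
  · rw [h0 hv, binomialProcess_zero]
    infer_instance
  · exact isProbabilityMeasure_binomialProcess hv hb N

theorem measurable_indicator_glue {Δ : Set (Space d)} (hΔ : MeasurableSet Δ)
    {E : Set (Configuration d)} (hE : MeasurableSet E) :
    Measurable fun q : Configuration d × Configuration d =>
      E.indicator (1 : Configuration d → ℝ) (glue Δ q.2 q.1) :=
  (measurable_one.indicator hE).comp ((measurable_glue hΔ).comp measurable_swap)

theorem measurable_indicator_glue_left {Δ : Set (Space d)} (hΔ : MeasurableSet Δ)
    {E : Set (Configuration d)} (hE : MeasurableSet E) (γ : Configuration d) :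
    Measurable fun η : Configuration d => E.indicator (1 : Configuration d → ℝ) (glue Δ η γ) :=
  (measurable_indicator_glue hΔ hE).comp (measurable_const.prodMk measurable_id)

theorem indicator_one_nonneg (E : Set (Configuration d)) (γ : Configuration d) :
    0 ≤ E.indicator (1 : Configuration d → ℝ) γ := Set.indicator_nonneg (fun _ _ => zero_le_one) _

theorem indicator_one_le_one (E : Set (Configuration d)) (γ : Configuration d) :
    E.indicator (1 : Configuration d → ℝ) γ ≤ 1 := Set.indicator_le_self' (by simp) _

theorem localAverage_mem_Icc {Δ : Set (Space d)} (hΔ : MeasurableSet Δ)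
    {E : Set (Configuration d)} (hE : MeasurableSet E)
    (V : Configuration d → Configuration d → ℝ) (γ : Configuration d) :
    localAverage Δ V E γ ∈ Set.Icc (0 : ℝ) 1 :=
  expAverage_mem_Icc (measurable_indicator_glue_left hΔ hE γ) (fun _ => indicator_one_nonneg E _)
    fun _ => indicator_one_le_one E _

theorem measurable_localAverage {Δ : Set (Space d)} (hΔ : MeasurableSet Δ) (hb : IsBounded Δ)
    {E : Set (Configuration d)} (hE : MeasurableSet E)
    {V : Configuration d → Configuration d → ℝ} (hV : Measurable (Function.uncurry V)) :
    Measurable (localAverage Δ V E) := by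
  have h1 : StronglyMeasurable fun γ => ∫ η, E.indicator (1 : Configuration d → ℝ) (glue Δ η γ)
      * Real.exp (V γ η) ∂(binomialKernel hΔ hb γ) :=
    StronglyMeasurable.integral_kernel_prod_right' (κ := binomialKernel hΔ hb)
      (f := fun q => E.indicator (1 : Configuration d → ℝ) (glue Δ q.2 q.1)
        * Real.exp (V q.1 q.2))
      ((measurable_indicator_glue hΔ hE).mul (Real.measurable_exp.comp hV)).stronglyMeasurable
  have h2 : StronglyMeasurable fun γ => ∫ η, Real.exp (V γ η) ∂(binomialKernel hΔ hb γ) :=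
    StronglyMeasurable.integral_kernel_prod_right' (κ := binomialKernel hΔ hb)
      (f := fun q => Real.exp (V q.1 q.2)) (Real.measurable_exp.comp hV).stronglyMeasurable
  exact h1.measurable.div h2.measurable

theorem integrable_localAverage {Δ : Set (Space d)} (hΔ : MeasurableSet Δ) (hb : IsBounded Δ)
    {E : Set (Configuration d)} (hE : MeasurableSet E)
    {V : Configuration d → Configuration d → ℝ} (hV : Measurable (Function.uncurry V))
    (Q : Measure (Configuration d)) [IsFiniteMeasure Q] :
    Integrable (localAverage Δ V E) Q :=
  Integrable.of_bound (measurable_localAverage hΔ hb hE hV).aestronglyMeasurable 1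
    (Eventually.of_forall fun γ => by
      have h := localAverage_mem_Icc hΔ hE V γ
      rw [Real.norm_of_nonneg h.1]
      exact h.2)

/-! ### The three potentials -/

/-- The potential of the configuration inside `Δ`, with truncated interaction. -/
def truncatedPotential (s β : ℝ) (Δ : Set (Space d)) (p : ℕ) (γ η : Configuration d) : ℝ :=
  -β * (energy s (η.restrict Δ) + truncatedMove s Δ p η γ)

/-- The potential of the configuration inside `Δ`. -/
def limitPotential (s β : ℝ) (Δ : Set (Space d)) (γ η : Configuration d) : ℝ :=
  -β * (energy s (η.restrict Δ) + move s Δ η γ)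

/-- The energy on the torus of the resampled configuration. -/
def torusPotential (s β : ℝ) (Δ : Set (Space d)) (n : ℕ) (γ η : Configuration d) : ℝ :=
  -β * periodicEnergy s n ((glue Δ η γ).restrict (box d n))

theorem energy_nonneg (s : ℝ) (η : Configuration d) : 0 ≤ energy s η :=
  mul_nonneg (by norm_num) (finsum_nonneg fun _ => finsum_nonneg fun _ => riesz_nonneg s _)

theorem integrable_exp_of_le {Δ : Set (Space d)} {N : ℕ} {V : Configuration d → ℝ}
    (hV : Measurable V) {C : ℝ}
    (h : ∀ᵐ η ∂(binomialProcess Δ N), V η ≤ C) :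
    Integrable (fun η => Real.exp (V η)) (binomialProcess Δ N) := by
  refine Integrable.of_bound (Real.measurable_exp.comp hV).aestronglyMeasurable (Real.exp C) ?_
  filter_upwards [h] with η hη
  rw [Real.norm_of_nonneg (Real.exp_pos _).le]
  exact Real.exp_le_exp.2 hη

theorem measurable_of_uncurry {V : Configuration d → Configuration d → ℝ}
    (hV : Measurable (Function.uncurry V)) (γ : Configuration d) : Measurable (V γ) :=
  hV.comp (measurable_const.prodMk measurable_id)

theorem integrable_exp_of_abs_sub_le {Δ : Set (Space d)} {N : ℕ}
    {V₁ V₂ : Configuration d → ℝ} (hV₁ : Measurable V₁)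
    (hV₂ : Integrable (fun η => Real.exp (V₂ η)) (binomialProcess Δ N)) {c δ : ℝ}
    (h : ∀ᵐ η ∂(binomialProcess Δ N), |V₁ η - V₂ η - c| ≤ δ) :
    Integrable (fun η => Real.exp (V₁ η)) (binomialProcess Δ N) := by
  refine (hV₂.const_mul (Real.exp (c + δ))).mono'
    (Real.measurable_exp.comp hV₁).aestronglyMeasurable ?_
  filter_upwards [h] with η hη
  rw [Real.norm_of_nonneg (Real.exp_pos _).le, ← Real.exp_add]
  exact Real.exp_le_exp.2 (by linarith [(abs_le.1 hη).2])

section Potentials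

variable [NeZero d] {s β : ℝ} {Δ : Set (Space d)}

theorem measurable_truncatedPotential (hΔ : MeasurableSet Δ) (hb : IsBounded Δ) (s β : ℝ) (p : ℕ) :
    Measurable (Function.uncurry (truncatedPotential s β Δ p)) := by
  refine Measurable.const_mul (Measurable.add ?_ ?_) _
  · exact (measurable_pairEnergy_restrict (measurable_riesz s) hΔ hb).comp measurable_snd
  · exact (truncatedMove_measurable s hΔ hb p (measurableSet_box d p) (isBounded_box d p)).comp
      measurable_swap

theorem measurable_limitPotential (hΔ : MeasurableSet Δ) (hb : IsBounded Δ) (s β : ℝ) :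
    Measurable (Function.uncurry (limitPotential s β Δ)) := by
  refine Measurable.const_mul (Measurable.add ?_ ?_) _
  · exact (measurable_pairEnergy_restrict (measurable_riesz s) hΔ hb).comp measurable_snd
  · have h : StronglyMeasurable fun q : Configuration d × Configuration d =>
        limUnder atTop fun p : ℕ => truncatedMove s Δ p q.2 q.1 :=
      StronglyMeasurable.limUnder fun p =>
        ((truncatedMove_measurable s hΔ hb p (measurableSet_box d p)
          (isBounded_box d p)).comp measurable_swap).stronglyMeasurable
    exact h.measurable

theorem measurable_torusPotential (hΔ : MeasurableSet Δ) (s β : ℝ) (n : ℕ) :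
    Measurable (Function.uncurry (torusPotential s β Δ n)) :=
  ((measurable_pairEnergy_restrict (measurable_periodicRiesz s n) (measurableSet_box d n)
    (isBounded_box d n)).comp ((measurable_glue hΔ).comp measurable_swap)).const_mul _

theorem ae_truncatedPotential_le (hΔ : MeasurableSet Δ) (hb : IsBounded Δ) (s : ℝ)
    (hβ : 0 < β) (p : ℕ) (γ : Configuration d) {N : ℕ} (h0 : volume Δ = 0 → N = 0) :
    ∀ᵐ η ∂(binomialProcess Δ N), truncatedPotential s β Δ p γ η
      ≤ β * (N * ∑ᶠ y ∈ γ.carrier ∩ (box d p \ Δ), riesz s y) := by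
  filter_upwards [ae_binomialProcess_count hΔ hb hΔ hb le_rfl h0] with η hη
  have h1 := le_truncatedMove s hb p η γ
  rw [hη] at h1
  have h2 := energy_nonneg s (η.restrict Δ)
  rw [truncatedPotential]
  nlinarith

theorem integrable_exp_truncatedPotential (hΔ : MeasurableSet Δ) (hb : IsBounded Δ) (s : ℝ)
    (hβ : 0 < β) (p : ℕ) {γ : Configuration d} (h0 : volume Δ = 0 → count Δ γ = 0) :
    Integrable (fun η => Real.exp (truncatedPotential s β Δ p γ η))
      (binomialProcess Δ (count Δ γ)) :=
  integrable_exp_of_le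
    (measurable_of_uncurry (measurable_truncatedPotential hΔ hb s β p) γ)
    (ae_truncatedPotential_le hΔ hb s hβ p γ h0)

theorem ae_abs_limitPotential_sub_le {D : ℝ} (hs : 0 < s) (hβ : 0 < β) (hΔ : MeasurableSet Δ)
    (hD0 : 0 ≤ D) (hD : Δ ⊆ Metric.closedBall 0 D) {p : ℕ} (hp : 2 * D + 1 ≤ side d p / 2)
    {γ : Configuration d} (hT : tail s p γ ≠ ⊤) (h0 : volume Δ = 0 → count Δ γ = 0) :
    ∀ᵐ η ∂(binomialProcess Δ (count Δ γ)),
      |limitPotential s β Δ γ η - truncatedPotential s β Δ p γ η - 0|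
        ≤ count Δ γ * (β * (moveConst s D * (tail s p γ).toReal)) := by
  have hb : IsBounded Δ := Metric.isBounded_closedBall.subset hD
  filter_upwards [ae_binomialProcess_count hΔ hb hΔ hb le_rfl h0] with η hη
  have h := abs_move_sub_le hs hD0 hD hp hT η
  rw [hη] at h
  rw [limitPotential, truncatedPotential, sub_zero, ← mul_sub, add_sub_add_left_eq_sub, abs_mul,
    abs_neg, abs_of_pos hβ]
  calc _ ≤ β * _ := mul_le_mul_of_nonneg_left h hβ.le
    _ = _ := by ring

theorem integrable_exp_limitPotential {D : ℝ} (hs : 0 < s) (hβ : 0 < β) (hΔ : MeasurableSet Δ)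
    (hD0 : 0 ≤ D) (hD : Δ ⊆ Metric.closedBall 0 D) {p : ℕ} (hp : 2 * D + 1 ≤ side d p / 2)
    {γ : Configuration d} (hT : tail s p γ ≠ ⊤) (h0 : volume Δ = 0 → count Δ γ = 0) :
    Integrable (fun η => Real.exp (limitPotential s β Δ γ η))
      (binomialProcess Δ (count Δ γ)) :=
  have hb : IsBounded Δ := Metric.isBounded_closedBall.subset hD
  integrable_exp_of_abs_sub_le (measurable_of_uncurry (measurable_limitPotential hΔ hb s β) γ)
    (integrable_exp_truncatedPotential hΔ hb s hβ p h0)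
    (ae_abs_limitPotential_sub_le hs hβ hΔ hD0 hD hp hT h0)

theorem abs_localAverage_limit_sub_le {D : ℝ} (hs : 0 < s) (hβ : 0 < β) (hΔ : MeasurableSet Δ)
    (hD0 : 0 ≤ D) (hD : Δ ⊆ Metric.closedBall 0 D) {p : ℕ} (hp : 2 * D + 1 ≤ side d p / 2)
    {γ : Configuration d} (hT : tail s p γ ≠ ⊤) (h0 : volume Δ = 0 → count Δ γ = 0)
    {E : Set (Configuration d)} (hE : MeasurableSet E) {θ : ℝ} (hθ : 0 < θ) :
    |localAverage Δ (limitPotential s β Δ) E γ - localAverage Δ (truncatedPotential s β Δ p) E γ|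
      ≤ θ * count Δ γ + 2 * (β * (moveConst s D * (tail s p γ).toReal)) / θ := by
  have hb : IsBounded Δ := Metric.isBounded_closedBall.subset hD
  have := isProbabilityMeasure_binomialProcess_of hb h0
  have hC := moveConst_nonneg hs hD0
  exact abs_expAverage_sub_le (measurable_indicator_glue_left hΔ hE γ)
    (fun _ => indicator_one_nonneg E _) (fun _ => indicator_one_le_one E _)
    (integrable_exp_limitPotential hs hβ hΔ hD0 hD hp hT h0)
    (integrable_exp_truncatedPotential hΔ hb s hβ p h0) (Nat.cast_nonneg _) (by positivity) hθ
    (ae_abs_limitPotential_sub_le hs hβ hΔ hD0 hD hp hT h0)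

/-- The energy comparison enters with its constant `c`, which the normalisation absorbs. `K` is
uniform in `n`, `p` and `γ`. -/
theorem exists_abs_localAverage_torus_sub_le {D : ℝ} (hs : 0 < s) (hsd : (d : ℝ) < s + 1)
    (hβ : 0 < β) (hΔ : MeasurableSet Δ) (hD0 : 0 ≤ D) (hD : Δ ⊆ Metric.closedBall 0 D) :
    ∃ K : ℝ, 0 ≤ K ∧ ∀ n p : ℕ, 1 ≤ n → p ≤ n → 2 * D + 1 ≤ side d p / 2 →
      ∀ γ : Configuration d, γ.carrier ⊆ box d n → count (box d n) γ = n → tail s p γ ≠ ⊤ →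
      (volume Δ = 0 → count Δ γ = 0) → ∀ E : Set (Configuration d), MeasurableSet E →
      ∀ θ : ℝ, 0 < θ →
      |localAverage Δ (torusPotential s β Δ n) E γ
        - localAverage Δ (truncatedPotential s β Δ p) E γ|
      ≤ θ * count Δ γ + 2 * (β * (moveConst s D * (tail s p γ).toReal
        + K * (n * side d n ^ (-(s + 1))))) / θ := by
  have hb : IsBounded Δ := Metric.isBounded_closedBall.subset hD
  obtain ⟨K, hK0, hK⟩ := exists_energy_comparison hs hsd hD0 hD
  refine ⟨K, hK0, fun n p hn hpn hp γ hγ hγn hT h0 E hE θ hθ => ?_⟩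
  have := isProbabilityMeasure_binomialProcess_of hb h0
  have hC := moveConst_nonneg hs hD0
  obtain ⟨c, hc⟩ := hK n p hn hpn hp γ hγ hγn hT
  have hΔn : Δ ⊆ box d n := hD.trans (closedBall_subset_box (by
    have := side_mono d hpn; linarith))
  have hae : ∀ᵐ η ∂(binomialProcess Δ (count Δ γ)),
      |torusPotential s β Δ n γ η - truncatedPotential s β Δ p γ η - (-β * c)|
        ≤ count Δ γ * (β * (moveConst s D * (tail s p γ).toReal
          + K * (n * side d n ^ (-(s + 1))))) := by
    filter_upwards [ae_binomialProcess_subset hΔ _,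
      ae_binomialProcess_count hΔ hb hΔ hb le_rfl h0] with η hη hηN
    have hg : (glue Δ η γ).carrier ⊆ box d n := by
      rintro x (hx | hx)
      · exact hΔn hx.2
      · exact hγ hx.1
    have h := hc η hη hηN
    rw [torusPotential, truncatedPotential, restrict_of_subset hg, restrict_of_subset hη,
      ← mul_sub, ← mul_sub, abs_mul, abs_neg, abs_of_pos hβ]
    calc _ ≤ β * _ := mul_le_mul_of_nonneg_left h hβ.le
      _ = _ := by ring
  have hside := side_nonneg d n
  exact abs_expAverage_sub_le (measurable_indicator_glue_left hΔ hE γ)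
    (fun _ => indicator_one_nonneg E _) (fun _ => indicator_one_le_one E _)
    (integrable_exp_of_abs_sub_le
      (measurable_of_uncurry (measurable_torusPotential hΔ s β n) γ)
      (integrable_exp_truncatedPotential hΔ hb s hβ p h0) hae)
    (integrable_exp_truncatedPotential hΔ hb s hβ p h0) (Nat.cast_nonneg _) (by positivity) hθ hae

end Potentials

/-! ### Canonical DLR equations on the torus -/

theorem glue_glue (Δ : Set (Space d)) (η η' γ : Configuration d) :
    glue Δ η' (glue Δ η γ) = glue Δ η' γ := by
  rw [glue, glue_restrict_compl, glue]

theorem count_glue_self {Δ : Set (Space d)} (hΔ : MeasurableSet Δ) (hb : IsBounded Δ)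
    (η γ : Configuration d) : count Δ (glue Δ η γ) = count Δ η := by
  rw [count_glue hΔ hb, Set.inter_self, Set.compl_inter_self]
  simp [count]

/-- The quotient depends on `γ` only through the points outside `Δ` and their number inside, so
resampling leaves it unchanged. Resampling the outer integral therefore averages `w` alone, and this
average cancels the denominator, which is nonzero because `w` is. -/
theorem lintegral_resampled_average [NeZero d] {Λ Δ : Set (Space d)} (hΔ : MeasurableSet Δ)
    (hsub : Δ ⊆ Λ) (hΛ : MeasurableSet Λ) (hΛb : IsBounded Λ) (hΛ0 : volume Λ ≠ 0) (n : ℕ)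
    {w G : Configuration d → ENNReal} (hw : Measurable w) (hG : Measurable G)
    (hw0 : ∀ γ, w γ ≠ 0) (hfin : ∫⁻ γ, w γ ∂(binomialProcess Λ n) ≠ ⊤) :
    ∫⁻ γ, w γ * ((∫⁻ η, G (glue Δ η γ) ∂(binomialProcess Δ (count Δ γ)))
        / ∫⁻ η, w (glue Δ η γ) ∂(binomialProcess Δ (count Δ γ))) ∂(binomialProcess Λ n)
      = ∫⁻ γ, G γ ∂(binomialProcess Λ n) := by
  have hΔb := hΛb.subset hsub
  have hglue : Measurable fun q : Configuration d × Configuration d => glue Δ q.2 q.1 :=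
    (measurable_glue hΔ).comp measurable_swap
  have hJ {G : Configuration d → ENNReal} (hG : Measurable G) : Measurable fun γ =>
      ∫⁻ η, G (glue Δ η γ) ∂(binomialProcess Δ (count Δ γ)) :=
    measurable_lintegral_binomialProcess hΔ hΔb (hG.comp hglue)
  have hres {G : Configuration d → ENNReal} (hG : Measurable G) :=
    lintegral_resample hΔ hsub hΛ hΛb hΛ0 n hG
  have hfin' : ∀ᵐ γ ∂(binomialProcess Λ n),
      ∫⁻ η, w (glue Δ η γ) ∂(binomialProcess Δ (count Δ γ)) < ⊤ :=
    ae_lt_top (hJ hw) (by rwa [hres hw])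
  have hgood : ∀ᵐ γ ∂(binomialProcess Λ n), volume Δ = 0 → count Δ γ = 0 := by
    by_cases h0 : volume Δ = 0
    · filter_upwards [ae_binomialProcess_count_eq_zero hΔ hΔb h0 (Λ := Λ) n] with γ hγ _ using hγ
    · exact Eventually.of_forall fun _ h => absurd h h0
  set F : Configuration d → ENNReal := fun γ =>
    (∫⁻ η, G (glue Δ η γ) ∂(binomialProcess Δ (count Δ γ)))
      / ∫⁻ η, w (glue Δ η γ) ∂(binomialProcess Δ (count Δ γ)) with hF
  have hFm : Measurable F := (hJ hG).div (hJ hw)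
  have hmul : Measurable fun γ => w γ * F γ := hw.mul hFm
  rw [← hres hmul, ← hres hG]
  refine lintegral_congr_ae ?_
  filter_upwards [hfin', hgood] with γ hγ h0
  have hprob := isProbabilityMeasure_binomialProcess_of hΔb h0
  have hwγ : Measurable fun η => w (glue Δ η γ) :=
    (hw.comp hglue).comp (measurable_const.prodMk measurable_id)
  have h1 : ∫⁻ η, w (glue Δ η γ) * F (glue Δ η γ) ∂(binomialProcess Δ (count Δ γ))
      = ∫⁻ η, w (glue Δ η γ) * F γ ∂(binomialProcess Δ (count Δ γ)) := by
    refine lintegral_congr_ae ?_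
    filter_upwards [ae_binomialProcess_count hΔ hΔb hΔ hΔb le_rfl h0] with η hη
    have : F (glue Δ η γ) = F γ := by
      simp only [hF, glue_glue, count_glue_self hΔ hΔb, hη]
    rw [this]
  rw [h1, lintegral_mul_const _ hwγ, hF, ENNReal.mul_div_cancel _ hγ.ne]
  intro h
  rw [lintegral_eq_zero_iff hwγ] at h
  obtain ⟨η, hη⟩ := h.exists
  exact hw0 _ hη

/-- This is `lintegral_resampled_average` with `w = e^{-β H_n}` and `G = 1_E w`; the rest passes
from extended nonnegative to real integrals. -/
theorem torusGibbs_real_eq_integral [NeZero d] {s β : ℝ} (hs : 0 < s) (hsd : (d : ℝ) < s + 1)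
    (hβ : 0 < β) {n : ℕ} (hn : 1 ≤ n) {Δ : Set (Space d)} (hΔ : MeasurableSet Δ)
    (hsub : Δ ⊆ box d n) {E : Set (Configuration d)} (hE : MeasurableSet E) :
    (torusGibbs d s β n).real E
      = ∫ γ, localAverage Δ (torusPotential s β Δ n) E γ ∂(torusGibbs d s β n) := by
  have hΔb := (isBounded_box d n).subset hsub
  have hprob := isProbabilityMeasure_torusGibbs (d := d) hs hsd hβ hn
  set B := binomialProcess (box d n) n
  have hwm := measurable_gibbsWeight (d := d) s β n
  set w : Configuration d → ENNReal := fun γ => ENNReal.ofReal (gibbsWeight s β n γ) with hwdef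
  set G : Configuration d → ENNReal := fun γ =>
    ENNReal.ofReal (E.indicator (1 : Configuration d → ℝ) γ * gibbsWeight s β n γ) with hGdef
  have hw : Measurable w := hwm.ennreal_ofReal
  have hG : Measurable G := ((measurable_one.indicator hE).mul hwm).ennreal_ofReal
  have hfin : ∫⁻ γ, w γ ∂B ≠ ⊤ := by
    rw [hwdef, ← ofReal_integral_eq_lintegral_ofReal (integrable_gibbsWeight hs hsd hβ hn)
      (Eventually.of_forall fun γ => (gibbsWeight_pos s β n γ).le)]
    exact ENNReal.ofReal_ne_top
  have hglue : Measurable fun q : Configuration d × Configuration d => glue Δ q.2 q.1 :=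
    (measurable_glue hΔ).comp measurable_swap
  have hJ {G : Configuration d → ENNReal} (hG : Measurable G) : Measurable fun γ =>
      ∫⁻ η, G (glue Δ η γ) ∂(binomialProcess Δ (count Δ γ)) :=
    measurable_lintegral_binomialProcess hΔ hΔb (hG.comp hglue)
  have hmain := lintegral_resampled_average hΔ hsub (measurableSet_box d n) (isBounded_box d n)
    (volume_box_ne_zero hn) n hw hG (fun γ => by
      simpa [hwdef] using gibbsWeight_pos s β n γ) hfin
  set F : Configuration d → ENNReal := fun γ =>
    (∫⁻ η, G (glue Δ η γ) ∂(binomialProcess Δ (count Δ γ)))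
      / ∫⁻ η, w (glue Δ η γ) ∂(binomialProcess Δ (count Δ γ)) with hF
  have hFm : Measurable F := (hJ hG).div (hJ hw)
  have hgibbs {H : Configuration d → ENNReal} (hH : Measurable H) :
      ∫⁻ γ, H γ ∂(torusGibbs d s β n)
        = ENNReal.ofReal (1 / torusPartition d s β n) * ∫⁻ γ, w γ * H γ ∂B := by
    have hZ := torusPartition_pos (d := d) hs hsd hβ hn
    have hmul : Measurable fun γ => w γ * H γ := hw.mul hH
    rw [lintegral_torusGibbs hH, ← lintegral_const_mul _ hmul]
    refine lintegral_congr fun γ => ?_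
    rw [ENNReal.ofReal_mul (by positivity), mul_assoc]
  have h1 : torusGibbs d s β n E = ∫⁻ γ, F γ ∂(torusGibbs d s β n) := by
    rw [hgibbs hFm, hmain, ← lintegral_indicator_one hE,
      hgibbs (measurable_one.indicator hE)]
    congr 1
    refine lintegral_congr fun γ => ?_
    by_cases hγ : γ ∈ E <;> simp [hwdef, hGdef, hγ]
  have hfin' : ∀ᵐ γ ∂(torusGibbs d s β n),
      ∫⁻ η, w (glue Δ η γ) ∂(binomialProcess Δ (count Δ γ)) < ⊤ := by
    refine torusGibbs_absolutelyContinuous.ae_le (ae_lt_top (hJ hw) ?_)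
    rwa [lintegral_resample hΔ hsub (measurableSet_box d n) (isBounded_box d n)
      (volume_box_ne_zero hn) n hw]
  have h2 : ∫⁻ γ, F γ ∂(torusGibbs d s β n)
      = ∫⁻ γ, ENNReal.ofReal (localAverage Δ (torusPotential s β Δ n) E γ)
        ∂(torusGibbs d s β n) := by
    refine lintegral_congr_ae ?_
    filter_upwards [hfin', (intensityLE_torusGibbs hs hsd hβ hn).ae_count_eq_zero hΔ hΔb]
      with γ hγ h0
    have hprob := isProbabilityMeasure_binomialProcess_of hΔb h0
    have hexp (η : Configuration d) :
        Real.exp (torusPotential s β Δ n γ η) = gibbsWeight s β n (glue Δ η γ) := rfl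
    have hVm : Measurable fun η => Real.exp (torusPotential s β Δ n γ η) :=
      Real.measurable_exp.comp (measurable_of_uncurry (measurable_torusPotential hΔ s β n) γ)
    have hInt : Integrable (fun η => Real.exp (torusPotential s β Δ n γ η))
        (binomialProcess Δ (count Δ γ)) := by
      refine ⟨hVm.aestronglyMeasurable, ?_⟩
      rw [hasFiniteIntegral_iff_ofReal (Eventually.of_forall fun η => (Real.exp_pos _).le)]
      exact hγ
    have hint2 := integrable_mul_exp (measurable_indicator_glue_left hΔ hE γ)
      (fun _ => indicator_one_nonneg E _) (fun _ => indicator_one_le_one E _) hInt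
    rw [localAverage, expAverage, ENNReal.ofReal_div_of_pos (integral_exp_pos hInt),
      ofReal_integral_eq_lintegral_ofReal hInt (Eventually.of_forall fun η => (Real.exp_pos _).le),
      ofReal_integral_eq_lintegral_ofReal hint2 (Eventually.of_forall fun η =>
        mul_nonneg (indicator_one_nonneg E _) (Real.exp_pos _).le)]
    rfl
  have hnn (γ : Configuration d) : 0 ≤ localAverage Δ (torusPotential s β Δ n) E γ :=
    (localAverage_mem_Icc hΔ hE _ γ).1
  rw [Measure.real, h1, h2, ← ofReal_integral_eq_lintegral_ofReal
    (integrable_localAverage hΔ hΔb hE (measurable_torusPotential hΔ s β n) _)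
    (Eventually.of_forall hnn), ENNReal.toReal_ofReal (integral_nonneg hnn)]

/-! ### Canonical DLR equations in infinite volume, for local events -/

/-- Truncation makes the average see `γ` only in `Δ ∪ A ∪ Λ_p`, so it is an admissible test function
for the local topology. -/
theorem localAverage_truncated_restrict {s β : ℝ} {Δ A : Set (Space d)} {p : ℕ}
    {E : Set (Configuration d)} (hE : MeasurableSet[sigmaOf d A] E) (γ : Configuration d) :
    localAverage Δ (truncatedPotential s β Δ p) E γ
      = localAverage Δ (truncatedPotential s β Δ p) E (γ.restrict (Δ ∪ (A ∪ box d p))) := by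
  have hcount : count Δ (γ.restrict (Δ ∪ (A ∪ box d p))) = count Δ γ := by
    rw [count_restrict, Set.inter_eq_right.2 Set.subset_union_left]
  have hV (η : Configuration d) : truncatedPotential s β Δ p (γ.restrict (Δ ∪ (A ∪ box d p))) η
      = truncatedPotential s β Δ p γ η := by
    have : (γ.restrict (Δ ∪ (A ∪ box d p))).carrier ∩ (box d p \ Δ)
        = γ.carrier ∩ (box d p \ Δ) := by
      ext y
      simp only [restrict, Set.mem_inter_iff, Set.mem_union, Set.mem_sdiff]
      tauto
    simp only [truncatedPotential, truncatedMove, this]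
  have hI (η : Configuration d) :
      E.indicator (1 : Configuration d → ℝ) (glue Δ η (γ.restrict (Δ ∪ (A ∪ box d p))))
        = E.indicator 1 (glue Δ η γ) := by
    have hiff : glue Δ η (γ.restrict (Δ ∪ (A ∪ box d p))) ∈ E ↔ glue Δ η γ ∈ E := by
      rw [mem_iff_restrict_mem hE, mem_iff_restrict_mem hE (glue Δ η γ)]
      have : (glue Δ η (γ.restrict (Δ ∪ (A ∪ box d p)))).restrict A
          = (glue Δ η γ).restrict A := by
        ext y
        simp only [glue, Configuration.union, restrict, Set.mem_inter_iff, Set.mem_union,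
          Set.mem_compl_iff]
        tauto
      rw [this]
    by_cases h : glue Δ η γ ∈ E
    · rw [Set.indicator_of_mem h, Set.indicator_of_mem (hiff.2 h)]; rfl
    · rw [Set.indicator_of_notMem h, Set.indicator_of_notMem (fun h' => h (hiff.1 h'))]
  simp only [localAverage, expAverage, hcount, hV, hI]

theorem isLocalTame_localAverage [NeZero d] (s β : ℝ) {Δ A : Set (Space d)}
    (hΔ : MeasurableSet Δ) (hΔb : IsBounded Δ) (hA : MeasurableSet A) (hAb : IsBounded A) (p : ℕ)
    {E : Set (Configuration d)} (hE : MeasurableSet[sigmaOf d A] E) :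
    IsLocalTame (localAverage Δ (truncatedPotential s β Δ p) E) := by
  have hE' : MeasurableSet E := sigmaOf_le A _ hE
  have hm : MeasurableSet (Δ ∪ (A ∪ box d p)) := hΔ.union (hA.union (measurableSet_box d p))
  refine isLocalTame_of_bounded hm (hΔb.union (hAb.union (isBounded_box d p))) ?_ (b := 1)
    fun γ => ?_
  · rw [funext fun γ => localAverage_truncated_restrict (s := s) (β := β) (Δ := Δ) (p := p) hE γ]
    exact (measurable_localAverage hΔ hΔb hE'
      (measurable_truncatedPotential hΔ hΔb s β p)).comp (measurable_restrict_sigmaOf hm)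
  · have h := localAverage_mem_Icc hΔ hE' (truncatedPotential s β Δ p) γ
    rw [abs_of_nonneg h.1]
    exact h.2

theorem isLocalTame_indicator {A : Set (Space d)} (hA : MeasurableSet A) (hAb : IsBounded A)
    {E : Set (Configuration d)} (hE : MeasurableSet[sigmaOf d A] E) :
    IsLocalTame (E.indicator (1 : Configuration d → ℝ)) := by
  refine isLocalTame_of_bounded hA hAb ?_ (b := 1) fun γ => ?_
  · exact Measurable.indicator (m := sigmaOf d A) measurable_const hE
  · rw [abs_of_nonneg (indicator_one_nonneg E γ)]
    exact indicator_one_le_one E γ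

theorem integral_abs_sub_le {Q : Measure (Configuration d)} [IsProbabilityMeasure Q]
    (hQ : IntensityLE Q) {s : ℝ} (hsd : (d : ℝ) < s + 1) {Δ : Set (Space d)}
    (hΔ : MeasurableSet Δ) (hΔb : IsBounded Δ) {f g : Configuration d → ℝ} (hf : Integrable f Q)
    (hg : Integrable g Q) {a b c : ℝ} (ha : 0 ≤ a) (hb : 0 ≤ b) {p : ℕ}
    (h : ∀ᵐ γ ∂Q, |f γ - g γ| ≤ a * count Δ γ + b * (tail s p γ).toReal + c) :
    |∫ γ, f γ ∂Q - ∫ γ, g γ ∂Q| ≤ a * volume.real Δ + b * (meanTail d s p).toReal + c := by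
  have hc := (hQ.integrable_count hΔ hΔb).const_mul a
  have ht := (hQ.integrable_tail hsd p).const_mul b
  have hct : Integrable (fun γ => a * (count Δ γ : ℝ) + b * (tail s p γ).toReal) Q := hc.add ht
  rw [← integral_sub hf hg]
  calc |∫ γ, (f γ - g γ) ∂Q| ≤ ∫ γ, |f γ - g γ| ∂Q := abs_integral_le_integral_abs
    _ ≤ ∫ γ, (a * count Δ γ + b * (tail s p γ).toReal + c) ∂Q :=
        integral_mono_ae (hf.sub hg).abs (hct.add (integrable_const c)) h
    _ = a * ∫ γ, (count Δ γ : ℝ) ∂Q + b * ∫ γ, (tail s p γ).toReal ∂Q + c := by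
        rw [integral_add hct (integrable_const c), integral_add hc ht,
          integral_const_mul, integral_const_mul]
        simp
    _ ≤ _ := by
        have h1 := mul_le_mul_of_nonneg_left (hQ.integral_count_le hΔ hΔb) ha
        have h2 := mul_le_mul_of_nonneg_left (hQ.integral_tail_le hsd p) hb
        linarith

/-- Since `n` is the `d`-th power of the side, the expression is the side to the power `d - s - 1 <
0`. -/
theorem tendsto_volume_mul_side_rpow [NeZero d] {s : ℝ} (hsd : (d : ℝ) < s + 1) :
    Tendsto (fun n : ℕ => (n : ℝ) * side d n ^ (-(s + 1))) atTop (𝓝 0) := by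
  have h := (tendsto_rpow_neg_atTop (y := s + 1 - d) (by linarith)).comp (tendsto_side d)
  refine h.congr' ?_
  filter_upwards [eventually_ge_atTop 1] with n hn
  have hL := side_pos d hn
  rw [Function.comp_apply, ← side_pow d n, ← Real.rpow_natCast, ← Real.rpow_add hL]
  congr 1
  ring

theorem exists_subset_closedBall {Δ : Set (Space d)} (hb : IsBounded Δ) :
    ∃ D : ℝ, 0 ≤ D ∧ Δ ⊆ Metric.closedBall 0 D := by
  obtain ⟨D, hD⟩ := hb.subset_closedBall 0
  exact ⟨max D 0, le_max_right _ _,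
    hD.trans (Metric.closedBall_subset_closedBall (le_max_left _ _))⟩

theorem real_eq_integral_localAverage_of_local [NeZero d] {s β : ℝ} (hs : 0 < s)
    (hsd : (d : ℝ) < s + 1) (hβ : 0 < β) {P : Measure (Configuration d)}
    (hP : IsCircularRieszGas s β P) {Δ : Set (Space d)} (hΔ : MeasurableSet Δ)
    (hΔb : IsBounded Δ) {A : Set (Space d)} (hA : MeasurableSet A) (hAb : IsBounded A)
    {E : Set (Configuration d)} (hE : MeasurableSet[sigmaOf d A] E) :
    P.real E = ∫ γ, localAverage Δ (limitPotential s β Δ) E γ ∂P := by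
  have hPp := hP.1
  have hE' : MeasurableSet E := sigmaOf_le A _ hE
  have hI := intensityLE_of_isCircularRieszGas hs hsd hβ hP
  obtain ⟨U, hU, hlim⟩ := exists_ultrafilter_tendsto hP
  obtain ⟨D, hD0, hD⟩ := exists_subset_closedBall hΔb
  obtain ⟨K, hK0, hK⟩ := exists_abs_localAverage_torus_sub_le hs hsd hβ hΔ hD0 hD
  have hC := moveConst_nonneg hs hD0
  set C := moveConst s D
  set v := volume.real Δ
  set q := fun p => ∫ γ, localAverage Δ (truncatedPotential s β Δ p) E γ ∂P
  set x := P.real E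
  set y := ∫ γ, localAverage Δ (limitPotential s β Δ) E γ ∂P
  -- Under `P`, replace the full move function by its truncation.
  have hbound1 (p : ℕ) (hp : 2 * D + 1 ≤ side d p / 2) (θ : ℝ) (hθ : 0 < θ) :
      |y - q p| ≤ θ * v + 2 * β * C / θ * (meanTail d s p).toReal + 0 := by
    refine integral_abs_sub_le hI hsd hΔ hΔb
      (integrable_localAverage hΔ hΔb hE' (measurable_limitPotential hΔ hΔb s β) P)
      (integrable_localAverage hΔ hΔb hE' (measurable_truncatedPotential hΔ hΔb s β p) P)
      hθ.le (by positivity) ?_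
    filter_upwards [hI.ae_tail_ne_top hsd p, hI.ae_count_eq_zero hΔ hΔb] with γ hT h0
    refine (abs_localAverage_limit_sub_le hs hβ hΔ hD0 hD hp hT h0 hE' hθ).trans (le_of_eq ?_)
    ring
  -- On the torus, replace `H_n` by the truncated potential at fixed `p`, then pass to the limit
  -- along `U`: both quantities compared are integrals of local tame functions.
  have hbound2 (p : ℕ) (hp : 2 * D + 1 ≤ side d p / 2) (θ : ℝ) (hθ : 0 < θ) :
      |x - q p| ≤ θ * v + 2 * β * C / θ * (meanTail d s p).toReal + 0 := by
    have hx : Tendsto (fun n => (torusGibbs d s β n).real E) U (𝓝 x) := by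
      have := hlim _ (isLocalTame_indicator hA hAb hE)
      simpa only [integral_indicator_one hE'] using this
    have hq := hlim _ (isLocalTame_localAverage s β hΔ hΔb hA hAb p hE)
    have hδ : Tendsto (fun n : ℕ => θ * v + 2 * β * C / θ * (meanTail d s p).toReal
        + 2 * β * K / θ * (n * side d n ^ (-(s + 1)))) U
        (𝓝 (θ * v + 2 * β * C / θ * (meanTail d s p).toReal + 2 * β * K / θ * 0)) :=
      (((tendsto_volume_mul_side_rpow hsd).mono_left hU).const_mul _).const_add _
    rw [mul_zero] at hδ
    refine le_of_tendsto_of_tendsto (hx.sub hq).abs hδ ?_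
    filter_upwards [hU (eventually_ge_atTop (max 1 p))] with n hn
    have hn1 : 1 ≤ n := (le_max_left _ _).trans hn
    have hpn : p ≤ n := (le_max_right _ _).trans hn
    have hsub : Δ ⊆ box d n := hD.trans (closedBall_subset_box (by
      have := side_mono d hpn; linarith))
    have hprob := isProbabilityMeasure_torusGibbs (d := d) hs hsd hβ hn1
    have hIn := intensityLE_torusGibbs (d := d) hs hsd hβ hn1
    rw [torusGibbs_real_eq_integral hs hsd hβ hn1 hΔ hsub hE']
    refine integral_abs_sub_le hIn hsd hΔ hΔb
      (integrable_localAverage hΔ hΔb hE' (measurable_torusPotential hΔ s β n) _)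
      (integrable_localAverage hΔ hΔb hE' (measurable_truncatedPotential hΔ hΔb s β p) _)
      hθ.le (by positivity) ?_
    have hbox := measurableSet_box d n
    filter_upwards [hIn.ae_tail_ne_top hsd p, hIn.ae_count_eq_zero hΔ hΔb,
      torusGibbs_absolutelyContinuous.ae_le (ae_binomialProcess_subset hbox n),
      torusGibbs_absolutelyContinuous.ae_le (ae_binomialProcess_count hbox (isBounded_box d n)
        hbox (isBounded_box d n) le_rfl fun h => absurd h (volume_box_ne_zero hn1))]
      with γ hT h0 hγ hγn
    refine (hK n p hn1 hpn hp γ hγ hγn hT h0 E hE' θ hθ).trans (le_of_eq ?_)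
    ring
  -- For fixed `θ` the mean tail vanishes as `p → ∞`. The limit in `θ` must come last because the
  -- tail has the factor `1/θ`.
  have hθ (θ : ℝ) (hθ : 0 < θ) : |x - y| ≤ 2 * (θ * v) := by
    have hm : Tendsto (fun p => (meanTail d s p).toReal) atTop (𝓝 0) := by
      have h := (ENNReal.tendsto_toReal ENNReal.zero_ne_top).comp (tendsto_meanTail (d := d) hsd)
      rwa [ENNReal.toReal_zero] at h
    have hlim2 : Tendsto (fun p => 2 * (θ * v + 2 * β * C / θ * (meanTail d s p).toReal)) atTop
        (𝓝 (2 * (θ * v + 2 * β * C / θ * 0))) :=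
      ((hm.const_mul _).const_add _).const_mul _
    rw [mul_zero, add_zero] at hlim2
    refine ge_of_tendsto hlim2 ?_
    filter_upwards [(tendsto_side d).eventually_ge_atTop (2 * (2 * D + 1))] with p hp
    have h1 := hbound1 p (by linarith) θ hθ
    have h2 := hbound2 p (by linarith) θ hθ
    rw [abs_sub_comm] at h1
    have h3 := abs_sub_le x (q p) y
    linarith
  have hxy : |x - y| ≤ 0 := by
    have ht : Tendsto (fun θ : ℝ => 2 * (θ * v)) (𝓝[>] 0) (𝓝 (2 * (0 * v))) :=
      ((continuous_const.mul (continuous_id.mul continuous_const)).tendsto 0).mono_left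
        nhdsWithin_le_nhds
    rw [zero_mul, mul_zero] at ht
    exact ge_of_tendsto ht (by filter_upwards [self_mem_nhdsWithin] with θ h using hθ θ h)
  exact sub_eq_zero.1 (abs_eq_zero.1 (le_antisymm hxy (abs_nonneg _)))

/-! ### The resampling kernel -/

/-- The normalised density of the points in `Δ` given the configuration `γ` outside `Δ`. -/
def resampleDensity (Δ : Set (Space d)) (V : Configuration d → Configuration d → ℝ)
    (γ η : Configuration d) : ENNReal :=
  ENNReal.ofReal (Real.exp (V γ η) / ∫ η', Real.exp (V γ η') ∂(binomialProcess Δ (count Δ γ)))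

theorem measurable_resampleDensity {Δ : Set (Space d)} (hΔ : MeasurableSet Δ) (hb : IsBounded Δ)
    {V : Configuration d → Configuration d → ℝ} (hV : Measurable (Function.uncurry V)) :
    Measurable (Function.uncurry (resampleDensity Δ V)) := by
  have h : StronglyMeasurable fun γ => ∫ η, Real.exp (V γ η) ∂(binomialKernel hΔ hb γ) :=
    StronglyMeasurable.integral_kernel_prod_right' (κ := binomialKernel hΔ hb)
      (f := fun q => Real.exp (V q.1 q.2)) (Real.measurable_exp.comp hV).stronglyMeasurable
  exact ((Real.measurable_exp.comp hV).div (h.measurable.comp measurable_fst)).ennreal_ofReal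

/-- The kernel resampling the points in `Δ` with the density proportional to `e^V`. -/
def resampleKernel {Δ : Set (Space d)} (hΔ : MeasurableSet Δ) (hb : IsBounded Δ)
    (V : Configuration d → Configuration d → ℝ) : Kernel (Configuration d) (Configuration d) :=
  Kernel.withDensity (binomialKernel hΔ hb) (resampleDensity Δ V)

instance {Δ : Set (Space d)} (hΔ : MeasurableSet Δ) (hb : IsBounded Δ)
    (V : Configuration d → Configuration d → ℝ) : IsSFiniteKernel (resampleKernel hΔ hb V) :=
  Kernel.IsSFiniteKernel.withDensity _ fun _ _ => ENNReal.ofReal_ne_top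

theorem resampleKernel_apply {Δ : Set (Space d)} (hΔ : MeasurableSet Δ) (hb : IsBounded Δ)
    {V : Configuration d → Configuration d → ℝ} (hV : Measurable (Function.uncurry V))
    (γ : Configuration d) : resampleKernel hΔ hb V γ
      = (binomialProcess Δ (count Δ γ)).withDensity (resampleDensity Δ V γ) :=
  Kernel.withDensity_apply _ (measurable_resampleDensity hΔ hb hV) γ

theorem integral_resampleKernel {Δ : Set (Space d)} (hΔ : MeasurableSet Δ) (hb : IsBounded Δ)
    {V : Configuration d → Configuration d → ℝ} (hV : Measurable (Function.uncurry V))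
    (γ : Configuration d) (F : Configuration d → ℝ) :
    ∫ η, F η ∂(resampleKernel hΔ hb V γ)
      = expAverage (binomialProcess Δ (count Δ γ)) (V γ) F := by
  have hm : Measurable (resampleDensity Δ V γ) :=
    (measurable_resampleDensity hΔ hb hV).comp (measurable_const.prodMk measurable_id)
  have h0 : 0 ≤ ∫ η, Real.exp (V γ η) ∂(binomialProcess Δ (count Δ γ)) :=
    integral_nonneg fun η => (Real.exp_pos _).le
  rw [resampleKernel_apply hΔ hb hV, integral_withDensity_eq_integral_toReal_smul hm
    (Eventually.of_forall fun _ => ENNReal.ofReal_lt_top), expAverage, ← integral_div]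
  refine integral_congr_ae (Eventually.of_forall fun η => ?_)
  simp only [resampleDensity, smul_eq_mul]
  rw [ENNReal.toReal_ofReal (div_nonneg (Real.exp_pos _).le h0)]
  ring

theorem resampleKernel_preimage_glue {Δ : Set (Space d)} (hΔ : MeasurableSet Δ) (hb : IsBounded Δ)
    {V : Configuration d → Configuration d → ℝ} (hV : Measurable (Function.uncurry V))
    {γ : Configuration d}
    (hInt : Integrable (fun η => Real.exp (V γ η)) (binomialProcess Δ (count Δ γ)))
    {E : Set (Configuration d)} (hE : MeasurableSet E) :
    resampleKernel hΔ hb V γ ((fun η => glue Δ η γ) ⁻¹' E)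
      = ENNReal.ofReal (localAverage Δ V E γ) := by
  have hg : Measurable fun η => glue Δ η γ :=
    (measurable_glue hΔ).comp (measurable_id.prodMk measurable_const)
  have hfin : IsFiniteMeasure (resampleKernel hΔ hb V γ) := by
    rw [resampleKernel_apply hΔ hb hV]
    exact isFiniteMeasure_withDensity_ofReal (hInt.div_const _).2
  rw [localAverage, ← integral_resampleKernel hΔ hb hV γ,
    ← ENNReal.ofReal_toReal (measure_ne_top (resampleKernel hΔ hb V γ) _)]
  congr 1
  exact (integral_indicator_one (hg hE)).symm

/-- If the local averages leave `P` invariant on local events, then `P` is invariant under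
resampling. -/
theorem map_glue_compProd_resampleKernel {Δ : Set (Space d)} (hΔ : MeasurableSet Δ)
    (hb : IsBounded Δ) {V : Configuration d → Configuration d → ℝ}
    (hV : Measurable (Function.uncurry V)) {P : Measure (Configuration d)} [IsProbabilityMeasure P]
    (hInt : ∀ᵐ γ ∂P, Integrable (fun η => Real.exp (V γ η)) (binomialProcess Δ (count Δ γ)))
    (hloc : ∀ A : Set (Space d), MeasurableSet A → IsBounded A → ∀ E : Set (Configuration d),
      MeasurableSet[sigmaOf d A] E → P.real E = ∫ γ, localAverage Δ V E γ ∂P) :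
    (P ⊗ₘ resampleKernel hΔ hb V).map (fun q => glue Δ q.2 q.1) = P := by
  have hg : Measurable fun q : Configuration d × Configuration d => glue Δ q.2 q.1 :=
    (measurable_glue hΔ).comp measurable_swap
  have hball (m : ℕ) : MeasurableSet (Metric.closedBall (0 : Space d) m) :=
    Metric.isClosed_closedBall.measurableSet
  have hagree (m : ℕ) (E : Set (Configuration d))
      (hE : MeasurableSet[sigmaOf d (Metric.closedBall 0 m)] E) :
      P E = (P ⊗ₘ resampleKernel hΔ hb V).map (fun q => glue Δ q.2 q.1) E := by
    have hE' : MeasurableSet E := sigmaOf_le _ _ hE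
    rw [Measure.map_apply hg hE', Measure.compProd_apply (hg hE')]
    have h1 : ∫⁻ γ, resampleKernel hΔ hb V γ
        (Prod.mk γ ⁻¹' ((fun q : Configuration d × Configuration d => glue Δ q.2 q.1) ⁻¹' E)) ∂P
        = ∫⁻ γ, ENNReal.ofReal (localAverage Δ V E γ) ∂P := by
      refine lintegral_congr_ae ?_
      filter_upwards [hInt] with γ hγ using resampleKernel_preimage_glue hΔ hb hV hγ hE'
    rw [h1, ← ofReal_integral_eq_lintegral_ofReal (integrable_localAverage hΔ hb hE' hV P)
      (Eventually.of_forall fun γ => (localAverage_mem_Icc hΔ hE' V γ).1),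
      ← hloc _ (hball m) Metric.isBounded_closedBall E hE, ofReal_measureReal]
  symm
  -- Events measurable inside some centred ball form a π-system, because balls are nested, and they
  -- generate the `σ`-algebra.
  refine ext_of_generate_finite
    {E | ∃ m : ℕ, MeasurableSet[sigmaOf d (Metric.closedBall 0 m)] E} ?_ ?_ ?_ ?_
  · refine le_antisymm (iSup_le fun A => ?_) (MeasurableSpace.generateFrom_le ?_)
    · obtain ⟨A, hA, hAb, -⟩ := A
      obtain ⟨r, hr⟩ := hAb.subset_closedBall 0
      obtain ⟨m, hm⟩ := exists_nat_ge r
      intro E hE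
      refine MeasurableSpace.measurableSet_generateFrom ⟨m, ?_⟩
      exact (measurable_count_sigmaOf hA hAb
        (hr.trans (Metric.closedBall_subset_closedBall hm))).comap_le _ hE
    · rintro E ⟨m, hE⟩
      exact sigmaOf_le _ _ hE
  · rintro E ⟨m, hE⟩ F ⟨m', hF⟩ -
    have hmono {k l : ℕ} (h : k ≤ l) : sigmaOf d (Metric.closedBall 0 k)
        ≤ sigmaOf d (Metric.closedBall 0 l) :=
      sigmaOf_mono (Metric.closedBall_subset_closedBall (by exact_mod_cast h))
    exact ⟨max m m', (hmono (le_max_left _ _) _ hE).inter (hmono (le_max_right _ _) _ hF)⟩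
  · rintro E ⟨m, hE⟩
    exact hagree m E hE
  · exact hagree 0 _ MeasurableSet.univ

/-! ### The canonical DLR kernel -/

theorem weight_ae_eq {Δ : Set (Space d)} (hΔ : MeasurableSet Δ) (s β : ℝ) (γ : Configuration d)
    (N : ℕ) : weight s β Δ γ =ᵐ[binomialProcess Δ N]
      fun η => Real.exp (limitPotential s β Δ γ η) := by
  filter_upwards [ae_binomialProcess_subset hΔ N] with η hη
  rw [weight, limitPotential, restrict_of_subset hη]

theorem localPartition_eq {Δ : Set (Space d)} (hΔ : MeasurableSet Δ) (s β : ℝ)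
    (γ : Configuration d) : localPartition s β Δ γ
      = ∫ η, Real.exp (limitPotential s β Δ γ η) ∂(binomialProcess Δ (count Δ γ)) :=
  integral_congr_ae (weight_ae_eq hΔ s β γ _)

theorem dlrAverage_eq {Δ : Set (Space d)} (hΔ : MeasurableSet Δ) (s β : ℝ)
    (f : Configuration d → ℝ) (γ : Configuration d) :
    dlrAverage s β Δ f γ = expAverage (binomialProcess Δ (count Δ γ)) (limitPotential s β Δ γ)
      fun η => f (glue Δ η γ) := by
  rw [dlrAverage, expAverage, ← localPartition_eq hΔ, ← integral_div]
  refine integral_congr_ae ?_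
  filter_upwards [ae_binomialProcess_subset hΔ _, weight_ae_eq hΔ s β γ _] with η hη hw
  rw [hw, glue_of_subset hη]
  ring

/-! ### Dependence on the exterior and conditional expectations. -/

theorem limitPotential_restrict_compl (s β : ℝ) (Δ : Set (Space d)) (γ η : Configuration d) :
    limitPotential s β Δ (γ.restrict Δᶜ) η = limitPotential s β Δ γ η := by
  have h (p : ℕ) : (γ.restrict Δᶜ).carrier ∩ (box d p \ Δ) = γ.carrier ∩ (box d p \ Δ) := by
    ext y
    simp only [restrict, Set.mem_inter_iff, Set.mem_sdiff, Set.mem_compl_iff]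
    tauto
  simp only [limitPotential, move, truncatedMove, h]

theorem glue_restrict_compl_right (Δ : Set (Space d)) (η γ : Configuration d) :
    glue Δ η (γ.restrict Δᶜ) = glue Δ η γ := by
  ext x
  simp only [glue, Configuration.union, restrict, Set.mem_inter_iff, Set.mem_union,
    Set.mem_compl_iff]
  tauto

theorem exteriorSigma_le {Δ : Set (Space d)} (hΔ : MeasurableSet Δ) (hb : IsBounded Δ) :
    exteriorSigma Δ ≤ instMeasurableSpaceConfiguration d :=
  sup_le (measurable_count hΔ hb).comap_le (sigmaOf_le _)

theorem measurable_exteriorSigma_prodMk {Δ : Set (Space d)} (hΔ : MeasurableSet Δ) :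
    Measurable[exteriorSigma Δ] fun γ : Configuration d => (γ.restrict Δᶜ, count Δ γ) :=
  Measurable.prodMk ((measurable_restrict_sigmaOf hΔ.compl).mono le_sup_right le_rfl)
    ((comap_measurable _).mono le_sup_left le_rfl)

/-- The generators of `E_Δ` factor through `γ ↦ (γ_{Δᶜ}, N_Δ(γ))`, hence so does each of its events.
-/
theorem mem_iff_of_exteriorSigma {Δ : Set (Space d)} {S : Set (Configuration d)}
    (hS : MeasurableSet[exteriorSigma Δ] S) {γ γ' : Configuration d}
    (hcount : count Δ γ = count Δ γ') (hrestrict : γ.restrict Δᶜ = γ'.restrict Δᶜ) :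
    γ ∈ S ↔ γ' ∈ S := by
  have hle : exteriorSigma Δ ≤ MeasurableSpace.comap
      (fun γ : Configuration d => (γ.restrict Δᶜ, count Δ γ)) inferInstance := by
    have hmeas := comap_measurable (m := inferInstance)
      fun γ : Configuration d => (γ.restrict Δᶜ, count Δ γ)
    refine sup_le (measurable_snd.comp hmeas).comap_le (iSup_le fun A => ?_)
    obtain ⟨A, hA, hAb, hAΔ⟩ := A
    have h := ((measurable_count hA hAb).comp measurable_fst).comp hmeas
    have heq : (count A ∘ Prod.fst) ∘ (fun γ : Configuration d => (γ.restrict Δᶜ, count Δ γ))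
        = count A := by
      ext γ
      simp only [Function.comp_apply, count_restrict, Set.inter_eq_right.2 hAΔ]
    rw [heq] at h
    exact h.comap_le
  obtain ⟨T, -, rfl⟩ := hle _ hS
  simp only [Set.mem_preimage, hcount, hrestrict]

theorem measurable_exteriorSigma_dlrAverage [NeZero d] {Δ : Set (Space d)} (hΔ : MeasurableSet Δ)
    (hb : IsBounded Δ) (s β : ℝ) {f : Configuration d → ℝ} (hf : Measurable f) :
    Measurable[exteriorSigma Δ] (dlrAverage s β Δ f) := by
  have hfm : Measurable fun q : Configuration d × Configuration d => f (glue Δ q.2 q.1) :=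
    hf.comp ((measurable_glue hΔ).comp measurable_swap)
  have hVm : Measurable fun q : Configuration d × Configuration d =>
      Real.exp (limitPotential s β Δ q.1 q.2) :=
    Real.measurable_exp.comp (measurable_limitPotential hΔ hb s β)
  have hΦ : Measurable fun q : Configuration d × ℕ => expAverage (binomialProcess Δ q.2)
      (limitPotential s β Δ q.1) fun η => f (glue Δ η q.1) := by
    -- The number of points takes countably many values, so it can be frozen; the reference law is
    -- then fixed and ordinary product measurability applies.
    refine measurable_from_prod_countable_left fun N => ?_
    exact ((hfm.mul hVm).stronglyMeasurable.integral_prod_right'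
      (ν := binomialProcess Δ N)).measurable.div
      (hVm.stronglyMeasurable.integral_prod_right' (ν := binomialProcess Δ N)).measurable
  have h := hΦ.comp (measurable_exteriorSigma_prodMk hΔ)
  refine (congrArg (Measurable[exteriorSigma Δ]) (funext fun γ => ?_)).mp h
  simp only [Function.comp_apply, dlrAverage_eq hΔ, glue_restrict_compl_right]
  congr 1
  funext η
  exact limitPotential_restrict_compl s β Δ γ η

/-- Resampling changes neither the exterior configuration nor, almost surely, the number of points
in `Δ`, so it does not move `γ` in or out of `S`. This reduces the defining property of conditional
expectation to the integral identity. -/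
theorem dlrAverage_indicator [NeZero d] {Δ : Set (Space d)} (hΔ : MeasurableSet Δ)
    (hb : IsBounded Δ) (s β : ℝ) (f : Configuration d → ℝ) {S : Set (Configuration d)}
    (hS : MeasurableSet[exteriorSigma Δ] S) {γ : Configuration d}
    (h0 : volume Δ = 0 → count Δ γ = 0) :
    dlrAverage s β Δ (S.indicator f) γ = S.indicator (dlrAverage s β Δ f) γ := by
  have hmem : ∀ᵐ η ∂(binomialProcess Δ (count Δ γ)), glue Δ η γ ∈ S ↔ γ ∈ S := by
    filter_upwards [ae_binomialProcess_count hΔ hb hΔ hb le_rfl h0] with η hη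
    exact mem_iff_of_exteriorSigma hS (by rw [count_glue_self hΔ hb, hη])
      (glue_restrict_compl Δ η γ)
  by_cases hγ : γ ∈ S
  · rw [Set.indicator_of_mem hγ, dlrAverage_eq hΔ, dlrAverage_eq hΔ, expAverage, expAverage]
    congr 1
    refine integral_congr_ae ?_
    filter_upwards [hmem] with η hη
    rw [Set.indicator_of_mem (hη.2 hγ)]
  · rw [Set.indicator_of_notMem hγ, dlrAverage_eq hΔ, expAverage, integral_eq_zero_of_ae,
      zero_div]
    filter_upwards [hmem] with η hη
    rw [Set.indicator_of_notMem (fun h => hγ (hη.1 h)), zero_mul, Pi.zero_apply]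

section Gas

variable [NeZero d] {s β : ℝ} {P : Measure (Configuration d)} {Δ : Set (Space d)}

theorem ae_integrable_exp_limitPotential (hs : 0 < s) (hsd : (d : ℝ) < s + 1) (hβ : 0 < β)
    (hI : IntensityLE P) (hΔ : MeasurableSet Δ) (hb : IsBounded Δ) :
    ∀ᵐ γ ∂P, Integrable (fun η => Real.exp (limitPotential s β Δ γ η))
      (binomialProcess Δ (count Δ γ)) := by
  obtain ⟨D, hD0, hD⟩ := exists_subset_closedBall hb
  obtain ⟨p, hp⟩ := ((tendsto_side d).eventually_ge_atTop (2 * (2 * D + 1))).exists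
  filter_upwards [hI.ae_tail_ne_top hsd p, hI.ae_count_eq_zero hΔ hb] with γ hT h0
  exact integrable_exp_limitPotential hs hβ hΔ hD0 hD (by linarith) hT h0

theorem integrable_dlrAverage_and_integral_eq (hs : 0 < s) (hsd : (d : ℝ) < s + 1) (hβ : 0 < β)
    (hP : IsCircularRieszGas s β P) (hΔ : MeasurableSet Δ) (hb : IsBounded Δ)
    {f : Configuration d → ℝ} (hf : Measurable f) {C : ℝ} (hC : ∀ γ, |f γ| ≤ C) :
    Integrable (dlrAverage s β Δ f) P ∧ ∫ γ, f γ ∂P = ∫ γ, dlrAverage s β Δ f γ ∂P := by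
  have := hP.1
  have hV := measurable_limitPotential hΔ hb s β
  have hinv := map_glue_compProd_resampleKernel hΔ hb hV (P := P)
    (ae_integrable_exp_limitPotential hs hsd hβ
      (intensityLE_of_isCircularRieszGas hs hsd hβ hP) hΔ hb)
    fun A hA hAb E hE => real_eq_integral_localAverage_of_local hs hsd hβ hP hΔ hb hA hAb hE
  have hg : Measurable fun q : Configuration d × Configuration d => glue Δ q.2 q.1 :=
    (measurable_glue hΔ).comp measurable_swap
  have hfP : Integrable f P :=
    Integrable.of_bound hf.aestronglyMeasurable C (Eventually.of_forall hC)
  have hF : Integrable (fun q : Configuration d × Configuration d => f (glue Δ q.2 q.1))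
      (P ⊗ₘ resampleKernel hΔ hb (limitPotential s β Δ)) := by
    rw [← hinv] at hfP
    -- Invariance of `P` makes integrability on the product automatic, so the average of `f` is
    -- integrable by Fubini.
    exact hfP.comp_measurable hg
  have hD (γ : Configuration d) : dlrAverage s β Δ f γ
      = ∫ η, f (glue Δ η γ) ∂(resampleKernel hΔ hb (limitPotential s β Δ) γ) := by
    rw [integral_resampleKernel hΔ hb hV, dlrAverage_eq hΔ]
  constructor
  · rw [funext hD]
    rw [Measure.compProd] at hF
    exact hF.integral_compProd
  · simp only [hD]
    rw [← Measure.integral_compProd hF]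
    conv_lhs => rw [← hinv]
    exact integral_map hg.aemeasurable hf.aestronglyMeasurable

theorem condExp_exteriorSigma_ae_eq (hs : 0 < s) (hsd : (d : ℝ) < s + 1) (hβ : 0 < β)
    (hP : IsCircularRieszGas s β P) (hΔ : MeasurableSet Δ) (hb : IsBounded Δ)
    {f : Configuration d → ℝ} (hf : Measurable f) {C : ℝ} (hC : ∀ γ, |f γ| ≤ C) :
    condExp (exteriorSigma Δ) P f =ᵐ[P] dlrAverage s β Δ f := by
  have := hP.1
  have hm := exteriorSigma_le hΔ hb
  have hI := intensityLE_of_isCircularRieszGas hs hsd hβ hP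
  have hInt := (integrable_dlrAverage_and_integral_eq hs hsd hβ hP hΔ hb hf hC).1
  symm
  refine ae_eq_condExp_of_forall_setIntegral_eq hm
    (Integrable.of_bound hf.aestronglyMeasurable C (Eventually.of_forall hC))
    (fun _ _ _ => hInt.integrableOn) (fun S hS _ => ?_)
    (measurable_exteriorSigma_dlrAverage hΔ hb s β hf).stronglyMeasurable.aestronglyMeasurable
  have hS' : MeasurableSet S := hm _ hS
  have hCS (γ : Configuration d) : |S.indicator f γ| ≤ C := by
    by_cases hγ : γ ∈ S
    · rw [Set.indicator_of_mem hγ]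
      exact hC γ
    · rw [Set.indicator_of_notMem hγ, abs_zero]
      exact (abs_nonneg _).trans (hC γ)
  rw [← integral_indicator hS', ← integral_indicator hS',
    (integrable_dlrAverage_and_integral_eq hs hsd hβ hP hΔ hb (hf.indicator hS') hCS).2]
  refine integral_congr_ae ?_
  filter_upwards [hI.ae_count_eq_zero hΔ hb] with γ h0
  exact (dlrAverage_indicator hΔ hb s β f hS h0).symm

end Gas

end RieszGas

end

/-! ### The theorem for circular Riesz gases. -/

theorem mainTheorem2 (d : ℕ) (hd : 1 ≤ d) (s : ℝ) (hs : (d : ℝ) - 1 < s) (hsd : s < (d : ℝ))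
    (β : ℝ) (hβ : 0 < β)
    (P : MeasureTheory.Measure (RieszGas.Configuration d))
    (hP : RieszGas.IsCircularRieszGas s β P)
    (Δ : Set (RieszGas.Space d)) (hΔ : MeasurableSet Δ) (hΔb : Bornology.IsBounded Δ) :
    -- almost surely, `0 ∉ γ` and the limit defining the move cost exists for every `η`
    (∀ᵐ γ ∂P, (0 : RieszGas.Space d) ∉ γ.carrier ∧
      ∀ η : RieszGas.Configuration d,
        Filter.Tendsto (fun p : ℕ => RieszGas.truncatedMove s Δ p η γ) Filter.atTop
          (nhds (RieszGas.move s Δ η γ))) ∧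
    -- almost surely, the normalisation constant is finite and positive
    (∀ᵐ γ ∂P,
      MeasureTheory.Integrable (RieszGas.weight s β Δ γ)
        (RieszGas.binomialProcess Δ (RieszGas.Configuration.count Δ γ)) ∧
      0 < RieszGas.localPartition s β Δ γ) ∧
    -- the canonical DLR equations, and their formulation as conditional expectations
    (∀ f : RieszGas.Configuration d → ℝ, Measurable f → (∃ C : ℝ, ∀ γ, |f γ| ≤ C) →
      MeasureTheory.Integrable (RieszGas.dlrAverage s β Δ f) P ∧
      ∫ γ, f γ ∂P = ∫ γ, RieszGas.dlrAverage s β Δ f γ ∂P ∧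
      MeasureTheory.condExp (RieszGas.exteriorSigma Δ) P f
        =ᵐ[P] RieszGas.dlrAverage s β Δ f) := by
  have : NeZero d := ⟨by omega⟩
  have hd' : (1 : ℝ) ≤ d := by exact_mod_cast hd
  have hs0 : 0 < s := by linarith
  have hsd1 : (d : ℝ) < s + 1 := by linarith
  have hI := RieszGas.intensityLE_of_isCircularRieszGas hs0 hsd1 hβ hP
  obtain ⟨D, hD0, hD⟩ := RieszGas.exists_subset_closedBall hΔb
  refine ⟨?_, ?_, fun f hf ⟨C, hC⟩ => ?_⟩
  -- Finiteness of the tail at one index suffices; `Λ_0` reduces to the origin.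
  · filter_upwards [hI.ae_zero_notMem, hI.ae_tail_ne_top hsd1 0] with γ h0 hT
    exact ⟨h0, RieszGas.tendsto_truncatedMove hs0 hD0 hD hT⟩
  · filter_upwards [RieszGas.ae_integrable_exp_limitPotential hs0 hsd1 hβ hI hΔ hΔb,
      hI.ae_count_eq_zero hΔ hΔb] with γ hγ h0
    have := RieszGas.isProbabilityMeasure_binomialProcess_of hΔb h0
    refine ⟨hγ.congr (RieszGas.weight_ae_eq hΔ s β γ _).symm, ?_⟩
    rw [RieszGas.localPartition_eq hΔ]
    exact integral_exp_pos hγ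
  · obtain ⟨h1, h2⟩ :=
      RieszGas.integrable_dlrAverage_and_integral_eq hs0 hsd1 hβ hP hΔ hΔb hf hC
    exact ⟨h1, h2, RieszGas.condExp_exteriorSigma_ae_eq hs0 hsd1 hβ hP hΔ hΔb hf hC⟩
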